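/- Units $G=c=1$. Let $M>0$ and $M_1,\alpha_1,C_1\in\mathbb R$. On $r>2M$ let $f=1-2M/r$, $y=-f\,dt^2+f^{-1}dr^2$, $\gamma=d\theta^2+\sin^2\theta\,d\phi^2$, and let $g=y+r^2\gamma$ be the Schwarzschild metric; vector fields are given by their covariant components, and $\mathcal L$ is the Lie derivative. The non-rotating C-metric with parameters $(m,\alpha,C)$ is $$\bar g(m,\alpha,C)=\frac{1}{(1+\alpha r\cos\theta)^2}\Big(-Q\,dt^2+\frac{dr^2}{Q}+\frac{r^2}{P}d\theta^2+P\,C^2r^2\sin^2\theta\,d\phi^2\Big),$$ $P=1+2\alpha m\cos\theta$, $Q=(1-\alpha^2r^2)(1-2m/r)$. Let $h=\frac{d}{d\epsilon}\big|_{\epsilon=0}\bar g(M+\epsilon M_1,\epsilon\alpha_1,1+\epsilon C_1)$ be the linearized C-metric, let $h^{(l)}$ be its part of degree $l\ge0$ in the decomposition into the scalar, vector and tensor harmonics on $S^2$ generated by the Legendre functions $P_l(\cos\theta)$, and let $T^{(l)}=\frac1{8\pi}G^{(1)}[h^{(l)}]$, where $G^{(1)}$ is the Einstein tensor linearized at $g$.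 Put $$\lambda_l=-\frac{2l+1}{16\pi}\big[(2\alpha_1M+C_1)+(-2\alpha_1M+C_1)(-1)^l\big].$$ **(1) $l=0$.** $h^{(0)}=\frac{2M_1}{r}(dt^2+f^{-2}dr^2)+r^2C_1\gamma$. Consider functions $\Upsilon_{M_1}(t,r)$ of class $C^3$ with $$-\tfrac1f\partial_t^2\Upsilon_{M_1}+\partial_r(f\partial_r\Upsilon_{M_1})+\tfrac{3(1-f)}{r^2}\Upsilon_{M_1}-\tfrac4{r^3}2M_1t=0 .$$ Such functions exist, and for each of them, with $$V_{(M_1)}=\tfrac f4(\Upsilon_{M_1}+r\partial_r\Upsilon_{M_1})dt+\tfrac{r}{4f}\partial_t\Upsilon_{M_1}\,dr,\qquad V_{(C_1)}=\tfrac12ftC_1\,dt+\tfrac r{2f}C_1\,dr,$$ one has $$h^{(0)}+\mathcal L_{V_{(M_1)}}g=\Big(\frac{2M_1}{r}+\frac{1-3f}{2}C_1\Big)(dt^2+f^{-2}dr^2)+\mathcal L_{V_{(M_1)}+V_{(C_1)}}g .$$ This tensor is the $l=0$ even-mode solution $$\tfrac2r\Big(M_1+4\pi\!\int\!\tfrac{r^2}{f}\tilde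 T_{tt}dr\Big)(dt^2+f^{-2}dr^2)+4\pi r\Big[\int\!\big(\tfrac1f\tilde T_{tt}+f\tilde T_{rr}\big)dt\Big](dt\,dr+dr\,dt)+\mathcal L_Vg,$$ $$V=\Big(\tfrac f4\Upsilon+\tfrac{rf}4\partial_r\Upsilon-\tfrac{r\Xi}{1-3f}+f\!\int\!\tfrac{2\Xi}{f(1-3f)^2}dr\Big)dt+\tfrac r{4f}\partial_t\Upsilon\,dr,$$ for the source $\tilde T_{tt}=f\lambda_0/r^2$, $\tilde T_{rr}=-\lambda_0/(fr^2)$, $\tilde T_{tr}=0$, with $\Upsilon=\Upsilon_{M_1}+2C_1t$, $\Xi=0$, the antiderivative $\int\frac{r^2}{f}\tilde T_{tt}dr=\frac{1-3f}{16\pi}rC_1$ and the other antiderivatives equal to $0$, so that $V=V_{(M_1)}+V_{(C_1)}$. The source satisfies the $l=0$ continuity equations $-\partial_t\tilde T_{tt}+f^2\partial_r\tilde T_{tr}+\frac{(1+f)f}r\tilde T_{tr}=0$ and $-\partial_t\tilde T_{tr}+\frac{1-f}{2rf}\tilde T_{tt}+f^2\partial_r\tilde T_{rr}+\frac{(3+f)f}{2r}\tilde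 T_{rr}=0$, and $F=\partial_t\Upsilon$ satisfies $$-\tfrac1f\partial_t^2F+\partial_r(f\partial_rF)+\tfrac{3(1-f)}{r^2}F-\tfrac{8}{r^3}\Big(M_1+4\pi\!\int\!\tfrac{r^2}{f}\tilde T_{tt}dr\Big)=16\pi\big(-\tfrac1f\tilde T_{tt}+f\tilde T_{rr}\big).$$ **(2) $l=1$.** $h^{(1)}=-2\alpha_1r\cos\theta\,g$. The $l=1$, $m=0$ even-mode solution with source $(\tilde T_{tt},\tilde T_{tr},\tilde T_{rr},\tilde T_{(e0)},\tilde T_{(e1)t},\tilde T_{(e1)r})$ is $$\mathcal F=\mathcal L_{V_{(vac)}}g-\tfrac{16\pi r^2}{3(1-f)}\Big[f^2\big\{\tfrac{1+f}2\tilde T_{rr}+rf\partial_r\tilde T_{rr}-\tilde T_{(e0)}-4\tilde T_{(e1)r}\big\}dt^2+\tfrac rf\big\{\partial_t\tilde T_{tt}-\tfrac{3f(1-f)}{2r}\tilde T_{tr}\big\}(dt\,dr+dr\,dt)$$ $$\qquad+\tfrac rf\big\{\partial_r\tilde T_{tt}-\tfrac{3(1-3f)}{2rf}\tilde T_{tt}\big\}dr^2+r^2\tilde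 T_{tt}\gamma\Big]\cos\theta,$$ $$V_{(vac)}=-r\partial_t\Phi\cos\theta\,dt+(\Phi-r\partial_r\Phi)\cos\theta\,dr-r\Phi\sin\theta\,d\theta,$$ where the source satisfies the $l=1$ continuity equations $$-\partial_t\tilde T_{tt}+f^2\partial_r\tilde T_{tr}+\tfrac{(1+f)f}r\tilde T_{tr}-\tfrac{2f}r\tilde T_{(e1)t}=0,$$ $$-\partial_t\tilde T_{tr}+\tfrac{1-f}{2rf}\tilde T_{tt}+f^2\partial_r\tilde T_{rr}+\tfrac{(3+f)f}{2r}\tilde T_{rr}-\tfrac{2f}r\tilde T_{(e1)r}-\tfrac fr\tilde T_{(e0)}=0,$$ $$-\partial_t\tilde T_{(e1)t}+f^2\partial_r\tilde T_{(e1)r}+\tfrac{(1+2f)f}r\tilde T_{(e1)r}+\tfrac f{2r}\tilde T_{(e0)}=0,$$ and $\Phi(t,r)$ is a $C^2$ solution of the $l=1$ master equation, with $\Lambda=3(1-f)$, $$-\tfrac1f\partial_t^2\Phi+\partial_r(f\partial_r\Phi)-\tfrac{1}{r^2\Lambda^2}\big[\Lambda^3-2(2-3f)\Lambda^2+6(1-3f)(1-f)\Lambda+18f(1-f)^2\big]\Phi=16\pi\tfrac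 r\Lambda S,$$ $$S=\tfrac12\big(\tfrac\Lambda{2f}-1\big)\tilde T_{tt}+\tfrac12\big(2-f-\tfrac\Lambda2\big)f\tilde T_{rr}-\tfrac r2\partial_r\tilde T_{tt}+\tfrac{f^2r}2\partial_r\tilde T_{rr}-\tfrac f2\tilde T_{(e0)}-2f\tilde T_{(e1)r}-\tfrac{3(1-f)}\Lambda\tilde T_{tt}.$$ For every constant $\lambda$ the source $\tilde T_{tt}=f\lambda/r^2$, $\tilde T_{rr}=-\lambda/(fr^2)$, all others $0$, satisfies the $l=1$ continuity equations and admits such a $\Phi$, and for every such $\Phi$, with $W=-\frac{16\pi\lambda}{6(1-f)}(r\cos\theta\,dr+r^2\sin\theta\,d\theta)$, $$\mathcal F=\mathcal L_{V_{(vac)}+W}g+\frac{16\pi\lambda}{3(1-f)}\cos\theta\,g .$$ The last term equals $h^{(1)}$ if and only if $\lambda=\lambda_1$, i.e. $16\pi\lambda=-12\alpha_1M$; hence for $\lambda=\lambda_1$ one has $\mathcal F=h^{(1)}+\mathcal L_{V_{(vac)}+W}g$. **(3) Tension formula.** For every $l\ge0$ and $\lambda\in\mathbb R$: $T^{(l)}_{ab}=-\frac1{r^2}\lambda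 P_l(\cos\theta)\,y_{ab}$ on $r>2M$, $0<\theta<\pi$, if and only if $\lambda=\lambda_l$. **(4) Sum over the modes.** For all $t$ and $r>2M$, in the sense of distributions on $S^2$ (convergence of the partial sums tested against each smooth function on $S^2$ with $d\Omega=\sin\theta\,d\theta\,d\phi$), $$\sum_{l=0}^\infty T^{(l)}_{ab}=-\frac1{r^2}y_{ab}\big[\mu_n\delta^2(n-n_{north})+\mu_s\delta^2(n-n_{south})\big],\qquad \mu_n=-\frac{2\alpha_1M+C_1}4,\quad \mu_s=\frac{2\alpha_1M-C_1}4 ,$$ the energy-momentum tensor of two half-infinite strings with constant line densities $\mu_n$ and $\mu_s$ along the north and the south half of the symmetry axis. -/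

import Mathlib

open Real Filter Topology
open scoped Matrix ContDiff Manifold

noncomputable section

namespace CMetricPert

/-! Coordinates are `x = ![t, r, θ, φ]`. A tensor field with two lower indices is given by its
components in this chart, a covector field likewise. -/

/-- Covariant two-tensor fields in the chart `(t, r, θ, φ)`. -/
abbrev TensorField := (Fin 4 → ℝ) → Matrix (Fin 4) (Fin 4) ℝ

/-- Covector fields in the chart `(t, r, θ, φ)`. -/
abbrev CovectorField := (Fin 4 → ℝ) → Fin 4 → ℝ

/-- The partial derivative `∂F/∂x^c`. -/
def pd (c : Fin 4) (F : (Fin 4 → ℝ) → ℝ) (x : Fin 4 → ℝ) : ℝ :=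
  deriv (fun s => F (Function.update x c s)) (x c)

/-- `∂F/∂t` for a function of `(t, r)`. -/
def dt (F : ℝ → ℝ → ℝ) (t r : ℝ) : ℝ := deriv (fun s => F s r) t

/-- `∂F/∂r` for a function of `(t, r)`. -/
def dr (F : ℝ → ℝ → ℝ) (t r : ℝ) : ℝ := deriv (fun s => F t s) r

/-! ### Lie derivatives of a metric and the linearized Einstein tensor -/

/-- Lie derivative of the metric `g` along the vector field `V^a = g^{ab} V_b`:
`V^c ∂_c g_{ab} + g_{cb} ∂_a V^c + g_{ac} ∂_b V^c`. -/
def lieMetric (g : TensorField) (V : CovectorField) : TensorField := fun x =>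
  Matrix.of fun a b =>
    ∑ c, (((g x)⁻¹ *ᵥ V x) c * pd c (fun y => g y a b) x
      + g x c b * pd a (fun y => ((g y)⁻¹ *ᵥ V y) c) x
      + g x a c * pd b (fun y => ((g y)⁻¹ *ᵥ V y) c) x)

/-- Christoffel symbols `Γ^c_{ab}` of `g`. -/
def christoffel (g : TensorField) (c a b : Fin 4) (x : Fin 4 → ℝ) : ℝ :=
  (1 / 2) * ∑ d, (g x)⁻¹ c d *
    (pd a (fun y => g y d b) x + pd b (fun y => g y d a) x - pd d (fun y => g y a b) x)

/-- Covariant derivative `∇_c h_{ab}`. -/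
def covDeriv (g h : TensorField) (c a b : Fin 4) (x : Fin 4 → ℝ) : ℝ :=
  pd c (fun y => h y a b) x
    - ∑ e, (christoffel g e c a x * h x e b + christoffel g e c b x * h x a e)

/-- First-order change of the connection,
`C^c_{ab} = g^{cd} (∇_a h_{db} + ∇_b h_{da} - ∇_d h_{ab}) / 2`. -/
def linConnection (g h : TensorField) (c a b : Fin 4) (x : Fin 4 → ℝ) : ℝ :=
  (1 / 2) * ∑ d, (g x)⁻¹ c d *
    (covDeriv g h a d b x + covDeriv g h b d a x - covDeriv g h d a b x)

/-- Covariant derivative `∇_c C^d_{ab}`. -/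
def covDerivConnection (g h : TensorField) (c d a b : Fin 4) (x : Fin 4 → ℝ) : ℝ :=
  pd c (linConnection g h d a b) x
    + ∑ e, (christoffel g d c e x * linConnection g h e a b x
      - christoffel g e c a x * linConnection g h d e b x
      - christoffel g e c b x * linConnection g h d a e x)

/-- Linearized Ricci tensor `∇_c C^c_{ab} - ∇_b C^c_{ac}`. -/
def linRicci (g h : TensorField) : TensorField := fun x =>
  Matrix.of fun a b =>
    ∑ c, (covDerivConnection g h c c a b x - covDerivConnection g h b c a c x)

/-- Linearization at a Ricci-flat metric `g`, in the direction `h`, of the Einstein tensor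
`G_{ab} = R_{ab} - g_{ab} R / 2`. (The further terms contain the Ricci tensor of `g`.) -/
def linEinstein (g h : TensorField) : TensorField := fun x =>
  linRicci g h x - ((1 / 2) * ∑ c, ∑ d, (g x)⁻¹ c d * linRicci g h x c d) • g x

/-! ### Schwarzschild background and C-metric -/

/-- `f = 1 - 2M/r`. -/
def f (M r : ℝ) : ℝ := 1 - 2 * M / r

/-- The chart domain: exterior region `r > 2M`, away from the axis. -/
def exterior (M : ℝ) : Set (Fin 4 → ℝ) := {x | 2 * M < x 1 ∧ 0 < x 2 ∧ x 2 < π}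

/-- The region `r > 2M` of the `(t, r)` half plane. -/
def exteriorTR (M : ℝ) : Set (ℝ × ℝ) := {p | 2 * M < p.2}

/-- The `(t, r)` part `y_{ab} = - f dt² + f⁻¹ dr²` of the background metric. -/
def yTensor (M : ℝ) : TensorField := fun x =>
  Matrix.diagonal ![-f M (x 1), (f M (x 1))⁻¹, 0, 0]

/-- The unit sphere metric `γ_{ab} = dθ² + sin² θ dφ²`. -/
def gammaTensor : TensorField := fun x => Matrix.diagonal ![0, 0, 1, sin (x 2) ^ 2]

/-- The Schwarzschild metric `g_{ab} = y_{ab} + r² γ_{ab}`. -/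
def schwarzschild (M : ℝ) : TensorField := fun x => yTensor M x + x 1 ^ 2 • gammaTensor x

/-- `dt² + f⁻² dr²`. -/
def massTensor (M : ℝ) : TensorField := fun x => Matrix.diagonal ![1, (f M (x 1) ^ 2)⁻¹, 0, 0]

/-- The non-rotating C-metric with mass `m`, acceleration `α` and conicity parameter `C`; the
rotational coordinate is rescaled to have period `2π`. -/
def cMetric (m α C : ℝ) : TensorField := fun x =>
  let r := x 1
  let θ := x 2
  let P := 1 + 2 * α * m * cos θ
  let Q := (1 - α ^ 2 * r ^ 2) * (1 - 2 * m / r)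
  (1 / (1 + α * r * cos θ) ^ 2) •
    Matrix.diagonal ![-Q, 1 / Q, r ^ 2 / P, P * C ^ 2 * r ^ 2 * sin θ ^ 2]

/-- The linearized C-metric: the `ε`-derivative at `ε = 0` of the C-metric with parameters
`M + ε M₁`, `ε α₁`, `1 + ε C₁`. -/
def linCMetric (M M₁ α₁ C₁ : ℝ) : TensorField := fun x =>
  Matrix.of fun a b => deriv (fun ε => cMetric (M + ε * M₁) (ε * α₁) (1 + ε * C₁) x a b) 0

/-! ### Harmonic decomposition with respect to `P_l (cos θ)` -/

/-- The Legendre polynomial `P_l`, by the Rodrigues formula. -/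
def legendreP (l : ℕ) : Polynomial ℝ :=
  Polynomial.C (1 / (2 ^ l * (l.factorial : ℝ))) *
    (Polynomial.derivative)^[l] ((Polynomial.X ^ 2 - 1) ^ l)

/-- `P_l (cos θ)`. -/
def harm (l : ℕ) (θ : ℝ) : ℝ := (legendreP l).eval (cos θ)

/-- `P_l' (cos θ)`. -/
def harm' (l : ℕ) (θ : ℝ) : ℝ := (legendreP l).derivative.eval (cos θ)

/-- The associated Legendre function `P_l² (z) = (1 - z²) P_l'' (z)` at `z = cos θ`. -/
def harm2 (l : ℕ) (θ : ℝ) : ℝ :=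
  (1 - cos θ ^ 2) * (legendreP l).derivative.derivative.eval (cos θ)

/-- Integral over the unit sphere, `∫ u sin θ dθ dφ`. -/
def sphereIntegral (u : ℝ → ℝ → ℝ) : ℝ :=
  ∫ φ in (-π)..π, ∫ θ in (0 : ℝ)..π, u θ φ * sin θ

/-- Coefficient of `u` along the scalar harmonic `P_l`. -/
def scalarCoeff (l : ℕ) (u : ℝ → ℝ → ℝ) : ℝ :=
  (2 * l + 1) / (4 * π) * sphereIntegral fun θ φ => u θ φ * harm l θ

/-- Coefficient, along the gradient of `P_l`, of the covector field on the sphere whose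
`θ`-component is `u`. For `l = 0` the harmonic vanishes. -/
def evenVectorCoeff (l : ℕ) (u : ℝ → ℝ → ℝ) : ℝ :=
  (2 * l + 1) / (4 * π * (l * (l + 1))) *
    sphereIntegral fun θ φ => u θ φ * (-sin θ * harm' l θ)

/-- Coefficient, along the rotated gradient of `P_l`, of the covector field on the sphere whose
`φ`-component is `u`. For `l = 0` the harmonic vanishes. -/
def oddVectorCoeff (l : ℕ) (u : ℝ → ℝ → ℝ) : ℝ :=
  (2 * l + 1) / (4 * π * (l * (l + 1))) * sphereIntegral fun θ φ => u θ φ * harm' l θ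

/-- Coefficient, along the traceless even harmonic `(D_p D_q - γ_{pq} D²/2) P_l`, of the traceless
tensor on the sphere with components `u` and `-u` in the orthonormal directions `θ θ` and `φ φ`.
For `l ≤ 1` the harmonic vanishes. -/
def evenTensorCoeff (l : ℕ) (u : ℝ → ℝ → ℝ) : ℝ :=
  (2 * l + 1) / (2 * π * (((l : ℝ) - 1) * l * (l + 1) * (l + 2))) *
    sphereIntegral fun θ φ => u θ φ * harm2 l θ

/-- Coefficient, along the traceless odd harmonic `2 P_l² θ_{(p} φ_{q)}`, of the traceless tensor
on the sphere with orthonormal `θ φ`-component `u`. For `l ≤ 1` the harmonic vanishes. -/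
def oddTensorCoeff (l : ℕ) (u : ℝ → ℝ → ℝ) : ℝ :=
  (2 * l + 1) / (4 * π * (((l : ℝ) - 1) * l * (l + 1) * (l + 2))) *
    sphereIntegral fun θ φ => u θ φ * harm2 l θ

/-- The part of `h` of degree `l` (and `m = 0`) in its decomposition into the scalar, vector and
tensor harmonics generated by `P_l (cos θ)`. -/
def modePart (l : ℕ) (h : TensorField) : TensorField := fun x =>
  let t := x 0
  let r := x 1
  let θ := x 2
  let u : Fin 4 → Fin 4 → ℝ → ℝ → ℝ := fun a b ϑ ϕ => h ![t, r, ϑ, ϕ] a b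
  let htt := scalarCoeff l (u 0 0)
  let htr := scalarCoeff l (u 0 1)
  let hrr := scalarCoeff l (u 1 1)
  let e1t := evenVectorCoeff l fun ϑ ϕ => u 0 2 ϑ ϕ / r
  let e1r := evenVectorCoeff l fun ϑ ϕ => u 1 2 ϑ ϕ / r
  let o1t := oddVectorCoeff l fun ϑ ϕ => u 0 3 ϑ ϕ / r
  let o1r := oddVectorCoeff l fun ϑ ϕ => u 1 3 ϑ ϕ / r
  let e0 := scalarCoeff l fun ϑ ϕ => (u 2 2 ϑ ϕ + u 3 3 ϑ ϕ / sin ϑ ^ 2) / r ^ 2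
  let e2 := evenTensorCoeff l fun ϑ ϕ => (u 2 2 ϑ ϕ - u 3 3 ϑ ϕ / sin ϑ ^ 2) / (2 * r ^ 2)
  let o2 := oddTensorCoeff l fun ϑ ϕ => u 2 3 ϑ ϕ / (r ^ 2 * sin ϑ)
  let vE := -sin θ * harm' l θ
  let vO := sin θ ^ 2 * harm' l θ
  let θφ := r ^ 2 * (o2 * harm2 l θ * sin θ)
  !![htt * harm l θ, htr * harm l θ, r * (e1t * vE), r * (o1t * vO);
     htr * harm l θ, hrr * harm l θ, r * (e1r * vE), r * (o1r * vO);
     r * (e1t * vE), r * (e1r * vE),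
       r ^ 2 * (e0 * harm l θ / 2 + e2 * harm2 l θ / 2), θφ;
     r * (o1t * vO), r * (o1r * vO), θφ,
       r ^ 2 * sin θ ^ 2 * (e0 * harm l θ / 2 - e2 * harm2 l θ / 2)]

/-- The energy-momentum tensor of the `l`-mode of the linearized C-metric, as determined by the
linearized Einstein equation `G_{ab} = 8π T_{ab}`. -/
def stressMode (M M₁ α₁ C₁ : ℝ) (l : ℕ) : TensorField := fun x =>
  (1 / (8 * π)) • linEinstein (schwarzschild M) (modePart l (linCMetric M M₁ α₁ C₁)) x

/-! ### The `l = 0` even-mode solution -/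

/-- Mode coefficients of the energy-momentum perturbation for `l = 0`, as functions of `(t, r)`. -/
structure MonopoleSource where
  tt : ℝ → ℝ → ℝ
  tr : ℝ → ℝ → ℝ
  rr : ℝ → ℝ → ℝ

/-- The generator of the `l = 0` solution. Here `K` stands for `∫ 2 Ξ / (f (1 - 3f)²) dr`. -/
def monopoleGenerator (M : ℝ) (Υ : ℝ → ℝ → ℝ) (Ξ K : ℝ → ℝ) : CovectorField := fun x =>
  let t := x 0
  let r := x 1
  ![f M r / 4 * Υ t r + r * f M r / 4 * dr Υ t r - r * Ξ r / (1 - 3 * f M r) + f M r * K r,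
    1 / (4 * f M r) * r * dt Υ t r, 0, 0]

/-- The `l = 0` solution. Here `I` stands for `∫ (r² / f) T_tt dr` and `J` for
`∫ (T_tt / f + f T_rr) dt`. -/
def monopoleSolution (M M₁ : ℝ) (I J Υ : ℝ → ℝ → ℝ) (Ξ K : ℝ → ℝ) : TensorField := fun x =>
  let t := x 0
  let r := x 1
  (2 / r * (M₁ + 4 * π * I t r)) • massTensor M x
    + (4 * π * r * J t r) • !![0, 1, 0, 0; 1, 0, 0, 0; 0, 0, 0, 0; 0, 0, 0, 0]
    + lieMetric (schwarzschild M) (monopoleGenerator M Υ Ξ K) x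

/-- The conditions on the data of the `l = 0` solution: the source obeys the continuity equation,
`I`, `J`, `K` are the antiderivatives that they stand for, and `F = ∂_t Υ` obeys its evolution
equation, in which the `l = 0` Moncrief variable `Φ` (times `1 - 3f`) is `-2 (M₁ + 4π I)`. -/
structure IsMonopoleData (M M₁ : ℝ) (T : MonopoleSource) (I J Υ : ℝ → ℝ → ℝ) (Ξ K : ℝ → ℝ) :
    Prop where
  continuity_t : ∀ t r, 2 * M < r →
    -dt T.tt t r + f M r ^ 2 * dr T.tr t r + (1 + f M r) * f M r / r * T.tr t r = 0
  continuity_r : ∀ t r, 2 * M < r →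
    -dt T.tr t r + (1 - f M r) / (2 * r * f M r) * T.tt t r + f M r ^ 2 * dr T.rr t r
      + (3 + f M r) * f M r / (2 * r) * T.rr t r = 0
  hasDerivAt_I : ∀ t r, 2 * M < r → HasDerivAt (fun s => I t s) (r ^ 2 / f M r * T.tt t r) r
  hasDerivAt_J : ∀ t r, 2 * M < r →
    HasDerivAt (fun s => J s r) (1 / f M r * T.tt t r + f M r * T.rr t r) t
  hasDerivAt_K : ∀ r, 2 * M < r → r ≠ 3 * M →
    HasDerivAt K (2 * Ξ r / (f M r * (1 - 3 * f M r) ^ 2)) r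
  contDiffOn : ContDiffOn ℝ 3 (fun p : ℝ × ℝ => Υ p.1 p.2) (exteriorTR M)
  evolution : ∀ t r, 2 * M < r →
    -(1 / f M r) * dt (dt (dt Υ)) t r + dr (fun τ ρ => f M ρ * dr (dt Υ) τ ρ) t r
      + 1 / r ^ 2 * (3 * (1 - f M r)) * dt Υ t r
      + 4 / r ^ 3 * (-2 * (M₁ + 4 * π * I t r))
      = 16 * π * (-(1 / f M r) * T.tt t r + f M r * T.rr t r)

/-- `Υ` is a gauge function for the mass perturbation `M₁`:
`- ∂_t² Υ / f + ∂_r (f ∂_r Υ) + 3 (1 - f) Υ / r² - (4 / r³) 2 M₁ t = 0`. -/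
structure IsMassGauge (M M₁ : ℝ) (Υ : ℝ → ℝ → ℝ) : Prop where
  contDiffOn : ContDiffOn ℝ 3 (fun p : ℝ × ℝ => Υ p.1 p.2) (exteriorTR M)
  equation : ∀ t r, 2 * M < r →
    -(1 / f M r) * dt (dt Υ) t r + dr (fun τ ρ => f M ρ * dr Υ τ ρ) t r
      + 1 / r ^ 2 * (3 * (1 - f M r)) * Υ t r - 4 / r ^ 3 * (2 * M₁ * t) = 0

/-- The generator `V_(M₁)` of the mass perturbation. -/
def massGenerator (M : ℝ) (Υ : ℝ → ℝ → ℝ) : CovectorField := fun x =>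
  let t := x 0
  let r := x 1
  ![1 / 4 * f M r * (Υ t r + r * dr Υ t r), 1 / (4 * f M r) * r * dt Υ t r, 0, 0]

/-- The generator `V_(C₁) = f t C₁ dt / 2 + r C₁ dr / (2 f)`. -/
def conicityGenerator (M C₁ : ℝ) : CovectorField := fun x =>
  ![1 / 2 * f M (x 1) * x 0 * C₁, x 1 / (2 * f M (x 1)) * C₁, 0, 0]

/-- The `l = 0` source `-(λ / r²) y_{ab}`. -/
def stringMonopoleSource (M lam : ℝ) : MonopoleSource where
  tt := fun _ r => f M r * lam / r ^ 2
  tr := fun _ _ => 0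
  rr := fun _ r => -lam / (f M r * r ^ 2)

/-! ### The `l = 1`, `m = 0` even-mode solution -/

/-- Mode coefficients of the even energy-momentum perturbation for `l = 1`, as functions of
`(t, r)`; the traceless tensor harmonic vanishes, and its coefficient is set to `0`. -/
structure DipoleSource where
  tt : ℝ → ℝ → ℝ
  tr : ℝ → ℝ → ℝ
  rr : ℝ → ℝ → ℝ
  e0 : ℝ → ℝ → ℝ
  e1t : ℝ → ℝ → ℝ
  e1r : ℝ → ℝ → ℝ

/-- The generator `V = - r ∂_t Φ cos θ dt + (Φ - r ∂_r Φ) cos θ dr - r Φ sin θ dθ`. -/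
def dipoleGenerator (Φ : ℝ → ℝ → ℝ) : CovectorField := fun x =>
  let t := x 0
  let r := x 1
  let θ := x 2
  ![-r * dt Φ t r * cos θ, (Φ t r - r * dr Φ t r) * cos θ, -r * Φ t r * sin θ, 0]

/-- The `l = 1`, `m = 0` solution. -/
def dipoleSolution (M : ℝ) (T : DipoleSource) (Φ : ℝ → ℝ → ℝ) : TensorField := fun x =>
  let t := x 0
  let r := x 1
  let F := f M r
  let ctt := F ^ 2 * ((1 + F) / 2 * T.rr t r + r * F * dr T.rr t r - T.e0 t r - 4 * T.e1r t r)
  let ctr := r / F * (dt T.tt t r - 3 * F * (1 - F) / (2 * r) * T.tr t r)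
  let crr := r / F * (dr T.tt t r - 3 * (1 - 3 * F) / (2 * r * F) * T.tt t r)
  lieMetric (schwarzschild M) (dipoleGenerator Φ) x
    - (16 * π * r ^ 2 / (3 * (1 - F)) * cos (x 2)) •
      (!![ctt, ctr, 0, 0; ctr, crr, 0, 0; 0, 0, 0, 0; 0, 0, 0, 0]
        + (r ^ 2 * T.tt t r) • gammaTensor x)

/-- `Λ = (l - 1)(l + 2) + 3 (1 - f)` for `l = 1`. -/
def dipoleLambda (M r : ℝ) : ℝ := 3 * (1 - f M r)

/-- The potential of the master equation, for `l = 1`. -/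
def dipolePotential (M r : ℝ) : ℝ :=
  let F := f M r
  let L := dipoleLambda M r
  1 / (r ^ 2 * L ^ 2) * (L ^ 3 - 2 * (2 - 3 * F) * L ^ 2 + 6 * (1 - 3 * F) * (1 - F) * L
    + 18 * F * (1 - F) ^ 2)

/-- The source of the master equation, for `l = 1`. -/
def dipoleMasterSource (M : ℝ) (T : DipoleSource) (t r : ℝ) : ℝ :=
  let F := f M r
  let L := dipoleLambda M r
  1 / 2 * (L / (2 * F) - 1) * T.tt t r + 1 / 2 * ((2 - F) - 1 / 2 * L) * F * T.rr t r
    - 1 / 2 * r * dr T.tt t r + 1 / 2 * F ^ 2 * r * dr T.rr t r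
    - F / 2 * T.e0 t r - 2 * F * T.e1r t r - 3 * (1 - F) / L * T.tt t r

/-- The conditions on the data of the `l = 1` solution: the source obeys the continuity equation
and `Φ` obeys the (Zerilli-Moncrief) master equation. -/
structure IsDipoleData (M : ℝ) (T : DipoleSource) (Φ : ℝ → ℝ → ℝ) : Prop where
  continuity_t : ∀ t r, 2 * M < r →
    -dt T.tt t r + f M r ^ 2 * dr T.tr t r + (1 + f M r) * f M r / r * T.tr t r
      - f M r / r * 2 * T.e1t t r = 0
  continuity_r : ∀ t r, 2 * M < r →
    -dt T.tr t r + (1 - f M r) / (2 * r * f M r) * T.tt t r + f M r ^ 2 * dr T.rr t r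
      + (3 + f M r) * f M r / (2 * r) * T.rr t r - f M r / r * 2 * T.e1r t r
      - f M r / r * T.e0 t r = 0
  continuity_p : ∀ t r, 2 * M < r →
    -dt T.e1t t r + f M r ^ 2 * dr T.e1r t r + (1 + 2 * f M r) * f M r / r * T.e1r t r
      + f M r / (2 * r) * T.e0 t r = 0
  contDiffOn : ContDiffOn ℝ 2 (fun p : ℝ × ℝ => Φ p.1 p.2) (exteriorTR M)
  master : ∀ t r, 2 * M < r →
    -(1 / f M r) * dt (dt Φ) t r + dr (fun τ ρ => f M ρ * dr Φ τ ρ) t r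
      - dipolePotential M r * Φ t r
      = 16 * π * (r / dipoleLambda M r) * dipoleMasterSource M T t r

/-- The `l = 1` source `-(λ / r²) y_{ab} cos θ`. -/
def stringDipoleSource (M lam : ℝ) : DipoleSource where
  tt := fun _ r => f M r * lam / r ^ 2
  tr := fun _ _ => 0
  rr := fun _ r => -lam / (f M r * r ^ 2)
  e0 := fun _ _ => 0
  e1t := fun _ _ => 0
  e1r := fun _ _ => 0

/-- The generator
`W = - 16πλ r / (6 (1 - f)) cos θ dr - 16πλ r² / (6 (1 - f)) sin θ dθ`. -/
def accelerationGenerator (M lam : ℝ) : CovectorField := fun x =>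
  ![0, -(x 1 / (6 * (1 - f M (x 1)))) * (16 * π * lam) * cos (x 2),
    -(x 1 ^ 2 / (6 * (1 - f M (x 1)))) * (16 * π * lam) * sin (x 2), 0]

/-! ### Strings on the axis -/

/-- The coefficient `λ_l`. -/
def tension (M α₁ C₁ : ℝ) (l : ℕ) : ℝ :=
  -(1 / (16 * π)) * ((2 * l + 1) * ((2 * α₁ * M + C₁) + (-(2 * α₁ * M) + C₁) * (-1) ^ l))

/-- The unit sphere in Euclidean three-space. -/
abbrev S2 := Metric.sphere (0 : EuclideanSpace ℝ (Fin 3)) 1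

/-- The point `(sin θ cos φ, sin θ sin φ, cos θ)` of the unit sphere. -/
def spherePoint (θ φ : ℝ) : S2 :=
  ⟨!₂[sin θ * cos φ, sin θ * sin φ, cos θ], by
    rw [mem_sphere_zero_iff_norm, EuclideanSpace.norm_eq, Real.sqrt_eq_one]
    simp only [Fin.sum_univ_three, Real.norm_eq_abs, sq_abs]
    simp
    nlinarith [sin_sq_add_cos_sq θ, sin_sq_add_cos_sq φ]⟩

/-- The north pole `(0, 0, 1)`. -/
def north : S2 := ⟨!₂[0, 0, 1], by
  rw [mem_sphere_zero_iff_norm, EuclideanSpace.norm_eq, Real.sqrt_eq_one]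
  simp [Fin.sum_univ_three]⟩

/-- The south pole `(0, 0, -1)`. -/
def south : S2 := -north

/-- Energy-momentum tensor `-(μ / r²) y_{ab} δ² (n - p)` of a half-infinite string with constant
line density `μ` along the half axis in direction `p`, evaluated at `(t, r)` on the test function
`ψ` on the sphere. (`y_{ab}` does not depend on the angles.) -/
def stringStress (M μ : ℝ) (p : S2) (t r : ℝ) (a b : Fin 4) (ψ : S2 → ℝ) : ℝ :=
  -(1 / r ^ 2) * yTensor M ![t, r, π / 2, 0] a b * (μ * ψ p)

end CMetricPert

end

open Real Filter Topology
open scoped Matrix ContDiff Manifold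

noncomputable section

namespace CMetricPert

/-! ### Legendre polynomials -/

section Legendre

open Polynomial

/-! Everything about the stress rests on one curvature computation. Each mode of the linearized
C-metric is diagonal and, in mixed components, belongs to the family `modeJet`: a conformal part `β
r cos θ`, a mass part `m`, a conicity part `C` and a traceless angular part `A(θ)`. This holds
because the scalar coefficients of the perturbation are affine in `cos θ`. They therefore feed only
`l = 0` (giving `m`, `C`) and `l = 1` (giving `β`), and all modes `l ≥ 2` come from the traceless
angular block alone (`modePart_linCMetric`).

On this family the linearized Ricci tensor is `ρ γ` with `ρ = -C + 3 β M cos θ + (A'' + 3 cot θ A' -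
2 A) / 2` (`linRicci_modeJet`). Removing half the trace turns `ρ γ` into `-(ρ / r²) y`, which is
string matter. For `A` proportional to `P_l²`, the angular operator returns `(l-1) l (l+1) (l+2)
P_l` (`legendreP_fourth_order`). The same factor stands in the denominator of the harmonic
coefficient, so it cancels and leaves `ρ = 8π λ_l P_l`. The coefficient itself is a pure boundary
term at `cos θ = ±1` (`legendreIntegral_harm2`), whence the two contributions to `λ_l`, one constant
and one alternating in `l`. For `l = 0, 1` the traceless harmonic vanishes, and `C` and `β` supply
the same formula.

For the sum, `∑ (2l+1) P_l = P'_{N+1} + P'_N`. With the weight `sin θ` this is minus the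
`θ`-derivative of `P_{N+1}(cos θ) + P_N(cos θ)`. Integrating by parts against a test function leaves
twice its value at the north pole, and an error bounded by `∫ |P_N(cos θ)| dθ` and its successor,
which tend to zero (`tendsto_integral_abs_harm`). The reflection `θ ↦ π - θ` gives the alternating
series and the south pole.

The realizations for `l = 0` and `l = 1` are gauge identities: explicit Lie derivatives of the
Schwarzschild metric (`lieMetric_conicityGenerator`, `lieMetric_accelerationGenerator`) convert the
conicity and acceleration terms into the forms of the general solutions. The evolution equation for
`l = 0` is the time derivative of the gauge equation. -/

theorem iterate_derivative_rodrigues (l n : ℕ) :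
    derivative^[n + 1] ((X ^ 2 - 1 : ℝ[X]) ^ (l + 1))
      = C (2 * ((l : ℝ) + 1)) * (derivative^[n] ((X ^ 2 - 1 : ℝ[X]) ^ l) * X
          + n • derivative^[n - 1] ((X ^ 2 - 1 : ℝ[X]) ^ l)) := by
  have h : derivative ((X ^ 2 - 1 : ℝ[X]) ^ (l + 1))
      = C (2 * ((l : ℝ) + 1)) * ((X ^ 2 - 1) ^ l * X) := by
    rw [derivative_pow_succ]
    simp only [derivative_sub, derivative_X_pow, derivative_one, map_mul, map_add, map_natCast,
      map_ofNat, map_one]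
    push_cast
    ring
  rw [Function.iterate_succ_apply, h, iterate_derivative_C_mul, iterate_derivative_mul_X]

theorem legendreP_succ_normalization (l : ℕ) :
    (1 / (2 ^ (l + 1) * ((l + 1).factorial : ℝ))) * (2 * ((l : ℝ) + 1))
      = 1 / (2 ^ l * (l.factorial : ℝ)) := by
  have h : (l.factorial : ℝ) ≠ 0 := by positivity
  have h' : (l : ℝ) + 1 ≠ 0 := by positivity
  rw [Nat.factorial_succ]
  push_cast
  field_simp
  ring

theorem derivative_legendreP_succ (l : ℕ) :
    derivative (legendreP (l + 1))
      = X * derivative (legendreP l) + C ((l : ℝ) + 1) * legendreP l := by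
  have h := iterate_derivative_rodrigues l (l + 1)
  rw [Nat.add_sub_cancel] at h
  unfold legendreP
  rw [derivative_C_mul, derivative_C_mul, ← Function.iterate_succ_apply' derivative (l + 1), h,
    ← mul_assoc, ← C_mul, legendreP_succ_normalization, ← Function.iterate_succ_apply' derivative l]
  simp only [nsmul_eq_mul, map_add, map_natCast, map_one]
  push_cast
  ring

/-- The derivative of order `l + 1` of `(X² - 1)^(l+1)` is computed twice, by the Rodrigues
recursion and by Leibniz on `(X² - 1)^l (X² - 1)`. In the combination `2 * h2 - h1` the derivative
of order `l - 1` drops out. -/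
theorem legendreP_succ (l : ℕ) :
    C ((l : ℝ) + 1) * legendreP (l + 1)
      = C ((l : ℝ) + 1) * X * legendreP l + (X ^ 2 - 1) * derivative (legendreP l) := by
  have h1 := iterate_derivative_rodrigues l l
  have h2 : derivative^[l + 1] ((X ^ 2 - 1 : ℝ[X]) ^ (l + 1))
      = (derivative^[l + 1] ((X ^ 2 - 1 : ℝ[X]) ^ l) * X
          + (l + 1) • derivative^[l] ((X ^ 2 - 1 : ℝ[X]) ^ l)) * X
        + (l + 1) • (derivative^[l] ((X ^ 2 - 1 : ℝ[X]) ^ l) * X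
          + l • derivative^[l - 1] ((X ^ 2 - 1 : ℝ[X]) ^ l))
        - derivative^[l + 1] ((X ^ 2 - 1 : ℝ[X]) ^ l) := by
    rw [show (X ^ 2 - 1 : ℝ[X]) ^ (l + 1) = (X ^ 2 - 1) ^ l * X * X - (X ^ 2 - 1) ^ l by ring,
      iterate_derivative_sub, iterate_derivative_mul_X, iterate_derivative_mul_X,
      Nat.add_sub_cancel, iterate_derivative_mul_X]
  have h3 : derivative^[l + 1] ((X ^ 2 - 1 : ℝ[X]) ^ (l + 1))
      = C 2 * (C ((l : ℝ) + 1) * X * derivative^[l] ((X ^ 2 - 1 : ℝ[X]) ^ l)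
        + (X ^ 2 - 1) * derivative^[l + 1] ((X ^ 2 - 1 : ℝ[X]) ^ l)) := by
    simp only [nsmul_eq_mul, map_add, map_mul, map_natCast, map_one, map_ofNat] at h1 h2 ⊢
    push_cast at h1 h2 ⊢
    linear_combination 2 * h2 - h1
  have h4 : C ((l : ℝ) + 1) * C (1 / (2 ^ (l + 1) * ((l + 1).factorial : ℝ))) * C 2
      = C (1 / (2 ^ l * (l.factorial : ℝ))) := by
    rw [← C_mul, ← C_mul, ← legendreP_succ_normalization l]
    congr 1
    generalize 1 / (2 ^ (l + 1) * ((l + 1).factorial : ℝ)) = c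
    ring
  unfold legendreP
  rw [h3, derivative_C_mul, ← Function.iterate_succ_apply' derivative l, ← mul_assoc, ← mul_assoc, h4]
  ring

theorem legendreP_zero : legendreP 0 = 1 := by simp [legendreP]

theorem legendreP_one : legendreP 1 = X := by
  have h := legendreP_succ 0
  simpa [legendreP_zero] using h

/-- Differentiating `legendreP_succ` and substituting `derivative_legendreP_succ` eliminates the
polynomial of degree `l + 1`. -/
theorem legendreP_ode (l : ℕ) :
    (1 - X ^ 2) * derivative (derivative (legendreP l))
      = 2 * X * derivative (legendreP l) - C ((l : ℝ) * (l + 1)) * legendreP l := by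
  have h1 := congrArg derivative (legendreP_succ l)
  have h2 := derivative_legendreP_succ l
  simp only [derivative_add, derivative_mul, derivative_C, derivative_X, derivative_sub,
    derivative_X_pow, derivative_one, h2] at h1
  simp only [map_add, map_mul, map_natCast, map_one] at h1 h2 ⊢
  simp at h1
  linear_combination h1

theorem derivative_legendreP_add_two (l : ℕ) :
    derivative (legendreP (l + 2))
      = derivative (legendreP l) + C (2 * (l : ℝ) + 3) * legendreP (l + 1) := by
  have h1 := derivative_legendreP_succ (l + 1)
  have h2 := derivative_legendreP_succ l
  have h3 := legendreP_succ l
  rw [h1, h2]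
  push_cast
  simp only [map_add, map_mul, map_natCast, map_one, map_ofNat] at h3 ⊢
  linear_combination -h3

theorem legendreP_eval_one (l : ℕ) : (legendreP l).eval 1 = 1 := by
  induction l with
  | zero => simp [legendreP_zero]
  | succ l ih =>
    have h := congrArg (eval 1) (legendreP_succ l)
    have h' : (l : ℝ) + 1 ≠ 0 := by positivity
    simp only [eval_mul, eval_add, eval_C, eval_X, eval_sub, eval_pow, eval_one, ih] at h
    apply mul_left_cancel₀ h'
    linarith

theorem legendreP_eval_neg_one (l : ℕ) : (legendreP l).eval (-1) = (-1) ^ l := by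
  induction l with
  | zero => simp [legendreP_zero]
  | succ l ih =>
    have h := congrArg (eval (-1)) (legendreP_succ l)
    have h' : (l : ℝ) + 1 ≠ 0 := by positivity
    simp only [eval_mul, eval_add, eval_C, eval_X, eval_sub, eval_pow, eval_one, ih] at h
    apply mul_left_cancel₀ h'
    rw [h, pow_succ]
    ring

/-- Closed form of the kernel of the partial sums at the north pole, where every `P_l` equals `1`.
That it is a derivative is what later permits integration by parts. -/
theorem sum_legendreP (N : ℕ) :
    ∑ l ∈ Finset.range (N + 1), C (2 * (l : ℝ) + 1) * legendreP l
      = derivative (legendreP (N + 1)) + derivative (legendreP N) := by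
  induction N with
  | zero => simp [legendreP_zero, legendreP_one]
  | succ N ih =>
    rw [Finset.sum_range_succ, ih, derivative_legendreP_add_two]
    simp only [map_add, map_mul, map_natCast, map_one, map_ofNat]
    push_cast
    ring

/-- The integral of a polynomial over `[-1, 1]`. -/
def legendreIntegral : ℝ[X] →ₗ[ℝ] ℝ where
  toFun p := ∫ z in (-1 : ℝ)..1, p.eval z
  map_add' p q := by
    simp only [eval_add]
    exact intervalIntegral.integral_add (p.continuous.intervalIntegrable _ _)
      (q.continuous.intervalIntegrable _ _)
  map_smul' c p := by simp [eval_smul]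

theorem legendreIntegral_apply (p : ℝ[X]) :
    legendreIntegral p = ∫ z in (-1 : ℝ)..1, p.eval z := rfl

theorem legendreIntegral_C_mul (c : ℝ) (p : ℝ[X]) :
    legendreIntegral (C c * p) = c * legendreIntegral p := by
  rw [← smul_eq_C_mul, map_smul, smul_eq_mul]

theorem legendreIntegral_derivative (p : ℝ[X]) :
    legendreIntegral (derivative p) = p.eval 1 - p.eval (-1) :=
  intervalIntegral.integral_eq_sub_of_hasDerivAt (fun z _ => p.hasDerivAt z)
    ((derivative p).continuous.intervalIntegrable _ _)

/-- Sturm–Liouville argument: `(1 - X²)` times the Wronskian vanishes at `±1`, and its derivative is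
the product times the difference of the eigenvalues. -/
theorem legendreP_orthogonal {l m : ℕ} (h : m < l) :
    legendreIntegral (legendreP l * legendreP m) = 0 := by
  have h1 := legendreP_ode l
  have h2 := legendreP_ode m
  have h3 := legendreIntegral_derivative ((1 - X ^ 2) *
    (derivative (legendreP l) * legendreP m - derivative (legendreP m) * legendreP l))
  have h4 : derivative ((1 - X ^ 2) *
      (derivative (legendreP l) * legendreP m - derivative (legendreP m) * legendreP l))
      = C ((m : ℝ) * (m + 1) - l * (l + 1)) * (legendreP l * legendreP m) := by
    simp only [derivative_mul, derivative_sub, derivative_X_sq, derivative_one, C_sub]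
    simp only [map_add, map_mul, map_natCast, map_one, map_ofNat] at h1 h2 ⊢
    linear_combination legendreP m * h1 - legendreP l * h2
  rw [h4, legendreIntegral_C_mul] at h3
  simp only [eval_mul, eval_sub, eval_pow, eval_one, eval_X] at h3
  have h5 : (m : ℝ) * (m + 1) - l * (l + 1) ≠ 0 := by
    have : (m : ℝ) < l := by exact_mod_cast h
    have : (0 : ℝ) ≤ m := by positivity
    nlinarith
  refine (mul_eq_zero.mp (h3.trans ?_)).resolve_left h5
  norm_num

/-- The derivative of `P_m` is a combination of `P_{m-1}`, `P_{m-3}`, …, each of degree below `l`;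
hence the induction in steps of two. -/
theorem legendreIntegral_mul_derivative {l m : ℕ} (h : m ≤ l) :
    legendreIntegral (legendreP l * derivative (legendreP m)) = 0 := by
  induction m using Nat.twoStepInduction with
  | zero => simp [legendreP_zero]
  | one =>
    have := legendreP_orthogonal (l := l) (m := 0) (by omega)
    simpa [legendreP_zero, legendreP_one] using this
  | more m ih _ =>
    rw [derivative_legendreP_add_two, mul_add, map_add, ih (by omega), mul_left_comm,
      legendreIntegral_C_mul, legendreP_orthogonal (by omega)]
    simp

/-- Integrate `(X P_l²)'`. Since `X P_l' = l P_l + P_{l-1}'` and the last term is orthogonal to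
`P_l`, only the square and the boundary value `2` remain. -/
theorem legendreIntegral_sq (l : ℕ) :
    (2 * (l : ℝ) + 1) * legendreIntegral (legendreP l ^ 2) = 2 := by
  have h1 := legendreIntegral_derivative (X * legendreP l ^ 2)
  -- For `l = 0` the truncated `l - 1` is `0`; this is harmless because `P_0` is constant.
  have h2 : legendreP l * (X * derivative (legendreP l))
      = C (l : ℝ) * legendreP l ^ 2 + legendreP l * derivative (legendreP (l - 1)) := by
    rcases l with _ | l
    · simp [legendreP_zero]
    · have h1 := derivative_legendreP_succ l
      have h3 := legendreP_succ l
      rw [h1]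
      rw [Nat.add_sub_cancel]
      push_cast
      simp only [map_add, map_natCast, map_one] at h3 ⊢
      linear_combination -legendreP (l + 1) * h3
  have h3 : derivative (X * legendreP l ^ 2)
      = C (2 * (l : ℝ) + 1) * legendreP l ^ 2
        + C 2 * (legendreP l * derivative (legendreP (l - 1))) := by
    rw [derivative_mul, derivative_X, derivative_pow]
    simp only [map_add, map_mul, map_natCast, map_one, map_ofNat] at h2 ⊢
    simp
    linear_combination 2 * h2
  rw [h3, map_add, legendreIntegral_C_mul, legendreIntegral_C_mul,
    legendreIntegral_mul_derivative (Nat.sub_le l 1)] at h1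
  simp only [eval_mul, eval_X, eval_pow, legendreP_eval_one, legendreP_eval_neg_one] at h1
  rw [mul_zero, add_zero] at h1
  rw [h1, ← pow_mul, mul_comm l 2, pow_mul]
  norm_num

/-- Energy argument: by the Legendre equation, `l (l+1) P_l² + (1 - z²) P_l'²` has derivative `2 z
P_l'²`. On `[-1, 1]` it is therefore largest at the endpoints, where it equals `l (l+1)`. -/
theorem legendreP_eval_sq_le_one (l : ℕ) (hl : 1 ≤ l) {z : ℝ} (hz : |z| ≤ 1) :
    (legendreP l).eval z ^ 2 ≤ 1 := by
  obtain ⟨hz1, hz2⟩ := abs_le.mp hz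
  have hl0 : (0 : ℝ) < (l : ℝ) * (l + 1) := by
    have : (1 : ℝ) ≤ l := by exact_mod_cast hl
    positivity
  set u : ℝ[X] := C ((l : ℝ) * (l + 1)) * legendreP l ^ 2
    + (1 - X ^ 2) * derivative (legendreP l) ^ 2 with hu
  have hd : derivative u = C 2 * X * derivative (legendreP l) ^ 2 := by
    have h := legendreP_ode l
    rw [hu]
    simp only [derivative_add, derivative_mul, derivative_sub, derivative_one,
      derivative_C, derivative_pow]
    simp only [map_add, map_mul, map_natCast, map_one, map_ofNat] at h ⊢
    simp
    linear_combination 2 * derivative (legendreP l) * h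
  have hd' : ∀ y, deriv (fun y => u.eval y) y = 2 * y * (derivative (legendreP l)).eval y ^ 2 := by
    intro y
    rw [u.deriv, hd]
    simp
  have hle : u.eval z ≤ (l : ℝ) * (l + 1) := by
    rcases le_total 0 z with h0 | h0
    · have hm : MonotoneOn (fun y => u.eval y) (Set.Ici 0) := by
        refine monotoneOn_of_deriv_nonneg (convex_Ici 0) u.continuous.continuousOn
          u.differentiable.differentiableOn fun y hy => ?_
        rw [interior_Ici] at hy
        rw [hd']
        have : 0 < y := hy
        positivity
      have := hm (a := z) (b := 1) h0 (by simp) hz2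
      simpa [hu, legendreP_eval_one] using this
    · have hm : AntitoneOn (fun y => u.eval y) (Set.Iic 0) := by
        refine antitoneOn_of_deriv_nonpos (convex_Iic 0) u.continuous.continuousOn
          u.differentiable.differentiableOn fun y hy => ?_
        rw [interior_Iic] at hy
        rw [hd']
        have : y < 0 := hy
        nlinarith [sq_nonneg ((derivative (legendreP l)).eval y)]
      have := hm (a := -1) (b := z) (by simp) h0 hz1
      have h1 : ((-1 : ℝ) ^ l) ^ 2 = 1 := by rw [← pow_mul, mul_comm, pow_mul]; simp
      simpa [hu, legendreP_eval_neg_one, h1] using this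
  have hz3 : 0 ≤ (1 - z ^ 2) * (derivative (legendreP l)).eval z ^ 2 :=
    mul_nonneg (by nlinarith) (sq_nonneg _)
  simp only [hu, eval_add, eval_mul, eval_C, eval_pow, eval_sub, eval_one, eval_X] at hle
  nlinarith

theorem integral_cos_comp (p : ℝ[X]) :
    ∫ θ in (0 : ℝ)..π, p.eval (cos θ) * sin θ = legendreIntegral p := by
  have h := intervalIntegral.integral_comp_mul_deriv (a := 0) (b := π) (f := cos)
    (f' := fun θ => -sin θ) (g := fun z => p.eval z) (fun θ _ => hasDerivAt_cos θ)
    (by fun_prop) p.continuous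
  rw [cos_zero, cos_pi, intervalIntegral.integral_symm (-1) 1] at h
  rw [legendreIntegral_apply, ← neg_inj, ← h, ← intervalIntegral.integral_neg]
  simp

end Legendre

/-! ### Convergence of Legendre series at the poles -/

theorem harm_eq (l : ℕ) (θ : ℝ) : harm l θ = (legendreP l).eval (cos θ) := rfl

theorem continuous_harm (l : ℕ) : Continuous (harm l) :=
  (legendreP l).continuous.comp continuous_cos

theorem hasDerivAt_harm (l : ℕ) (θ : ℝ) : HasDerivAt (harm l) (-sin θ * harm' l θ) θ := by
  have := ((legendreP l).hasDerivAt (cos θ)).comp θ (hasDerivAt_cos θ)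
  rw [mul_comm]
  exact this

theorem harm_zero (l : ℕ) : harm l 0 = 1 := by simp [harm, legendreP_eval_one]

theorem harm_pi (l : ℕ) : harm l π = (-1) ^ l := by simp [harm, legendreP_eval_neg_one]

theorem abs_harm_le_one {l : ℕ} (hl : 1 ≤ l) (θ : ℝ) : |harm l θ| ≤ 1 := by
  rw [← sq_le_one_iff_abs_le_one]
  exact legendreP_eval_sq_le_one l hl (abs_cos_le_one θ)

theorem sum_harm (N : ℕ) (θ : ℝ) :
    ∑ l ∈ Finset.range (N + 1), (2 * (l : ℝ) + 1) * harm l θ = harm' (N + 1) θ + harm' N θ := by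
  have h := congrArg (Polynomial.eval (cos θ)) (sum_legendreP N)
  simpa [Polynomial.eval_finsetSum, harm, harm'] using h

theorem integral_harm_sq (l : ℕ) :
    ∫ θ in (0 : ℝ)..π, harm l θ ^ 2 * sin θ = 2 / (2 * (l : ℝ) + 1) := by
  have h := integral_cos_comp (legendreP l ^ 2)
  have h2 := legendreIntegral_sq l
  have h3 : (2 * (l : ℝ) + 1) ≠ 0 := by positivity
  simp only [Polynomial.eval_pow, ← harm_eq] at h
  rw [eq_div_iff h3, mul_comm, h, h2]

/-- The functions `P_l (cos θ)` tend to `0` in the mean with respect to `dθ`. -/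
theorem tendsto_integral_abs_harm :
    Tendsto (fun l : ℕ => ∫ θ in (0 : ℝ)..π, |harm l θ|) atTop (𝓝 0) := by
  have hint : ∀ (l : ℕ) (a b : ℝ), IntervalIntegrable (fun θ => |harm l θ|) MeasureTheory.volume a b :=
    fun l a b => (continuous_harm l).abs.intervalIntegrable _ _
  -- The `L²` norm carries the weight `sin θ`, which degenerates at the poles. Two caps of width `δ`
  -- are handled by `|P_l| ≤ 1`; between them `sin θ ≥ sin δ`, and the `L²` norm, which tends to
  -- zero, controls the integral.
  have key : ∀ δ : ℝ, 0 < δ → δ < 1 → ∀ l : ℕ, 1 ≤ l →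
      ∫ θ in (0 : ℝ)..π, |harm l θ|
        ≤ (2 + π) * δ + (1 / (4 * δ * sin δ)) * (2 / (2 * (l : ℝ) + 1)) := by
    intro δ h0 h1 l hl
    have hpi := pi_gt_three
    have hs : 0 < sin δ := sin_pos_of_pos_of_lt_pi h0 (by linarith)
    rw [← intervalIntegral.integral_add_adjacent_intervals (hint l 0 δ) (hint l δ π),
      ← intervalIntegral.integral_add_adjacent_intervals (hint l δ (π - δ)) (hint l (π - δ) π)]
    have e1 : ∫ θ in (0 : ℝ)..δ, |harm l θ| ≤ δ := by
      have := intervalIntegral.integral_mono_on h0.le (hint l 0 δ)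
        (intervalIntegrable_const (c := (1 : ℝ))) fun θ _ => abs_harm_le_one hl θ
      simpa using this
    have e3 : ∫ θ in (π - δ)..π, |harm l θ| ≤ δ := by
      have := intervalIntegral.integral_mono_on (by linarith) (hint l (π - δ) π)
        (intervalIntegrable_const (c := (1 : ℝ))) fun θ _ => abs_harm_le_one hl θ
      simpa using this
    have hc : Continuous fun θ => 1 / (4 * δ * sin δ) * (harm l θ ^ 2 * sin θ) :=
      continuous_const.mul (((continuous_harm l).pow 2).mul continuous_sin)
    have e2 : ∫ θ in δ..(π - δ), |harm l θ|
        ≤ ∫ θ in δ..(π - δ), (δ + 1 / (4 * δ * sin δ) * (harm l θ ^ 2 * sin θ)) := by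
      refine intervalIntegral.integral_mono_on (by linarith) (hint l _ _)
        ((continuous_const.add hc).intervalIntegrable _ _) fun θ hθ => ?_
      have hsθ : sin δ ≤ sin θ := by
        rcases le_total θ (π / 2) with h | h
        · exact sin_le_sin_of_le_of_le_pi_div_two (by linarith) h hθ.1
        · rw [← sin_pi_sub θ]
          exact sin_le_sin_of_le_of_le_pi_div_two (by linarith) (by linarith) (by linarith [hθ.2])
      -- The arithmetic–geometric mean inequality replaces Cauchy–Schwarz; the additive `δ` is
      -- affordable on an interval of length at most `π`.
      have h2 : |harm l θ| ≤ δ + 1 / (4 * δ) * harm l θ ^ 2 := by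
        rw [← sq_abs (harm l θ)]
        have : 0 ≤ (|harm l θ| - 2 * δ) ^ 2 / (4 * δ) := by positivity
        have h3 : (|harm l θ| - 2 * δ) ^ 2 / (4 * δ)
          = 1 / (4 * δ) * |harm l θ| ^ 2 - |harm l θ| + δ := by field_simp; ring
        linarith
      have h4 : 1 / (4 * δ) * harm l θ ^ 2 ≤ 1 / (4 * δ * sin δ) * (harm l θ ^ 2 * sin θ) := by
        have : 1 / (4 * δ * sin δ) * (harm l θ ^ 2 * sin θ)
          = 1 / (4 * δ) * harm l θ ^ 2 * (sin θ / sin δ) := by field_simp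
        rw [this]
        exact le_mul_of_one_le_right (by positivity) ((one_le_div hs).mpr hsθ)
      linarith
    have e4 : ∫ θ in δ..(π - δ), (δ + 1 / (4 * δ * sin δ) * (harm l θ ^ 2 * sin θ))
        ≤ ∫ θ in (0 : ℝ)..π, (δ + 1 / (4 * δ * sin δ) * (harm l θ ^ 2 * sin θ)) := by
      refine intervalIntegral.integral_mono_interval h0.le (by linarith) (by linarith) ?_
        ((continuous_const.add hc).intervalIntegrable _ _)
      filter_upwards [MeasureTheory.ae_restrict_mem measurableSet_Ioc] with θ hθ
      have : 0 ≤ sin θ := sin_nonneg_of_nonneg_of_le_pi hθ.1.le hθ.2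
      have h5 : 0 ≤ 1 / (4 * δ * sin δ) * (harm l θ ^ 2 * sin θ) := by positivity
      simpa using add_nonneg h0.le h5
    have e5 : ∫ θ in (0 : ℝ)..π, (δ + 1 / (4 * δ * sin δ) * (harm l θ ^ 2 * sin θ))
        = π * δ + 1 / (4 * δ * sin δ) * (2 / (2 * (l : ℝ) + 1)) := by
      rw [intervalIntegral.integral_add (by simp) (hc.intervalIntegrable _ _),
        intervalIntegral.integral_const_mul, integral_harm_sq]
      simp
    linarith
  rw [Metric.tendsto_atTop]
  intro ε hε
  have hpi := pi_gt_three
  obtain ⟨δ, h0, h1, h2⟩ : ∃ δ : ℝ, 0 < δ ∧ δ < 1 ∧ (2 + π) * δ < ε / 2 := by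
    refine ⟨min (1 / 2) (ε / (4 * (2 + π))), by positivity, by simp; left; norm_num, ?_⟩
    calc (2 + π) * min (1 / 2) (ε / (4 * (2 + π))) ≤ (2 + π) * (ε / (4 * (2 + π))) := by
          gcongr; exact min_le_right _ _
      _ = ε / 4 := by field_simp
      _ < ε / 2 := by linarith
  have hlim : Tendsto (fun l : ℕ => (1 / (4 * δ * sin δ)) * (2 / (2 * (l : ℝ) + 1))) atTop (𝓝 0) := by
    rw [← mul_zero (1 / (4 * δ * sin δ))]
    refine Tendsto.const_mul _ (Tendsto.const_div_atTop ?_ _)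
    exact tendsto_atTop_add_const_right _ _
      (tendsto_natCast_atTop_atTop.const_mul_atTop (by norm_num))
  obtain ⟨N, hN⟩ := (hlim.eventually (gt_mem_nhds (half_pos hε))).exists_forall_of_atTop
  refine ⟨max N 1, fun l hl => ?_⟩
  have h3 := key δ h0 h1 l (le_of_max_le_right hl)
  have h4 := hN l (le_of_max_le_left hl)
  have h5 : 0 ≤ ∫ θ in (0 : ℝ)..π, |harm l θ| :=
    intervalIntegral.integral_nonneg (by linarith) fun θ _ => abs_nonneg _
  rw [dist_zero_right, norm_eq_abs, abs_of_nonneg h5]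
  linarith

theorem integral_harm_deriv_mul (N : ℕ) {u u' : ℝ → ℝ} (hu : ∀ θ, HasDerivAt u (u' θ) θ)
    (hc : Continuous u') :
    ∫ θ in (0 : ℝ)..π, (-sin θ * harm' N θ) * u θ
      = (-1) ^ N * u π - u 0 - ∫ θ in (0 : ℝ)..π, harm N θ * u' θ := by
  have hd : Continuous fun θ => -sin θ * harm' N θ :=
    continuous_sin.neg.mul ((legendreP N).derivative.continuous.comp continuous_cos)
  have h := intervalIntegral.integral_mul_deriv_eq_deriv_mul (a := 0) (b := π)
    (fun θ _ => hasDerivAt_harm N θ) (fun θ _ => hu θ) (hd.intervalIntegrable _ _)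
    (hc.intervalIntegrable _ _)
  rw [harm_pi, harm_zero] at h
  linarith

/-- The partial sums of the Legendre expansion of a function of `θ`, evaluated at the north pole,
differ from its value there by at most the right-hand side. -/
theorem abs_legendre_sum_sub_le (N : ℕ) {u u' : ℝ → ℝ} (hu : ∀ θ, HasDerivAt u (u' θ) θ)
    (hc : Continuous u') {K : ℝ} (hK : ∀ θ ∈ Set.Icc 0 π, |u' θ| ≤ K) :
    |(∫ θ in (0 : ℝ)..π, (∑ l ∈ Finset.range (N + 1), (2 * (l : ℝ) + 1) * harm l θ) * u θ * sin θ)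
      - 2 * u 0|
      ≤ K * ((∫ θ in (0 : ℝ)..π, |harm (N + 1) θ|) + ∫ θ in (0 : ℝ)..π, |harm N θ|) := by
  have hcu : Continuous u := continuous_iff_continuousAt.mpr fun θ => (hu θ).continuousAt
  have hd : ∀ N, Continuous fun θ => -sin θ * harm' N θ := fun N =>
    continuous_sin.neg.mul ((legendreP N).derivative.continuous.comp continuous_cos)
  have hb : ∀ N, |∫ θ in (0 : ℝ)..π, harm N θ * u' θ| ≤ K * ∫ θ in (0 : ℝ)..π, |harm N θ| := by
    intro N
    rw [← intervalIntegral.integral_const_mul, ← Real.norm_eq_abs]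
    refine intervalIntegral.norm_integral_le_of_norm_le pi_pos.le (MeasureTheory.ae_of_all _ fun θ hθ => ?_)
      ((continuous_const.mul (continuous_harm N).abs).intervalIntegrable _ _)
    rw [norm_mul, mul_comm, Real.norm_eq_abs, Real.norm_eq_abs]
    exact mul_le_mul_of_nonneg_right (hK θ ⟨hθ.1.le, hθ.2⟩) (abs_nonneg _)
  have h1 : (∫ θ in (0 : ℝ)..π,
      (∑ l ∈ Finset.range (N + 1), (2 * (l : ℝ) + 1) * harm l θ) * u θ * sin θ)
      = -((∫ θ in (0 : ℝ)..π, (-sin θ * harm' (N + 1) θ) * u θ)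
        + ∫ θ in (0 : ℝ)..π, (-sin θ * harm' N θ) * u θ) := by
    have hi : ∀ N, IntervalIntegrable (fun θ => -sin θ * harm' N θ * u θ)
        MeasureTheory.volume 0 π := fun N => ((hd N).mul hcu).intervalIntegrable _ _
    rw [← intervalIntegral.integral_add (hi _) (hi _), ← intervalIntegral.integral_neg]
    congr 1
    ext θ
    rw [sum_harm]
    ring
  -- The boundary terms at `π` carry `(-1)^(N+1)` and `(-1)^N` and cancel; those at `0` add up to `2
  -- u 0`.
  rw [h1, integral_harm_deriv_mul _ hu hc, integral_harm_deriv_mul _ hu hc, pow_succ, mul_add]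
  have := (abs_add_le (∫ θ in (0 : ℝ)..π, harm (N + 1) θ * u' θ)
    (∫ θ in (0 : ℝ)..π, harm N θ * u' θ)).trans (add_le_add (hb (N + 1)) (hb N))
  refine le_of_eq_of_le (congrArg _ ?_) this
  ring

theorem legendreP_comp_neg (l : ℕ) :
    (legendreP l).comp (-Polynomial.X) = Polynomial.C ((-1) ^ l) * legendreP l := by
  induction l with
  | zero => simp [legendreP_zero]
  | succ l ih =>
    have h := congrArg (fun p => Polynomial.comp p (-Polynomial.X)) (legendreP_succ l)
    have h1 := congrArg Polynomial.derivative ih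
    have h0 : (Polynomial.C ((l : ℝ) + 1)) ≠ 0 := by
      rw [Ne, Polynomial.C_eq_zero]; positivity
    have h2 := legendreP_succ l
    simp only [Polynomial.derivative_comp, Polynomial.derivative_neg, Polynomial.derivative_X,
      Polynomial.derivative_C_mul] at h1
    simp only [Polynomial.mul_comp, Polynomial.add_comp, Polynomial.C_comp, Polynomial.X_comp,
      Polynomial.sub_comp, Polynomial.pow_comp, Polynomial.one_comp, ih] at h
    apply mul_left_cancel₀ h0
    rw [h]
    have h3 : (Polynomial.C ((-1 : ℝ) ^ (l + 1))) = -Polynomial.C ((-1 : ℝ) ^ l) := by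
      rw [pow_succ, mul_neg_one, Polynomial.C_neg]
    rw [h3]
    linear_combination (Polynomial.C ((-1 : ℝ) ^ l)) * h2 - (Polynomial.X ^ 2 - 1) * h1

theorem harm_pi_sub (l : ℕ) (θ : ℝ) : harm l (π - θ) = (-1) ^ l * harm l θ := by
  have h := congrArg (Polynomial.eval (cos θ)) (legendreP_comp_neg l)
  simpa [harm, cos_pi_sub] using h

/-! ### Partial sums tested against functions of both angles. -/

section AngularFunctions

variable {V : ℝ → ℝ → ℝ}

theorem continuous_integral_harm_mul (l : ℕ) (hV : Continuous fun p : ℝ × ℝ => V p.1 p.2) :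
    Continuous fun φ => ∫ θ in (0 : ℝ)..π, harm l θ * V θ φ * sin θ := by
  refine intervalIntegral.continuous_parametric_intervalIntegral_of_continuous' ?_ 0 π
  have h1 : Continuous fun p : ℝ × ℝ => harm l p.2 := (continuous_harm l).comp continuous_snd
  have h2 : Continuous fun p : ℝ × ℝ => V p.2 p.1 := hV.comp continuous_swap
  exact (h1.mul h2).mul (continuous_sin.comp continuous_snd)

theorem sphereIntegral_sum_harm (N : ℕ) (c : ℕ → ℝ)
    (hV : Continuous fun p : ℝ × ℝ => V p.1 p.2) :
    ∑ l ∈ Finset.range N, c l * sphereIntegral (fun θ φ => harm l θ * V θ φ)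
      = ∫ φ in (-π)..π, ∫ θ in (0 : ℝ)..π,
          (∑ l ∈ Finset.range N, c l * harm l θ) * V θ φ * sin θ := by
  have h1 : ∀ φ, (∫ θ in (0 : ℝ)..π, (∑ l ∈ Finset.range N, c l * harm l θ) * V θ φ * sin θ)
      = ∑ l ∈ Finset.range N, c l * ∫ θ in (0 : ℝ)..π, harm l θ * V θ φ * sin θ := by
    intro φ
    have h2 : Continuous fun θ : ℝ => V θ φ := hV.comp (continuous_id.prodMk continuous_const)
    simp_rw [← intervalIntegral.integral_const_mul]
    have hi : ∀ l ∈ Finset.range N, IntervalIntegrable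
        (fun θ => c l * (harm l θ * V θ φ * sin θ)) MeasureTheory.volume 0 π := fun l _ =>
      (continuous_const.mul
        (((continuous_harm l).mul h2).mul continuous_sin)).intervalIntegrable _ _
    rw [← intervalIntegral.integral_finsetSum hi]
    congr 1
    ext θ
    rw [Finset.sum_mul, Finset.sum_mul]
    exact Finset.sum_congr rfl fun l _ => by ring
  simp_rw [h1]
  have hi : ∀ l ∈ Finset.range N, IntervalIntegrable
      (fun φ => c l * ∫ θ in (0 : ℝ)..π, harm l θ * V θ φ * sin θ)
      MeasureTheory.volume (-π) π := fun l _ =>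
    (continuous_const.mul (continuous_integral_harm_mul l hV)).intervalIntegrable _ _
  rw [intervalIntegral.integral_finsetSum hi]
  simp_rw [intervalIntegral.integral_const_mul]
  rfl

/-- The one-dimensional estimate is applied on each meridian. Its constant is uniform in `φ`, as
`∂V/∂θ` is bounded on the compact rectangle of angles, so the error survives integration over `φ`.
-/
theorem tendsto_sum_north (hV : ContDiff ℝ 1 fun p : ℝ × ℝ => V p.1 p.2) :
    Tendsto (fun N : ℕ => ∑ l ∈ Finset.range N,
        (2 * (l : ℝ) + 1) * sphereIntegral fun θ φ => harm l θ * V θ φ)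
      atTop (𝓝 (2 * ∫ φ in (-π)..π, V 0 φ)) := by
  rw [← tendsto_add_atTop_iff_nat 1]
  set F : ℝ × ℝ → ℝ := fun p => V p.1 p.2 with hF
  set V' : ℝ → ℝ → ℝ := fun θ φ => fderiv ℝ F (θ, φ) (1, 0) with hV'
  have hd : ∀ φ θ, HasDerivAt (fun θ => V θ φ) (V' θ φ) θ := by
    intro φ θ
    have h1 : HasFDerivAt F (fderiv ℝ F (θ, φ)) (θ, φ) :=
      (hV.differentiable (by simp) _).hasFDerivAt
    exact h1.comp_hasDerivAt θ ((hasDerivAt_id θ).prodMk (hasDerivAt_const θ φ))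
  have hc : Continuous fun p : ℝ × ℝ => V' p.1 p.2 :=
    (hV.continuous_fderiv (by simp)).clm_apply continuous_const
  obtain ⟨K, hK⟩ := ((isCompact_Icc (a := (0 : ℝ)) (b := π)).prod
    (isCompact_Icc (a := -π) (b := π))).exists_bound_of_continuousOn hc.continuousOn
  have hVc : Continuous F := hV.continuous
  have hV0 : Continuous fun φ => V 0 φ := hVc.comp (continuous_const.prodMk continuous_id)
  rw [tendsto_iff_norm_sub_tendsto_zero]
  have hlim : Tendsto (fun N : ℕ => K * ((∫ θ in (0 : ℝ)..π, |harm (N + 1) θ|)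
      + ∫ θ in (0 : ℝ)..π, |harm N θ|) * (2 * π)) atTop (𝓝 0) := by
    have h1 := ((tendsto_add_atTop_iff_nat 1).mpr tendsto_integral_abs_harm).add
      tendsto_integral_abs_harm
    simpa using (h1.const_mul K).mul_const (2 * π)
  refine squeeze_zero (fun _ => norm_nonneg _) (fun N => ?_) hlim
  rw [sphereIntegral_sum_harm _ _ hVc, ← intervalIntegral.integral_const_mul]
  have hi : IntervalIntegrable (fun φ => ∫ θ in (0 : ℝ)..π,
      (∑ l ∈ Finset.range (N + 1), (2 * (l : ℝ) + 1) * harm l θ) * V θ φ * sin θ)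
      MeasureTheory.volume (-π) π := by
    refine (intervalIntegral.continuous_parametric_intervalIntegral_of_continuous' ?_ 0 π
      ).intervalIntegrable _ _
    have h1 : Continuous fun p : ℝ × ℝ =>
        ∑ l ∈ Finset.range (N + 1), (2 * (l : ℝ) + 1) * harm l p.2 :=
      continuous_finsetSum _ fun l _ =>
        continuous_const.mul ((continuous_harm l).comp continuous_snd)
    have h2 : Continuous fun p : ℝ × ℝ => V p.2 p.1 := hVc.comp continuous_swap
    exact (h1.mul h2).mul (continuous_sin.comp continuous_snd)
  have hi0 : IntervalIntegrable (fun φ => 2 * V 0 φ) MeasureTheory.volume (-π) π :=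
    (continuous_const.mul hV0).intervalIntegrable _ _
  rw [← intervalIntegral.integral_sub hi hi0]
  have hb := intervalIntegral.norm_integral_le_of_norm_le_const (a := -π) (b := π)
    (f := fun φ => (∫ θ in (0 : ℝ)..π,
      (∑ l ∈ Finset.range (N + 1), (2 * (l : ℝ) + 1) * harm l θ) * V θ φ * sin θ) - 2 * V 0 φ)
    (C := K * ((∫ θ in (0 : ℝ)..π, |harm (N + 1) θ|) + ∫ θ in (0 : ℝ)..π, |harm N θ|))
    fun φ hφ => by
      rw [Set.uIoc_of_le (by linarith [pi_pos])] at hφ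
      exact abs_legendre_sum_sub_le N (hd φ) (hc.comp (continuous_id.prodMk continuous_const))
        fun θ hθ => hK (θ, φ) ⟨hθ, hφ.1.le, hφ.2⟩
  rwa [sub_neg_eq_add, ← two_mul, abs_of_pos (by positivity)] at hb

/-- The reflection `θ ↦ π - θ` exchanges the poles and multiplies `P_l(cos θ)` by `(-1)^l`. -/
theorem tendsto_sum_south (hV : ContDiff ℝ 1 fun p : ℝ × ℝ => V p.1 p.2) :
    Tendsto (fun N : ℕ => ∑ l ∈ Finset.range N,
        (2 * (l : ℝ) + 1) * (-1) ^ l * sphereIntegral fun θ φ => harm l θ * V θ φ)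
      atTop (𝓝 (2 * ∫ φ in (-π)..π, V π φ)) := by
  have hW : ContDiff ℝ 1 fun p : ℝ × ℝ => (fun θ φ => V (π - θ) φ) p.1 p.2 :=
    hV.comp ((contDiff_const.sub contDiff_fst).prodMk contDiff_snd)
  have h := tendsto_sum_north (V := fun θ φ => V (π - θ) φ) hW
  simp only [sub_zero] at h
  refine h.congr fun N => Finset.sum_congr rfl fun l _ => ?_
  rw [mul_assoc]
  congr 1
  unfold sphereIntegral
  rw [← intervalIntegral.integral_const_mul]
  congr 1
  ext φ
  rw [← intervalIntegral.integral_const_mul]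
  have h1 := intervalIntegral.integral_comp_sub_left (a := 0) (b := π)
    (fun θ => harm l (π - θ) * V θ φ * sin (π - θ)) π
  simp only [sub_sub_cancel, sub_zero, sub_self] at h1
  rw [h1]
  congr 1
  ext θ
  rw [harm_pi_sub, sin_pi_sub]
  ring

end AngularFunctions

/-- Spherical coordinates are a smooth map into the ambient space with values in the sphere. The
composite is thus smooth even at the poles, where the map fails to be a chart. -/
theorem contDiff_comp_spherePoint {ψ : S2 → ℝ} (hψ : ContMDiff (𝓡 2) 𝓘(ℝ, ℝ) ∞ ψ) :
    ContDiff ℝ 1 fun p : ℝ × ℝ => ψ (spherePoint p.1 p.2) := by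
  have : Fact (Module.finrank ℝ (EuclideanSpace ℝ (Fin 3)) = 2 + 1) := ⟨by simp⟩
  have h1 : ContMDiff 𝓘(ℝ, ℝ × ℝ) 𝓘(ℝ, EuclideanSpace ℝ (Fin 3)) ∞
      fun p : ℝ × ℝ => (spherePoint p.1 p.2 : EuclideanSpace ℝ (Fin 3)) := by
    rw [contMDiff_iff_contDiff]
    refine contDiff_euclidean.mpr fun i => ?_
    fin_cases i <;> simp only [spherePoint] <;> simp <;> fun_prop
  have h2 := ContMDiff.codRestrict_sphere (n := 2) h1 fun p => (spherePoint p.1 p.2).2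
  have h3 := hψ.comp h2
  exact (contMDiff_iff_contDiff.mp h3).of_le (by exact_mod_cast le_top)

theorem spherePoint_zero (φ : ℝ) : spherePoint 0 φ = north := by
  apply Subtype.ext
  simp [spherePoint, north]

theorem spherePoint_pi (φ : ℝ) : spherePoint π φ = south := by
  apply Subtype.ext
  ext i
  fin_cases i <;> simp [spherePoint, south, north]

/-- The series with coefficients `tension` sums to point sources at the poles. -/
theorem tendsto_sum_tension (M α₁ C₁ : ℝ) {ψ : S2 → ℝ} (hψ : ContMDiff (𝓡 2) 𝓘(ℝ, ℝ) ∞ ψ) :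
    Tendsto (fun N : ℕ => ∑ l ∈ Finset.range N,
        tension M α₁ C₁ l * sphereIntegral fun θ φ => harm l θ * ψ (spherePoint θ φ))
      atTop (𝓝 (-(2 * α₁ * M + C₁) / 4 * ψ north + (2 * α₁ * M - C₁) / 4 * ψ south)) := by
  have hV := contDiff_comp_spherePoint hψ
  have h1 := (tendsto_sum_north (V := fun θ φ => ψ (spherePoint θ φ)) hV).const_mul
    (-(1 / (16 * π)) * (2 * α₁ * M + C₁))
  have h2 := (tendsto_sum_south (V := fun θ φ => ψ (spherePoint θ φ)) hV).const_mul
    (-(1 / (16 * π)) * (-(2 * α₁ * M) + C₁))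
  have h3 := h1.add h2
  have hpi := pi_ne_zero
  convert h3 using 2 with N
  · rw [Finset.mul_sum, Finset.mul_sum, ← Finset.sum_add_distrib]
    refine Finset.sum_congr rfl fun l _ => ?_
    unfold tension
    ring
  · simp only [spherePoint_zero, spherePoint_pi, intervalIntegral.integral_const, smul_eq_mul]
    field_simp
    ring

/-! ### Calculus in the chart -/

theorem isOpen_exterior (M : ℝ) : IsOpen (exterior M) := by
  have h1 : IsOpen {x : Fin 4 → ℝ | 2 * M < x 1} := isOpen_lt continuous_const (continuous_apply 1)
  have h2 : IsOpen {x : Fin 4 → ℝ | 0 < x 2} := isOpen_lt continuous_const (continuous_apply 2)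
  have h3 : IsOpen {x : Fin 4 → ℝ | x 2 < π} := isOpen_lt (continuous_apply 2) continuous_const
  exact h1.inter (h2.inter h3)

theorem pd_congr {F G : (Fin 4 → ℝ) → ℝ} {x : Fin 4 → ℝ} (h : F =ᶠ[𝓝 x] G) (c : Fin 4) :
    pd c F x = pd c G x := by
  have hc : Tendsto (fun s => Function.update x c s) (𝓝 (x c)) (𝓝 x) := by
    have : Continuous fun s => Function.update x c s := continuous_const.update c continuous_id
    simpa using this.tendsto (x c)
  exact EventuallyEq.deriv_eq (hc.eventually h)

theorem pd_congr_of_eqOn {M : ℝ} {F G : (Fin 4 → ℝ) → ℝ} {x : Fin 4 → ℝ} (hx : x ∈ exterior M)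
    (h : ∀ y ∈ exterior M, F y = G y) (c : Fin 4) : pd c F x = pd c G x :=
  pd_congr (eventually_of_mem ((isOpen_exterior M).mem_nhds hx) h) c

/-- Partial derivatives of a function that depends on `(r, θ)` only. -/
theorem pd_of_radial_polar {M : ℝ} {F : (Fin 4 → ℝ) → ℝ} {G : ℝ → ℝ → ℝ} {x : Fin 4 → ℝ}
    (hx : x ∈ exterior M) (h : ∀ y ∈ exterior M, F y = G (y 1) (y 2)) {Gr Gθ : ℝ}
    (hr : HasDerivAt (fun s => G s (x 2)) Gr (x 1)) (hθ : HasDerivAt (fun s => G (x 1) s) Gθ (x 2))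
    (c : Fin 4) : pd c F x = ![0, Gr, Gθ, 0] c := by
  rw [pd_congr_of_eqOn hx h]
  fin_cases c
  · simp [pd]
  · simpa [pd] using hr.deriv
  · simpa [pd] using hθ.deriv
  · simp [pd]

/-! ### The Schwarzschild background -/

section Background

variable {M r θ : ℝ}

theorem f_pos (hM : 0 < M) (hr : 2 * M < r) : 0 < f M r := by
  have : 0 < r := by linarith
  unfold f
  rw [sub_pos, div_lt_one this]
  exact hr

/-- Writing `2M / r²` as `(1 - f) / r` removes `M`, so that most later identities are rational in
`r` and `f` as independent symbols. -/
theorem hasDerivAt_f (hr : r ≠ 0) : HasDerivAt (f M) ((1 - f M r) / r) r := by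
  have h := (hasDerivAt_const r (1 : ℝ)).sub ((hasDerivAt_const r (2 * M)).div (hasDerivAt_id r) hr)
  refine h.congr_deriv ?_
  simp only [f, id]
  field_simp
  ring

/-- Diagonal entries of the Schwarzschild metric. -/
def gDiag (M r θ : ℝ) : Fin 4 → ℝ := ![-f M r, (f M r)⁻¹, r ^ 2, r ^ 2 * sin θ ^ 2]

/-- Radial derivatives of `gDiag`. -/
def gDiagR (M r θ : ℝ) : Fin 4 → ℝ :=
  ![-((1 - f M r) / r), -((1 - f M r) / r) / f M r ^ 2, 2 * r, 2 * r * sin θ ^ 2]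

/-- Polar derivatives of `gDiag`. -/
def gDiagT (r θ : ℝ) : Fin 4 → ℝ := ![0, 0, 0, r ^ 2 * (2 * sin θ * cos θ)]

theorem schwarzschild_eq (M : ℝ) (x : Fin 4 → ℝ) :
    schwarzschild M x = Matrix.diagonal (gDiag M (x 1) (x 2)) := by
  ext a b
  fin_cases a <;> fin_cases b <;> simp [schwarzschild, yTensor, gammaTensor, gDiag]

theorem gDiag_ne_zero (hr : r ≠ 0) (hf : f M r ≠ 0) (hs : sin θ ≠ 0) (a : Fin 4) :
    gDiag M r θ a ≠ 0 := by
  fin_cases a <;> simp [gDiag, hr, hf, hs]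

theorem hasDerivAt_gDiag_r (hr : r ≠ 0) (hf : f M r ≠ 0) (a : Fin 4) :
    HasDerivAt (fun s => gDiag M s θ a) (gDiagR M r θ a) r := by
  fin_cases a
  · exact (hasDerivAt_f hr).neg
  · exact (hasDerivAt_f hr).inv hf
  · simpa [gDiag, gDiagR] using hasDerivAt_pow 2 r
  · simpa [gDiag, gDiagR] using (hasDerivAt_pow 2 r).mul_const (sin θ ^ 2)

theorem hasDerivAt_gDiag_t (a : Fin 4) : HasDerivAt (gDiag M r · a) (gDiagT r θ a) θ := by
  fin_cases a
  · simpa [gDiag, gDiagT] using hasDerivAt_const θ _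
  · simpa [gDiag, gDiagT] using hasDerivAt_const θ _
  · simpa [gDiag, gDiagT] using hasDerivAt_const θ _
  · simpa [gDiag, gDiagT] using ((hasDerivAt_sin θ).pow 2).const_mul (r ^ 2)

/-- Christoffel symbols `Γ^c_{ab}` of the Schwarzschild metric. -/
def gammaTable (M r θ : ℝ) : Fin 4 → Matrix (Fin 4) (Fin 4) ℝ :=
  let F := f M r
  let p := (1 - F) / (2 * r * F)
  ![!![0, p, 0, 0; p, 0, 0, 0; 0, 0, 0, 0; 0, 0, 0, 0],
    !![F * (1 - F) / (2 * r), 0, 0, 0; 0, -p, 0, 0; 0, 0, -(r * F), 0;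
      0, 0, 0, -(r * F * sin θ ^ 2)],
    !![0, 0, 0, 0; 0, 0, 1 / r, 0; 0, 1 / r, 0, 0; 0, 0, 0, -(sin θ * cos θ)],
    !![0, 0, 0, 0; 0, 0, 0, 1 / r; 0, 0, 0, cos θ / sin θ; 0, 1 / r, cos θ / sin θ, 0]]

end Background

section Exterior

variable {M : ℝ} {x : Fin 4 → ℝ}

theorem exterior_r_ne (hM : 0 < M) (hx : x ∈ exterior M) : x 1 ≠ 0 := by
  have : 2 * M < x 1 := hx.1
  linarith

theorem exterior_f_ne (hM : 0 < M) (hx : x ∈ exterior M) : f M (x 1) ≠ 0 := (f_pos hM hx.1).ne'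

theorem exterior_sin_ne (hx : x ∈ exterior M) : sin (x 2) ≠ 0 :=
  (sin_pos_of_pos_of_lt_pi hx.2.1 hx.2.2).ne'

theorem schwarzschild_inv (hM : 0 < M) (hx : x ∈ exterior M) :
    (schwarzschild M x)⁻¹ = Matrix.diagonal fun a => (gDiag M (x 1) (x 2) a)⁻¹ := by
  rw [schwarzschild_eq]
  refine Matrix.inv_eq_right_inv ?_
  rw [Matrix.diagonal_mul_diagonal, ← Matrix.diagonal_one]
  congr 1
  ext a
  exact mul_inv_cancel₀ (gDiag_ne_zero (exterior_r_ne hM hx) (exterior_f_ne hM hx)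
    (exterior_sin_ne hx) a)

theorem pd_schwarzschild (hM : 0 < M) (hx : x ∈ exterior M) (a b c : Fin 4) :
    pd c (fun y => schwarzschild M y a b) x
      = if a = b then ![0, gDiagR M (x 1) (x 2) a, gDiagT (x 1) (x 2) a, 0] c else 0 := by
  split_ifs with h
  · subst h
    exact pd_of_radial_polar (G := fun r θ => gDiag M r θ a) hx
      (fun y _ => by rw [schwarzschild_eq, Matrix.diagonal_apply_eq])
      (hasDerivAt_gDiag_r (exterior_r_ne hM hx) (exterior_f_ne hM hx) a) (hasDerivAt_gDiag_t a) c
  · rw [pd_of_radial_polar (G := fun _ _ => 0) (Gr := 0) (Gθ := 0) hx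
      (fun y _ => by rw [schwarzschild_eq, Matrix.diagonal_apply_ne _ h])
      (hasDerivAt_const _ _) (hasDerivAt_const _ _)]
    fin_cases c <;> rfl

theorem christoffel_schwarzschild (hM : 0 < M) (hx : x ∈ exterior M) (c a b : Fin 4) :
    christoffel (schwarzschild M) c a b x = gammaTable M (x 1) (x 2) c a b := by
  have h1 := exterior_r_ne hM hx
  have h2 := exterior_f_ne hM hx
  have h3 := exterior_sin_ne hx
  unfold christoffel
  simp only [pd_schwarzschild hM hx, schwarzschild_inv hM hx, Matrix.diagonal_apply, ite_mul,
    zero_mul, Finset.sum_ite_eq, Finset.mem_univ, if_true]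
  generalize x 1 = r at *
  generalize x 2 = θ at *
  fin_cases c <;> fin_cases a <;> fin_cases b <;>
    simp [gammaTable, gDiag, gDiagR, gDiagT] <;> field_simp

end Exterior

/-! ### Diagonal perturbations that depend on `(r, θ)` only -/

/-- The partial derivatives up to order two of four functions of `(r, θ)`. -/
structure IsJet (M : ℝ) (k kr kt krr krt ktt : Fin 4 → ℝ → ℝ → ℝ) : Prop where
  r : ∀ a r θ, 2 * M < r → HasDerivAt (fun s => k a s θ) (kr a r θ) r
  t : ∀ a r θ, HasDerivAt (k a r) (kt a r θ) θ
  rr : ∀ a r θ, 2 * M < r → HasDerivAt (fun s => kr a s θ) (krr a r θ) r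
  rt : ∀ a r θ, HasDerivAt (kr a r) (krt a r θ) θ
  tr : ∀ a r θ, 2 * M < r → HasDerivAt (fun s => kt a s θ) (krt a r θ) r
  tt : ∀ a r θ, HasDerivAt (kt a r) (ktt a r θ) θ

/-- The perturbation with mixed components `k`. -/
def diagPert (M : ℝ) (k : Fin 4 → ℝ → ℝ → ℝ) : TensorField := fun x =>
  Matrix.diagonal fun a => gDiag M (x 1) (x 2) a * k a (x 1) (x 2)

/-- The components of `linConnection` for a diagonal perturbation. -/
def connTable (M : ℝ) (k kr kt : Fin 4 → ℝ → ℝ → ℝ) (r θ : ℝ) :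
    Fin 4 → Matrix (Fin 4) (Fin 4) ℝ :=
  let F := f M r
  ![!![0, kr 0 r θ / 2, kt 0 r θ / 2, 0;
      kr 0 r θ / 2, 0, 0, 0;
      kt 0 r θ / 2, 0, 0, 0;
      0, 0, 0, 0],
    !![F * (F * kr 0 r θ + (k 0 r θ - k 1 r θ) * ((1 - F) / r)) / 2, 0, 0, 0;
      0, kr 1 r θ / 2, kt 1 r θ / 2, 0;
      0, kt 1 r θ / 2, -(F * (r ^ 2 * kr 2 r θ + (k 2 r θ - k 1 r θ) * (2 * r))) / 2, 0;
      0, 0, 0, -(F * (r ^ 2 * kr 3 r θ + (k 3 r θ - k 1 r θ) * (2 * r))) / 2 * sin θ ^ 2],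
    !![F * kt 0 r θ / r ^ 2 / 2, 0, 0, 0;
      0, -(kt 1 r θ / (F * r ^ 2)) / 2, kr 2 r θ / 2, 0;
      0, kr 2 r θ / 2, kt 2 r θ / 2, 0;
      0, 0, 0, -(sin θ ^ 2 * kt 3 r θ + (k 3 r θ - k 2 r θ) * (2 * sin θ * cos θ)) / 2],
    !![0, 0, 0, 0;
      0, 0, 0, kr 3 r θ / 2;
      0, 0, 0, kt 3 r θ / 2;
      0, kr 3 r θ / 2, kt 3 r θ / 2, 0]]

section Perturbation

variable {M : ℝ} {x : Fin 4 → ℝ} {k kr kt krr krt ktt : Fin 4 → ℝ → ℝ → ℝ}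

theorem pd_diagPert (hM : 0 < M) (hk : IsJet M k kr kt krr krt ktt) (hx : x ∈ exterior M)
    (a b c : Fin 4) :
    pd c (fun y => diagPert M k y a b) x
      = if a = b then
          ![0, gDiagR M (x 1) (x 2) a * k a (x 1) (x 2) + gDiag M (x 1) (x 2) a * kr a (x 1) (x 2),
            gDiagT (x 1) (x 2) a * k a (x 1) (x 2) + gDiag M (x 1) (x 2) a * kt a (x 1) (x 2), 0] c
        else 0 := by
  split_ifs with h
  · subst h
    exact pd_of_radial_polar (G := fun r θ => gDiag M r θ a * k a r θ) hx
      (fun y _ => by rw [diagPert, Matrix.diagonal_apply_eq])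
      ((hasDerivAt_gDiag_r (exterior_r_ne hM hx) (exterior_f_ne hM hx) a).mul (hk.r a _ _ hx.1))
      ((hasDerivAt_gDiag_t a).mul (hk.t a _ _)) c
  · rw [pd_of_radial_polar (G := fun _ _ => 0) (Gr := 0) (Gθ := 0) hx
      (fun y _ => by rw [diagPert, Matrix.diagonal_apply_ne _ h])
      (hasDerivAt_const _ _) (hasDerivAt_const _ _)]
    fin_cases c <;> rfl

theorem covDeriv_diagPert (hM : 0 < M) (hk : IsJet M k kr kt krr krt ktt) (hx : x ∈ exterior M)
    (c a b : Fin 4) :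
    covDeriv (schwarzschild M) (diagPert M k) c a b x
      = (if a = b then
          ![0, gDiagR M (x 1) (x 2) a * k a (x 1) (x 2) + gDiag M (x 1) (x 2) a * kr a (x 1) (x 2),
            gDiagT (x 1) (x 2) a * k a (x 1) (x 2) + gDiag M (x 1) (x 2) a * kt a (x 1) (x 2), 0] c
        else 0)
        - (gammaTable M (x 1) (x 2) b c a * (gDiag M (x 1) (x 2) b * k b (x 1) (x 2))
          + gammaTable M (x 1) (x 2) a c b * (gDiag M (x 1) (x 2) a * k a (x 1) (x 2))) := by
  unfold covDeriv
  rw [pd_diagPert hM hk hx]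
  simp only [christoffel_schwarzschild hM hx, diagPert, Matrix.diagonal_apply, mul_ite, mul_zero,
    Finset.sum_add_distrib, Finset.sum_ite_eq, Finset.sum_ite_eq', Finset.mem_univ, if_true]

theorem linConnection_diagPert (hM : 0 < M) (hk : IsJet M k kr kt krr krt ktt)
    (hx : x ∈ exterior M) (c a b : Fin 4) :
    linConnection (schwarzschild M) (diagPert M k) c a b x
      = connTable M k kr kt (x 1) (x 2) c a b := by
  have h1 := exterior_r_ne hM hx
  have h2 := exterior_f_ne hM hx
  have h3 := exterior_sin_ne hx
  unfold linConnection
  simp only [covDeriv_diagPert hM hk hx, schwarzschild_inv hM hx, Matrix.diagonal_apply, ite_mul,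
    zero_mul, Finset.sum_ite_eq, Finset.mem_univ, if_true]
  generalize x 1 = r at *
  generalize x 2 = θ at *
  fin_cases c <;> fin_cases a <;> fin_cases b <;>
    simp [gammaTable, gDiag, gDiagR, gDiagT, connTable] <;> field_simp <;> ring

end Perturbation

/-- Radial derivatives of `connTable`. -/
def connTableR (M : ℝ) (k kr krr krt : Fin 4 → ℝ → ℝ → ℝ) (kt : Fin 4 → ℝ → ℝ → ℝ) (r θ : ℝ) :
    Fin 4 → Matrix (Fin 4) (Fin 4) ℝ :=
  let F := f M r
  let u := (1 - F) / r
  ![!![0, krr 0 r θ / 2, krt 0 r θ / 2, 0;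
      krr 0 r θ / 2, 0, 0, 0;
      krt 0 r θ / 2, 0, 0, 0;
      0, 0, 0, 0],
    !![(u * (F * kr 0 r θ + (k 0 r θ - k 1 r θ) * u) + F * (u * kr 0 r θ + F * krr 0 r θ
          + (kr 0 r θ - kr 1 r θ) * u + (k 0 r θ - k 1 r θ) * (-2 * u / r))) / 2, 0, 0, 0;
      0, krr 1 r θ / 2, krt 1 r θ / 2, 0;
      0, krt 1 r θ / 2, -(u * (r ^ 2 * kr 2 r θ + (k 2 r θ - k 1 r θ) * (2 * r))
          + F * (2 * r * kr 2 r θ + r ^ 2 * krr 2 r θ + (kr 2 r θ - kr 1 r θ) * (2 * r)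
          + (k 2 r θ - k 1 r θ) * 2)) / 2, 0;
      0, 0, 0, -(u * (r ^ 2 * kr 3 r θ + (k 3 r θ - k 1 r θ) * (2 * r))
          + F * (2 * r * kr 3 r θ + r ^ 2 * krr 3 r θ + (kr 3 r θ - kr 1 r θ) * (2 * r)
          + (k 3 r θ - k 1 r θ) * 2)) / 2 * sin θ ^ 2],
    !![(u * kt 0 r θ / r ^ 2 + F * krt 0 r θ / r ^ 2 - 2 * F * kt 0 r θ / r ^ 3) / 2, 0, 0, 0;
      0, -(krt 1 r θ / (F * r ^ 2) - kt 1 r θ * (u * r ^ 2 + F * (2 * r)) / (F * r ^ 2) ^ 2) / 2,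
        krr 2 r θ / 2, 0;
      0, krr 2 r θ / 2, krt 2 r θ / 2, 0;
      0, 0, 0, -(sin θ ^ 2 * krt 3 r θ + (kr 3 r θ - kr 2 r θ) * (2 * sin θ * cos θ)) / 2],
    !![0, 0, 0, 0;
      0, 0, 0, krr 3 r θ / 2;
      0, 0, 0, krt 3 r θ / 2;
      0, krr 3 r θ / 2, krt 3 r θ / 2, 0]]

/-- Polar derivatives of `connTable`. -/
def connTableT (M : ℝ) (k kr kt krt ktt : Fin 4 → ℝ → ℝ → ℝ) (r θ : ℝ) :
    Fin 4 → Matrix (Fin 4) (Fin 4) ℝ :=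
  let F := f M r
  ![!![0, krt 0 r θ / 2, ktt 0 r θ / 2, 0;
      krt 0 r θ / 2, 0, 0, 0;
      ktt 0 r θ / 2, 0, 0, 0;
      0, 0, 0, 0],
    !![F * (F * krt 0 r θ + (kt 0 r θ - kt 1 r θ) * ((1 - F) / r)) / 2, 0, 0, 0;
      0, krt 1 r θ / 2, ktt 1 r θ / 2, 0;
      0, ktt 1 r θ / 2, -(F * (r ^ 2 * krt 2 r θ + (kt 2 r θ - kt 1 r θ) * (2 * r))) / 2, 0;
      0, 0, 0, -(F * (r ^ 2 * krt 3 r θ + (kt 3 r θ - kt 1 r θ) * (2 * r))) / 2 * sin θ ^ 2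
        - (F * (r ^ 2 * kr 3 r θ + (k 3 r θ - k 1 r θ) * (2 * r))) / 2 * (2 * sin θ * cos θ)],
    !![F * ktt 0 r θ / r ^ 2 / 2, 0, 0, 0;
      0, -(ktt 1 r θ / (F * r ^ 2)) / 2, krt 2 r θ / 2, 0;
      0, krt 2 r θ / 2, ktt 2 r θ / 2, 0;
      0, 0, 0, -(2 * sin θ * cos θ * kt 3 r θ + sin θ ^ 2 * ktt 3 r θ
        + (kt 3 r θ - kt 2 r θ) * (2 * sin θ * cos θ)
        + (k 3 r θ - k 2 r θ) * (2 * (cos θ ^ 2 - sin θ ^ 2))) / 2],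
    !![0, 0, 0, 0;
      0, 0, 0, krt 3 r θ / 2;
      0, 0, 0, ktt 3 r θ / 2;
      0, krt 3 r θ / 2, ktt 3 r θ / 2, 0]]

section Perturbation

variable {M : ℝ} {x : Fin 4 → ℝ} {k kr kt krr krt ktt : Fin 4 → ℝ → ℝ → ℝ}

theorem hasDerivAt_connTable_r (hM : 0 < M) (hk : IsJet M k kr kt krr krt ktt) {r θ : ℝ}
    (hr : 2 * M < r) (c a b : Fin 4) :
    HasDerivAt (fun s => connTable M k kr kt s θ c a b)
      (connTableR M k kr krr krt kt r θ c a b) r := by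
  have hF := hasDerivAt_f (M := M) (r := r) (by linarith)
  have hF0 := (f_pos hM hr).ne'
  have hr0 : r ≠ 0 := by linarith
  have hid := hasDerivAt_id r
  have h2 := hasDerivAt_pow 2 r
  have hu := (hF.const_sub 1).div hid hr0
  have h2r := hid.const_mul 2
  have z := hasDerivAt_const r (0 : ℝ)
  have k0 := hk.r 0 r θ hr
  have k1 := hk.r 1 r θ hr
  have k2 := hk.r 2 r θ hr
  have k3 := hk.r 3 r θ hr
  have r0 := hk.rr 0 r θ hr
  have r1 := hk.rr 1 r θ hr
  have r2 := hk.rr 2 r θ hr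
  have r3 := hk.rr 3 r θ hr
  have t0 := hk.tr 0 r θ hr
  have t1 := hk.tr 1 r θ hr
  have t2 := hk.tr 2 r θ hr
  have t3 := hk.tr 3 r θ hr
  fin_cases c <;> fin_cases a <;> fin_cases b <;>
    -- The alternatives settle the entries that are zero or half a jet function. The six entries
    -- left over are those with the metric or its derivatives as coefficients.
    first
    | exact z
    | exact r0.div_const 2
    | exact r1.div_const 2
    | exact r2.div_const 2
    | exact r3.div_const 2
    | exact t0.div_const 2
    | exact t1.div_const 2
    | exact t2.div_const 2
    | exact t3.div_const 2
    | skip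
  · refine ((hF.mul ((hF.mul r0).add ((k0.sub k1).mul hu))).div_const 2).congr_deriv ?_
    simp [connTableR, hF0]
    field_simp
    ring
  · refine ((hF.mul ((h2.mul r2).add ((k2.sub k1).mul h2r))).neg.div_const 2).congr_deriv ?_
    simp [connTableR, hF0]
    ring
  · refine (((hF.mul ((h2.mul r3).add ((k3.sub k1).mul h2r))).neg.div_const 2).mul_const
      (sin θ ^ 2)).congr_deriv ?_
    simp [connTableR, hF0]
    left
    ring
  · refine (((hF.mul t0).div h2 (pow_ne_zero 2 hr0)).div_const 2).congr_deriv ?_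
    simp [connTableR]
    field_simp
  · refine ((t1.div (hF.mul h2) (mul_ne_zero hF0 (pow_ne_zero 2 hr0))).neg.div_const 2
      ).congr_deriv ?_
    simp [connTableR]
    field_simp
    ring
  · refine (((t3.const_mul (sin θ ^ 2)).add ((k3.sub k2).mul_const (2 * sin θ * cos θ))
      ).neg.div_const 2).congr_deriv ?_
    simp [connTableR]

theorem hasDerivAt_connTable_t (hk : IsJet M k kr kt krr krt ktt) {r θ : ℝ} (c a b : Fin 4) :
    HasDerivAt (fun s => connTable M k kr kt r s c a b)
      (connTableT M k kr kt krt ktt r θ c a b) θ := by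
  have z := hasDerivAt_const θ (0 : ℝ)
  have hs2 := (hasDerivAt_sin θ).pow 2
  have hsc := ((hasDerivAt_sin θ).const_mul 2).mul (hasDerivAt_cos θ)
  have k0 := hk.t 0 r θ
  have k1 := hk.t 1 r θ
  have k2 := hk.t 2 r θ
  have k3 := hk.t 3 r θ
  have r0 := hk.rt 0 r θ
  have r1 := hk.rt 1 r θ
  have r2 := hk.rt 2 r θ
  have r3 := hk.rt 3 r θ
  have t0 := hk.tt 0 r θ
  have t1 := hk.tt 1 r θ
  have t2 := hk.tt 2 r θ
  have t3 := hk.tt 3 r θ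
  fin_cases c <;> fin_cases a <;> fin_cases b <;>
    first
    | exact z
    | exact r0.div_const 2
    | exact r1.div_const 2
    | exact r2.div_const 2
    | exact r3.div_const 2
    | exact t0.div_const 2
    | exact t1.div_const 2
    | exact t2.div_const 2
    | exact t3.div_const 2
    | skip
  · exact ((((r0.const_mul (f M r)).add ((k0.sub k1).mul_const _)).const_mul (f M r)).div_const 2)
  · exact (((r2.const_mul (r ^ 2)).add ((k2.sub k1).mul_const _)).const_mul (f M r)).neg.div_const 2
  · refine (((((r3.const_mul (r ^ 2)).add ((k3.sub k1).mul_const (2 * r))).const_mul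
      (f M r)).neg.div_const 2).mul hs2).congr_deriv ?_
    simp [connTableT]
    ring
  · exact ((t0.const_mul (f M r)).div_const _).div_const 2
  · exact (t1.div_const _).neg.div_const 2
  · refine (((hs2.mul t3).add ((k3.sub k2).mul hsc)).neg.div_const 2).congr_deriv ?_
    simp [connTableT]
    ring

theorem covDerivConnection_diagPert (hM : 0 < M) (hk : IsJet M k kr kt krr krt ktt)
    (hx : x ∈ exterior M) (c d a b : Fin 4) :
    covDerivConnection (schwarzschild M) (diagPert M k) c d a b x
      = ![0, connTableR M k kr krr krt kt (x 1) (x 2) d a b,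
            connTableT M k kr kt krt ktt (x 1) (x 2) d a b, 0] c
        + ∑ e, (gammaTable M (x 1) (x 2) d c e * connTable M k kr kt (x 1) (x 2) e a b
          - gammaTable M (x 1) (x 2) e c a * connTable M k kr kt (x 1) (x 2) d e b
          - gammaTable M (x 1) (x 2) e c b * connTable M k kr kt (x 1) (x 2) d a e) := by
  unfold covDerivConnection
  rw [pd_of_radial_polar (G := fun r θ => connTable M k kr kt r θ d a b) hx
    (fun y hy => linConnection_diagPert hM hk hy d a b)
    (hasDerivAt_connTable_r hM hk hx.1 d a b) (hasDerivAt_connTable_t hk d a b)]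
  simp only [christoffel_schwarzschild hM hx, linConnection_diagPert hM hk hx]

end Perturbation

/-! ### Modes of the C-metric -/

section Modes

/-- Mixed components of the modes of the linearized C-metric: a conformal part `β r cos θ`, a mass
part `m`, a conicity part `C`, and a traceless angular part `A`. -/
def modeJet (M m C β : ℝ) (A : ℝ → ℝ) : Fin 4 → ℝ → ℝ → ℝ :=
  ![fun r θ => β * r * cos θ - 2 * m / (r * f M r), fun r θ => β * r * cos θ + 2 * m / (r * f M r),
    fun r θ => C + β * r * cos θ + A θ, fun r θ => C + β * r * cos θ - A θ]

/-- The mass terms have this simple form because `r f = r - 2M` has derivative `1`. -/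
def modeJetR (M m β : ℝ) : Fin 4 → ℝ → ℝ → ℝ :=
  ![fun r θ => β * cos θ + 2 * m / (r * f M r) ^ 2, fun r θ => β * cos θ - 2 * m / (r * f M r) ^ 2,
    fun _ θ => β * cos θ, fun _ θ => β * cos θ]

def modeJetT (β : ℝ) (A' : ℝ → ℝ) : Fin 4 → ℝ → ℝ → ℝ :=
  ![fun r θ => -(β * r * sin θ), fun r θ => -(β * r * sin θ),
    fun r θ => -(β * r * sin θ) + A' θ, fun r θ => -(β * r * sin θ) - A' θ]

def modeJetRR (M m : ℝ) : Fin 4 → ℝ → ℝ → ℝ :=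
  ![fun r _ => -(4 * m / (r * f M r) ^ 3), fun r _ => 4 * m / (r * f M r) ^ 3,
    fun _ _ => 0, fun _ _ => 0]

def modeJetRT (β : ℝ) : Fin 4 → ℝ → ℝ → ℝ := fun _ _ θ => -(β * sin θ)

def modeJetTT (β : ℝ) (A'' : ℝ → ℝ) : Fin 4 → ℝ → ℝ → ℝ :=
  ![fun r θ => -(β * r * cos θ), fun r θ => -(β * r * cos θ),
    fun r θ => -(β * r * cos θ) + A'' θ, fun r θ => -(β * r * cos θ) - A'' θ]

variable {M m C β : ℝ} {A A' A'' : ℝ → ℝ}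

theorem isJet_modeJet (hM : 0 < M) (hA : ∀ θ, HasDerivAt A (A' θ) θ)
    (hA' : ∀ θ, HasDerivAt A' (A'' θ) θ) :
    IsJet M (modeJet M m C β A) (modeJetR M m β) (modeJetT β A') (modeJetRR M m) (modeJetRT β)
      (modeJetTT β A'') := by
  have hrF : ∀ r, 2 * M < r → HasDerivAt (fun s => s * f M s) 1 r := by
    intro r hr
    have hr0 : r ≠ 0 := by linarith
    refine ((hasDerivAt_id r).mul (hasDerivAt_f hr0)).congr_deriv ?_
    simp only [id]
    field_simp
    ring
  have hne : ∀ r, 2 * M < r → r * f M r ≠ 0 := fun r hr =>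
    mul_ne_zero (by linarith) (f_pos hM hr).ne'
  have hlin : ∀ r θ, HasDerivAt (fun s => β * s * cos θ) (β * cos θ) r := fun r θ => by
    simpa using ((hasDerivAt_id r).const_mul β).mul_const (cos θ)
  have hcos : ∀ r θ, HasDerivAt (fun s => β * r * cos s) (-(β * r * sin θ)) θ := fun r θ => by
    simpa using (hasDerivAt_cos θ).const_mul (β * r)
  have hsin : ∀ r θ, HasDerivAt (fun s => -(β * r * sin s)) (-(β * r * cos θ)) θ := fun r θ =>
    ((hasDerivAt_sin θ).const_mul (β * r)).neg
  have hinv : ∀ r, 2 * M < r →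
      HasDerivAt (fun s => 2 * m / (s * f M s)) (-(2 * m / (r * f M r) ^ 2)) r := fun r hr => by
    refine ((hasDerivAt_const r (2 * m)).div (hrF r hr) (hne r hr)).congr_deriv ?_
    ring
  have hinv2 : ∀ r, 2 * M < r →
      HasDerivAt (fun s => 2 * m / (s * f M s) ^ 2) (-(4 * m / (r * f M r) ^ 3)) r := fun r hr => by
    refine ((hasDerivAt_const r (2 * m)).div ((hrF r hr).pow 2)
      (pow_ne_zero 2 (hne r hr))).congr_deriv ?_
    have := hne r hr
    simp
    field_simp
    ring
  have hc1 : ∀ θ, HasDerivAt (fun s => β * cos s) (-(β * sin θ)) θ := fun θ => by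
    simpa using (hasDerivAt_cos θ).const_mul β
  constructor
  · intro a r θ hr
    fin_cases a
    · exact ((hlin r θ).sub (hinv r hr)).congr_deriv (by simp [modeJetR])
    · exact ((hlin r θ).add (hinv r hr)).congr_deriv (by simp [modeJetR]; ring)
    · exact ((hlin r θ).const_add C).add_const (A θ)
    · exact ((hlin r θ).const_add C).sub_const (A θ)
  · intro a r θ
    fin_cases a
    · exact (hcos r θ).sub_const _
    · exact (hcos r θ).add_const _
    · exact ((hcos r θ).const_add C).add (hA θ)
    · exact ((hcos r θ).const_add C).sub (hA θ)
  · intro a r θ hr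
    fin_cases a
    · exact (hinv2 r hr).const_add _
    · exact ((hinv2 r hr).const_sub _).congr_deriv (by simp [modeJetRR])
    · exact hasDerivAt_const _ _
    · exact hasDerivAt_const _ _
  · intro a r θ
    fin_cases a
    · exact (hc1 θ).add_const _
    · exact (hc1 θ).sub_const _
    · exact hc1 θ
    · exact hc1 θ
  · intro a r θ hr
    have h : HasDerivAt (fun s => -(β * s * sin θ)) (-(β * sin θ)) r :=
      (((hasDerivAt_id r).const_mul β).mul_const (sin θ)).neg.congr_deriv (by simp)
    fin_cases a
    · exact h
    · exact h
    · exact h.add_const _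
    · exact h.sub_const _
  · intro a r θ
    fin_cases a
    · exact hsin r θ
    · exact hsin r θ
    · exact (hsin r θ).add (hA' θ)
    · exact (hsin r θ).sub (hA' θ)

-- The mass part is a variation within the Ricci-flat Schwarzschild family and drops out. Rescaling
-- the sphere by `C` leaves the intrinsic curvature of `γ` unchanged but not the warping
-- contribution, a mismatch of `-C γ`. For the conformal part, `r cos θ` is an affine function when
-- `M = 0`, so only a term proportional to `r (1 - f) = 2M` survives. The traceless part enters
-- through half its double divergence on the unit sphere.
set_option maxHeartbeats 1600000 in
theorem linRicci_modeJet (hM : 0 < M) (hA : ∀ θ, HasDerivAt A (A' θ) θ)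
    (hA' : ∀ θ, HasDerivAt A' (A'' θ) θ) {x : Fin 4 → ℝ} (hx : x ∈ exterior M) :
    linRicci (schwarzschild M) (diagPert M (modeJet M m C β A)) x
      = (-C + 3 / 2 * β * x 1 * (1 - f M (x 1)) * cos (x 2)
          + (A'' (x 2) + 3 * (cos (x 2) / sin (x 2)) * A' (x 2) - 2 * A (x 2)) / 2)
        • gammaTensor x := by
  have h1 := exterior_r_ne hM hx
  have h2 := exterior_f_ne hM hx
  have h3 := exterior_sin_ne hx
  have hk := isJet_modeJet (m := m) (C := C) (β := β) hM hA hA'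
  ext a b
  simp only [linRicci, Matrix.of_apply, covDerivConnection_diagPert hM hk hx, gammaTensor]
  generalize x 1 = r at *
  generalize x 2 = θ at *
  fin_cases a <;> fin_cases b <;>
    simp [Fin.sum_univ_four, gammaTable, connTable, connTableR, connTableT, modeJet, modeJetR,
      modeJetT, modeJetRR, modeJetRT, modeJetTT] <;> try (field_simp; try ring)

end Modes

/-- Mixed components of the linearized C-metric. -/
def cMetricJet (M M₁ α₁ C₁ : ℝ) : Fin 4 → ℝ → ℝ → ℝ :=
  ![fun r θ => -2 * α₁ * r * cos θ - 2 * M₁ / (r * f M r),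
    fun r θ => -2 * α₁ * r * cos θ + 2 * M₁ / (r * f M r),
    fun r θ => -2 * α₁ * r * cos θ - 2 * α₁ * M * cos θ,
    fun r θ => -2 * α₁ * r * cos θ + 2 * α₁ * M * cos θ + 2 * C₁]

/-- No condition is put on `θ`, since the harmonic coefficients evaluate the perturbation at every
angle. At `ε = 0` the acceleration vanishes, so `P = 1` and `Q = f`. -/
theorem linCMetric_eq {M M₁ α₁ C₁ : ℝ} (hM : 0 < M) {x : Fin 4 → ℝ} (hx : 2 * M < x 1) :
    linCMetric M M₁ α₁ C₁ x = diagPert M (cMetricJet M M₁ α₁ C₁) x := by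
  have hr0 : x 1 ≠ 0 := by linarith
  have hF0 := (f_pos hM hx).ne'
  ext a b
  by_cases hab : a = b
  swap
  · simp [linCMetric, cMetric, diagPert, Matrix.diagonal_apply_ne _ hab]
  subst hab
  simp only [linCMetric, cMetric, diagPert, Matrix.of_apply, Matrix.smul_apply,
    Matrix.diagonal_apply_eq, smul_eq_mul]
  generalize x 1 = r at *
  generalize x 2 = θ at *
  have hε := hasDerivAt_id (0 : ℝ)
  have hα : HasDerivAt (fun ε : ℝ => ε * α₁) α₁ 0 := by simpa using hε.mul_const α₁
  have hm : HasDerivAt (fun ε : ℝ => M + ε * M₁) M₁ 0 := by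
    simpa using (hε.mul_const M₁).const_add M
  have hC : HasDerivAt (fun ε : ℝ => 1 + ε * C₁) C₁ 0 := by
    simpa using (hε.mul_const C₁).const_add 1
  have hW : HasDerivAt (fun ε : ℝ => 1 / (1 + ε * α₁ * r * cos θ) ^ 2)
      (-2 * α₁ * r * cos θ) 0 := by
    refine ((hasDerivAt_const (0 : ℝ) (1 : ℝ)).div
      ((((hα.mul_const r).mul_const (cos θ)).const_add 1).pow 2) (by simp)).congr_deriv ?_
    simp
    ring
  have hP : HasDerivAt (fun ε : ℝ => 1 + 2 * (ε * α₁) * (M + ε * M₁) * cos θ)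
      (2 * α₁ * M * cos θ) 0 := by
    refine ((((hα.const_mul 2).mul hm).mul_const (cos θ)).const_add 1).congr_deriv ?_
    simp
  have hQ : HasDerivAt (fun ε : ℝ => (1 - (ε * α₁) ^ 2 * r ^ 2) * (1 - 2 * (M + ε * M₁) / r))
      (-2 * M₁ / r) 0 := by
    refine ((((hα.pow 2).mul_const (r ^ 2)).const_sub 1).mul
      (((hm.const_mul 2).div_const r).const_sub 1)).congr_deriv ?_
    simp
    ring
  have hQ0 : (1 - (0 * α₁) ^ 2 * r ^ 2) * (1 - 2 * (M + 0 * M₁) / r) = f M r := by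
    simp [f]
  fin_cases a
  · refine (hW.mul hQ.neg).deriv.trans ?_
    simp only [Pi.neg_apply]
    rw [hQ0]
    simp [gDiag, cMetricJet]
    field_simp
    ring
  · refine (hW.mul ((hasDerivAt_const (0 : ℝ) (1 : ℝ)).div hQ (by rw [hQ0]; exact hF0))).deriv.trans ?_
    simp only [Pi.div_apply]
    rw [hQ0]
    simp [gDiag, cMetricJet]
    field_simp
  · refine (hW.mul ((hasDerivAt_const (0 : ℝ) (r ^ 2)).div hP (by simp))).deriv.trans ?_
    simp [gDiag, cMetricJet]
    ring
  · refine (hW.mul (((hP.mul (hC.pow 2)).mul_const (r ^ 2)).mul_const (sin θ ^ 2))).deriv.trans ?_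
    simp [gDiag, cMetricJet]
    ring

/-! ### Harmonic coefficients -/

/-- The weight `sin θ` removes the points where division by `sin² θ` takes its default value. -/
theorem sphereIntegral_congr {u v : ℝ → ℝ → ℝ} (h : ∀ θ φ, sin θ ≠ 0 → u θ φ = v θ φ) :
    sphereIntegral u = sphereIntegral v := by
  unfold sphereIntegral
  congr 1
  ext φ
  congr 1
  ext θ
  by_cases hs : sin θ = 0
  · simp [hs]
  · rw [h θ φ hs]

theorem sphereIntegral_polynomial (p : Polynomial ℝ) :
    sphereIntegral (fun θ _ => p.eval (cos θ)) = 2 * π * legendreIntegral p := by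
  unfold sphereIntegral
  simp only [integral_cos_comp, intervalIntegral.integral_const, smul_eq_mul]
  ring

theorem sphereIntegral_zero : sphereIntegral (fun _ _ => 0) = 0 := by
  simp [sphereIntegral]

theorem legendreIntegral_legendreP (l : ℕ) :
    legendreIntegral (legendreP l) = if l = 0 then 2 else 0 := by
  split_ifs with h
  · subst h
    simpa [legendreP_zero] using legendreIntegral_sq 0
  · simpa [legendreP_zero] using legendreP_orthogonal (Nat.pos_of_ne_zero h)

theorem legendreIntegral_X_mul_legendreP (l : ℕ) :
    legendreIntegral (Polynomial.X * legendreP l) = if l = 1 then 2 / 3 else 0 := by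
  rw [← legendreP_one]
  split_ifs with h
  · subst h
    have h := legendreIntegral_sq 1
    rw [← pow_two]
    norm_num at h
    linarith
  · rcases lt_or_gt_of_ne h with h | h
    · exact legendreP_orthogonal h
    · rw [mul_comm]
      exact legendreP_orthogonal h

theorem scalarCoeff_zero (l : ℕ) : scalarCoeff l (fun _ _ => 0) = 0 := by
  simp [scalarCoeff, sphereIntegral_zero]

theorem evenVectorCoeff_zero (l : ℕ) : evenVectorCoeff l (fun _ _ => 0) = 0 := by
  simp [evenVectorCoeff, sphereIntegral_zero]

theorem oddVectorCoeff_zero (l : ℕ) : oddVectorCoeff l (fun _ _ => 0) = 0 := by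
  simp [oddVectorCoeff, sphereIntegral_zero]

theorem oddTensorCoeff_zero (l : ℕ) : oddTensorCoeff l (fun _ _ => 0) = 0 := by
  simp [oddTensorCoeff, sphereIntegral_zero]

theorem scalarCoeff_affine (l : ℕ) {u : ℝ → ℝ → ℝ} {p q : ℝ}
    (h : ∀ θ φ, sin θ ≠ 0 → u θ φ = p + q * cos θ) :
    scalarCoeff l u = (if l = 0 then p else 0) + if l = 1 then q else 0 := by
  have h1 : sphereIntegral (fun θ φ => u θ φ * harm l θ)
      = 2 * π * legendreIntegral (Polynomial.C p * legendreP l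
        + Polynomial.C q * (Polynomial.X * legendreP l)) := by
    rw [← sphereIntegral_polynomial]
    refine sphereIntegral_congr fun θ φ hs => ?_
    rw [h θ φ hs]
    simp [harm]
    ring
  have hpi := pi_ne_zero
  rw [scalarCoeff, h1, map_add, legendreIntegral_C_mul, legendreIntegral_C_mul,
    legendreIntegral_legendreP, legendreIntegral_X_mul_legendreP]
  rcases l with _ | _ | l
  · simp
    field_simp
    norm_num
  · simp
    field_simp
    ring
  · simp

/-- Two integrations by parts with `w = (p + q z)(1 - z²)`: an antiderivative of `w P'' - w'' P` is
`w P' - w' P`. Since `w''` is affine, its integral against `P_l` vanishes for `l ≥ 2`, and since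
`w(±1) = 0` only `-w' P` contributes at the endpoints. -/
theorem legendreIntegral_harm2 {l : ℕ} (hl : 2 ≤ l) (p q : ℝ) :
    legendreIntegral ((Polynomial.C p + Polynomial.C q * Polynomial.X) *
        ((1 - Polynomial.X ^ 2) * (legendreP l).derivative.derivative))
      = 2 * (p * (1 + (-1) ^ l) + q * (1 - (-1) ^ l)) := by
  have h1 := legendreIntegral_derivative ((Polynomial.C p + Polynomial.C q * Polynomial.X) *
      ((1 - Polynomial.X ^ 2) * (legendreP l).derivative)
    - (Polynomial.C q * (1 - Polynomial.X ^ 2)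
      - 2 * Polynomial.X * (Polynomial.C p + Polynomial.C q * Polynomial.X)) * legendreP l)
  have h2 : Polynomial.derivative ((Polynomial.C p + Polynomial.C q * Polynomial.X) *
      ((1 - Polynomial.X ^ 2) * (legendreP l).derivative)
    - (Polynomial.C q * (1 - Polynomial.X ^ 2)
      - 2 * Polynomial.X * (Polynomial.C p + Polynomial.C q * Polynomial.X)) * legendreP l)
      = (Polynomial.C p + Polynomial.C q * Polynomial.X) *
          ((1 - Polynomial.X ^ 2) * (legendreP l).derivative.derivative)
        + (Polynomial.C (2 * p) * legendreP l
          + Polynomial.C (6 * q) * (Polynomial.X * legendreP l)) := by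
    simp only [Polynomial.derivative_add, Polynomial.derivative_mul, Polynomial.derivative_sub,
      Polynomial.derivative_X_sq, Polynomial.derivative_one, Polynomial.derivative_C,
      Polynomial.derivative_X, Polynomial.derivative_ofNat, map_mul, map_ofNat]
    ring
  rw [h2, map_add, map_add, legendreIntegral_C_mul, legendreIntegral_C_mul,
    legendreIntegral_legendreP, legendreIntegral_X_mul_legendreP, if_neg (by omega),
    if_neg (by omega)] at h1
  simp [legendreP_eval_one, legendreP_eval_neg_one] at h1
  rw [h1]
  ring

theorem evenTensorCoeff_linCMetric (M α₁ C₁ : ℝ) (l : ℕ) {u : ℝ → ℝ → ℝ}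
    (h : ∀ θ φ, sin θ ≠ 0 → u θ φ = -C₁ + -(2 * α₁ * M) * cos θ) :
    evenTensorCoeff l u
      = 32 * π * tension M α₁ C₁ l / (((l : ℝ) - 1) * l * (l + 1) * (l + 2)) := by
  -- For `l ≤ 1` both sides are divisions by zero, hence `0`, in accordance with the vanishing
  -- harmonic.
  by_cases hl : l ≤ 1
  · interval_cases l <;> simp [evenTensorCoeff]
  have h1 : sphereIntegral (fun θ φ => u θ φ * harm2 l θ) = 2 * π * legendreIntegral
      ((Polynomial.C (-C₁) + Polynomial.C (-(2 * α₁ * M)) * Polynomial.X) *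
        ((1 - Polynomial.X ^ 2) * (legendreP l).derivative.derivative)) := by
    rw [← sphereIntegral_polynomial]
    refine sphereIntegral_congr fun θ φ hs => ?_
    rw [h θ φ hs]
    simp [harm2]
  have hpi := pi_ne_zero
  rw [evenTensorCoeff, h1, legendreIntegral_harm2 (by omega), tension]
  generalize ((l : ℝ) - 1) * l * (l + 1) * (l + 2) = d
  by_cases hd : d = 0
  · simp [hd]
  · field_simp
    ring

theorem harm2_of_le_one {l : ℕ} (hl : l ≤ 1) (θ : ℝ) : harm2 l θ = 0 := by
  interval_cases l <;> simp [harm2, legendreP_zero, legendreP_one]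

/-- The angular part of the mode of degree `l` of the linearized C-metric. -/
def modeAngular (M α₁ C₁ : ℝ) (l : ℕ) (θ : ℝ) : ℝ :=
  16 * π * tension M α₁ C₁ l / (((l : ℝ) - 1) * l * (l + 1) * (l + 2)) * harm2 l θ

/-- The scalar coefficients are affine in `cos θ`, so they supply `m` and `C` at `l = 0`, `β` at `l
= 1` and nothing beyond. Only the traceless angular coefficient persists for `l ≥ 2`. -/
theorem modePart_linCMetric {M M₁ α₁ C₁ : ℝ} (hM : 0 < M) (l : ℕ) {x : Fin 4 → ℝ}
    (hx : 2 * M < x 1) :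
    modePart l (linCMetric M M₁ α₁ C₁) x
      = diagPert M (modeJet M (if l = 0 then M₁ else 0) (if l = 0 then C₁ else 0)
          (if l = 1 then -2 * α₁ else 0) (modeAngular M α₁ C₁ l)) x := by
  have hr0 : x 1 ≠ 0 := by linarith
  have hF0 := (f_pos hM hx).ne'
  have hu : ∀ ϑ ϕ, linCMetric M M₁ α₁ C₁ ![x 0, x 1, ϑ, ϕ]
      = diagPert M (cMetricJet M M₁ α₁ C₁) ![x 0, x 1, ϑ, ϕ] := fun ϑ ϕ =>
    linCMetric_eq hM (by simpa using hx)
  have c00 : scalarCoeff l (fun ϑ ϕ => diagPert M (cMetricJet M M₁ α₁ C₁) ![x 0, x 1, ϑ, ϕ] 0 0)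
      = (if l = 0 then 2 * M₁ / x 1 else 0)
        + if l = 1 then f M (x 1) * (2 * α₁ * x 1) else 0 := by
    refine scalarCoeff_affine l fun θ φ _ => ?_
    simp [diagPert, gDiag, cMetricJet]
    field_simp
    ring
  have c11 : scalarCoeff l (fun ϑ ϕ => diagPert M (cMetricJet M M₁ α₁ C₁) ![x 0, x 1, ϑ, ϕ] 1 1)
      = (if l = 0 then 2 * M₁ / (x 1 * f M (x 1) ^ 2) else 0)
        + if l = 1 then -(2 * α₁ * x 1) / f M (x 1) else 0 := by
    refine scalarCoeff_affine l fun θ φ _ => ?_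
    simp [diagPert, gDiag, cMetricJet]
    field_simp
    ring
  have c0 : scalarCoeff l (fun ϑ ϕ =>
      (diagPert M (cMetricJet M M₁ α₁ C₁) ![x 0, x 1, ϑ, ϕ] 2 2
        + diagPert M (cMetricJet M M₁ α₁ C₁) ![x 0, x 1, ϑ, ϕ] 3 3 / sin ϑ ^ 2) / x 1 ^ 2)
      = (if l = 0 then 2 * C₁ else 0) + if l = 1 then -(4 * α₁ * x 1) else 0 := by
    refine scalarCoeff_affine l fun θ φ hs => ?_
    simp [diagPert, gDiag, cMetricJet]
    field_simp
    ring
  have c2 : evenTensorCoeff l (fun ϑ ϕ =>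
      (diagPert M (cMetricJet M M₁ α₁ C₁) ![x 0, x 1, ϑ, ϕ] 2 2
        - diagPert M (cMetricJet M M₁ α₁ C₁) ![x 0, x 1, ϑ, ϕ] 3 3 / sin ϑ ^ 2) / (2 * x 1 ^ 2))
      = 32 * π * tension M α₁ C₁ l / (((l : ℝ) - 1) * l * (l + 1) * (l + 2)) := by
    refine evenTensorCoeff_linCMetric M α₁ C₁ l fun θ φ hs => ?_
    simp [diagPert, gDiag, cMetricJet]
    field_simp
    ring
  have hoff : ∀ (ϑ ϕ : ℝ) (a b : Fin 4), a ≠ b →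
      diagPert M (cMetricJet M M₁ α₁ C₁) ![x 0, x 1, ϑ, ϕ] a b = 0 := fun ϑ ϕ a b hab =>
    Matrix.diagonal_apply_ne _ hab
  unfold modePart
  simp only [hu]
  rw [c00, c11, c0, c2]
  simp only [hoff _ _ 0 1 (by decide), hoff _ _ 0 2 (by decide), hoff _ _ 0 3 (by decide),
    hoff _ _ 1 2 (by decide), hoff _ _ 1 3 (by decide), hoff _ _ 2 3 (by decide), zero_div,
    scalarCoeff_zero, evenVectorCoeff_zero, oddVectorCoeff_zero, oddTensorCoeff_zero, zero_mul,
    mul_zero]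
  have hA : modeAngular M α₁ C₁ l (x 2)
      = 32 * π * tension M α₁ C₁ l / (((l : ℝ) - 1) * l * (l + 1) * (l + 2)) * harm2 l (x 2) / 2 := by
    unfold modeAngular
    ring
  generalize 32 * π * tension M α₁ C₁ l / (((l : ℝ) - 1) * l * (l + 1) * (l + 2)) = E at *
  have hA0 : modeAngular M α₁ C₁ 0 (x 2) = 0 := by
    simp [modeAngular, harm2_of_le_one (zero_le_one)]
  have hA1 : modeAngular M α₁ C₁ 1 (x 2) = 0 := by
    simp [modeAngular, harm2_of_le_one (le_refl 1)]
  have h0 : harm 0 (x 2) = 1 := by simp [harm, legendreP_zero]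
  have h1 : harm 1 (x 2) = cos (x 2) := by simp [harm, legendreP_one]
  clear hu hoff c00 c11 c0 c2
  unfold diagPert
  generalize x 1 = r at *
  generalize x 2 = θ at *
  rcases l with _ | _ | l
  · ext a b
    rw [harm2_of_le_one (by norm_num)]
    fin_cases a <;> fin_cases b <;> simp [gDiag, modeJet, h0, hA0] <;> field_simp
  · ext a b
    rw [harm2_of_le_one (by norm_num)]
    fin_cases a <;> fin_cases b <;> simp [gDiag, modeJet, h1, hA1] <;> field_simp <;> ring
  · ext a b
    fin_cases a <;> fin_cases b <;> simp [gDiag, modeJet, hA]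

/-! ### The stress of the modes -/

theorem linEinstein_congr {M : ℝ} {g h k : TensorField} {x : Fin 4 → ℝ} (hx : x ∈ exterior M)
    (hk : ∀ y ∈ exterior M, h y = k y) : linEinstein g h x = linEinstein g k x := by
  have h1 : ∀ y ∈ exterior M, ∀ c a b, covDeriv g h c a b y = covDeriv g k c a b y := by
    intro y hy c a b
    unfold covDeriv
    rw [pd_congr_of_eqOn hy (fun z hz => by rw [hk z hz]) c, hk y hy]
  have h2 : ∀ y ∈ exterior M, ∀ c a b, linConnection g h c a b y = linConnection g k c a b y := by
    intro y hy c a b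
    simp only [linConnection, h1 y hy]
  have h3 : ∀ c d a b, covDerivConnection g h c d a b x = covDerivConnection g k c d a b x := by
    intro c d a b
    unfold covDerivConnection
    rw [pd_congr_of_eqOn hx (fun z hz => h2 z hz d a b) c]
    simp only [h2 x hx]
  simp only [linEinstein, linRicci, h3]

/-- The trace of `ρ γ` is `2ρ / r²`; subtracting half of it times `g = y + r² γ` cancels the sphere
part exactly. -/
theorem linEinstein_of_linRicci {M ρ : ℝ} (hM : 0 < M) {h : TensorField} {x : Fin 4 → ℝ}
    (hx : x ∈ exterior M) (hρ : linRicci (schwarzschild M) h x = ρ • gammaTensor x) :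
    linEinstein (schwarzschild M) h x = (-(ρ / x 1 ^ 2)) • yTensor M x := by
  have h1 := exterior_r_ne hM hx
  have h2 := exterior_f_ne hM hx
  have h3 := exterior_sin_ne hx
  have htr : ∑ c, ∑ d, (schwarzschild M x)⁻¹ c d * linRicci (schwarzschild M) h x c d
      = 2 * ρ / x 1 ^ 2 := by
    rw [schwarzschild_inv hM hx, hρ]
    simp [Fin.sum_univ_four, gDiag, gammaTensor]
    field_simp
    norm_num
  rw [linEinstein, htr, hρ]
  ext a b
  fin_cases a <;> fin_cases b <;> simp [gammaTensor, yTensor, schwarzschild, h2] <;>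
    field_simp <;> ring

/-- This is the operator `A'' + 3 cot θ A' - 2 A` in the variable `z = cos θ`, where it reads `((1 -
z²) q)''`. The Legendre equation is used once to reduce `q` and again, with its derivative, to
reduce the result. -/
theorem legendreP_fourth_order (l : ℕ) :
    (1 - Polynomial.X ^ 2) * ((1 - Polynomial.X ^ 2)
        * (legendreP l).derivative.derivative).derivative.derivative
      - 4 * Polynomial.X * ((1 - Polynomial.X ^ 2)
        * (legendreP l).derivative.derivative).derivative
      - 2 * ((1 - Polynomial.X ^ 2) * (legendreP l).derivative.derivative)
      = Polynomial.C (((l : ℝ) - 1) * l * (l + 1) * (l + 2)) * legendreP l := by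
  have h1 := legendreP_ode l
  have h2 := congrArg Polynomial.derivative h1
  rw [h1]
  have hL : Polynomial.C (((l : ℝ) - 1) * l * (l + 1) * (l + 2))
      = Polynomial.C ((l : ℝ) * (l + 1)) * (Polynomial.C ((l : ℝ) * (l + 1)) - 2) := by
    simp only [map_add, map_mul, map_natCast, map_one, map_sub, map_ofNat]
    ring
  rw [hL]
  simp only [Polynomial.derivative_add, Polynomial.derivative_mul, Polynomial.derivative_sub,
    Polynomial.derivative_X_sq, Polynomial.derivative_one, Polynomial.derivative_C,
    Polynomial.derivative_X, Polynomial.derivative_ofNat, Polynomial.derivative_zero, map_ofNat] at h2 ⊢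
  generalize Polynomial.C ((l : ℝ) * (l + 1)) = L at *
  linear_combination 2 * Polynomial.X * h2 + (4 - L) * h1

theorem stressMode_eq {M M₁ α₁ C₁ : ℝ} (hM : 0 < M) (l : ℕ) {x : Fin 4 → ℝ} (hx : x ∈ exterior M) :
    stressMode M M₁ α₁ C₁ l x
      = (-(1 / x 1 ^ 2) * (tension M α₁ C₁ l * harm l (x 2))) • yTensor M x := by
  set q : Polynomial ℝ := (1 - Polynomial.X ^ 2) * (legendreP l).derivative.derivative with hq
  set E : ℝ := 16 * π * tension M α₁ C₁ l / (((l : ℝ) - 1) * l * (l + 1) * (l + 2)) with hE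
  have hpoly : ∀ (p : Polynomial ℝ) θ, HasDerivAt (fun θ => p.eval (cos θ))
      (p.derivative.eval (cos θ) * -sin θ) θ := fun p θ =>
    (p.hasDerivAt (cos θ)).comp θ (hasDerivAt_cos θ)
  have hA : ∀ θ, HasDerivAt (modeAngular M α₁ C₁ l)
      (E * (q.derivative.eval (cos θ) * -sin θ)) θ := fun θ => by
    have hfun : modeAngular M α₁ C₁ l = fun θ => E * q.eval (cos θ) := by
      ext θ
      simp [modeAngular, harm2, hq, hE]
    rw [hfun]
    exact (hpoly q θ).const_mul E
  have hA' : ∀ θ, HasDerivAt (fun θ => E * (q.derivative.eval (cos θ) * -sin θ))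
      (E * (q.derivative.derivative.eval (cos θ) * sin θ ^ 2
        - q.derivative.eval (cos θ) * cos θ)) θ := fun θ => by
    refine (((hpoly q.derivative θ).mul (hasDerivAt_sin θ).neg).const_mul E).congr_deriv ?_
    simp
    left
    ring
  have hric := linRicci_modeJet (m := if l = 0 then M₁ else 0) (C := if l = 0 then C₁ else 0)
    (β := if l = 1 then -2 * α₁ else 0) hM hA hA' hx
  have hr0 := exterior_r_ne hM hx
  have hs0 := exterior_sin_ne hx
  have hpi := pi_ne_zero
  have hρ : -(if l = 0 then C₁ else 0)
        + 3 / 2 * (if l = 1 then -2 * α₁ else 0) * x 1 * (1 - f M (x 1)) * cos (x 2)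
        + (E * (q.derivative.derivative.eval (cos (x 2)) * sin (x 2) ^ 2
            - q.derivative.eval (cos (x 2)) * cos (x 2))
          + 3 * (cos (x 2) / sin (x 2)) * (E * (q.derivative.eval (cos (x 2)) * -sin (x 2)))
          - 2 * modeAngular M α₁ C₁ l (x 2)) / 2
      = 8 * π * tension M α₁ C₁ l * harm l (x 2) := by
    have h4 := congrArg (Polynomial.eval (cos (x 2))) (legendreP_fourth_order l)
    simp only [← hq] at h4
    simp only [Polynomial.eval_sub, Polynomial.eval_mul, Polynomial.eval_one, Polynomial.eval_pow,
      Polynomial.eval_X, Polynomial.eval_ofNat, Polynomial.eval_C, ← sin_sq] at h4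
    have h5 : E * (q.derivative.derivative.eval (cos (x 2)) * sin (x 2) ^ 2
            - q.derivative.eval (cos (x 2)) * cos (x 2))
          + 3 * (cos (x 2) / sin (x 2)) * (E * (q.derivative.eval (cos (x 2)) * -sin (x 2)))
          - 2 * modeAngular M α₁ C₁ l (x 2)
        = E * ((((l : ℝ) - 1) * l * (l + 1) * (l + 2)) * harm l (x 2)) := by
      have h6 : modeAngular M α₁ C₁ l (x 2) = E * q.eval (cos (x 2)) := by
        simp [modeAngular, harm2, hq, hE]
      rw [h6, harm_eq, ← h4]
      field_simp
      ring
    rw [h5, hE]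
    -- For `l = 0` and `l = 1` the coefficient `E` is zero, and `-C₁` and `-6 α₁ M cos θ` must match
    -- `λ_l` by themselves. For `l ≥ 2` the factor `(l-1) l (l+1) (l+2)` is nonzero and cancels.
    rcases l with _ | _ | l
    · simp [tension, harm, legendreP_zero]
      field_simp
      ring
    · simp [tension, harm, legendreP_one, f]
      field_simp
      left
      ring
    · rw [if_neg (by omega), if_neg (by omega)]
      push_cast
      have e1 : (l : ℝ) + 1 + 1 - 1 ≠ 0 := by
        have : (0 : ℝ) ≤ l := by positivity
        linarith
      field_simp
      ring
  rw [hρ] at hric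
  unfold stressMode
  rw [linEinstein_congr hx (fun y hy => modePart_linCMetric hM l hy.1),
    linEinstein_of_linRicci hM hx hric, smul_smul]
  congr 1
  field_simp

/-! ### Functions of `(t, r)` -/

section TimeRadius

variable {M : ℝ} {F : ℝ → ℝ → ℝ} {t r : ℝ}

theorem isOpen_exteriorTR (M : ℝ) : IsOpen (exteriorTR M) :=
  isOpen_lt continuous_const continuous_snd

theorem hasDerivAt_dt (hF : DifferentiableAt ℝ (fun p : ℝ × ℝ => F p.1 p.2) (t, r)) :
    HasDerivAt (fun s => F s r) (fderiv ℝ (fun p : ℝ × ℝ => F p.1 p.2) (t, r) (1, 0)) t := by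
  have h := hF.hasFDerivAt
  exact h.comp_hasDerivAt t ((hasDerivAt_id t).prodMk (hasDerivAt_const t r))

theorem hasDerivAt_dr (hF : DifferentiableAt ℝ (fun p : ℝ × ℝ => F p.1 p.2) (t, r)) :
    HasDerivAt (fun s => F t s) (fderiv ℝ (fun p : ℝ × ℝ => F p.1 p.2) (t, r) (0, 1)) r := by
  have h := hF.hasFDerivAt
  exact h.comp_hasDerivAt r ((hasDerivAt_const r t).prodMk (hasDerivAt_id r))

theorem hasDerivAt_dt' (hF : DifferentiableAt ℝ (fun p : ℝ × ℝ => F p.1 p.2) (t, r)) :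
    HasDerivAt (fun s => F s r) (dt F t r) t :=
  (hasDerivAt_dt hF).differentiableAt.hasDerivAt

theorem hasDerivAt_dr' (hF : DifferentiableAt ℝ (fun p : ℝ × ℝ => F p.1 p.2) (t, r)) :
    HasDerivAt (fun s => F t s) (dr F t r) r :=
  (hasDerivAt_dr hF).differentiableAt.hasDerivAt

theorem differentiableAt_of_contDiffOn {n : ℕ∞ω}
    (hF : ContDiffOn ℝ n (fun p : ℝ × ℝ => F p.1 p.2) (exteriorTR M)) (hn : n ≠ 0)
    (hr : 2 * M < r) : DifferentiableAt ℝ (fun p : ℝ × ℝ => F p.1 p.2) (t, r) :=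
  (hF.differentiableOn hn).differentiableAt ((isOpen_exteriorTR M).mem_nhds hr)

theorem contDiffOn_dt {n m : ℕ∞ω}
    (hF : ContDiffOn ℝ n (fun p : ℝ × ℝ => F p.1 p.2) (exteriorTR M)) (hmn : m + 1 ≤ n) :
    ContDiffOn ℝ m (fun p : ℝ × ℝ => dt F p.1 p.2) (exteriorTR M) := by
  have hn : n ≠ 0 := by
    rintro rfl
    simp at hmn
  refine ((hF.fderiv_of_isOpen (isOpen_exteriorTR M) hmn).clm_apply
    (contDiffOn_const (c := ((1 : ℝ), (0 : ℝ))))).congr fun p hp => ?_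
  exact (hasDerivAt_dt (differentiableAt_of_contDiffOn hF hn hp)).deriv

theorem contDiffOn_dr {n m : ℕ∞ω}
    (hF : ContDiffOn ℝ n (fun p : ℝ × ℝ => F p.1 p.2) (exteriorTR M)) (hmn : m + 1 ≤ n) :
    ContDiffOn ℝ m (fun p : ℝ × ℝ => dr F p.1 p.2) (exteriorTR M) := by
  have hn : n ≠ 0 := by
    rintro rfl
    simp at hmn
  refine ((hF.fderiv_of_isOpen (isOpen_exteriorTR M) hmn).clm_apply
    (contDiffOn_const (c := ((0 : ℝ), (1 : ℝ))))).congr fun p hp => ?_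
  exact (hasDerivAt_dr (differentiableAt_of_contDiffOn hF hn hp)).deriv

theorem dt_dr_comm (hF : ContDiffOn ℝ 2 (fun p : ℝ × ℝ => F p.1 p.2) (exteriorTR M))
    (hr : 2 * M < r) : dt (dr F) t r = dr (dt F) t r := by
  set G : ℝ × ℝ → ℝ := fun p => F p.1 p.2 with hG
  have hmem : exteriorTR M ∈ 𝓝 (t, r) := (isOpen_exteriorTR M).mem_nhds hr
  have hd : DifferentiableAt ℝ (fderiv ℝ G) (t, r) :=
    ((hF.fderiv_of_isOpen (m := 1) (isOpen_exteriorTR M) (by norm_num)).differentiableOn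
      (by simp)).differentiableAt hmem
  have hsymm : IsSymmSndFDerivAt ℝ G (t, r) :=
    (hF.contDiffAt hmem).isSymmSndFDerivAt (by simp)
  have h1 : dt (dr F) t r = fderiv ℝ (fderiv ℝ G) (t, r) (1, 0) (0, 1) := by
    -- The exterior is invariant under translations of `t`, so this equality holds for every `s`;
    -- the counterpart in `r` holds only near the point.
    have heq : (fun s => dr F s r) = fun s => fderiv ℝ G (s, r) (0, 1) := by
      ext s
      exact (hasDerivAt_dr (differentiableAt_of_contDiffOn hF (by simp) hr)).deriv
    unfold dt
    rw [heq]
    have := (hd.hasFDerivAt.comp_hasDerivAt t ((hasDerivAt_id t).prodMk (hasDerivAt_const t r)))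
    exact (this.clm_apply (hasDerivAt_const t ((0 : ℝ), (1 : ℝ)))).deriv.trans (by simp)
  have h2 : dr (dt F) t r = fderiv ℝ (fderiv ℝ G) (t, r) (0, 1) (1, 0) := by
    have heq : (fun s => dt F t s) =ᶠ[𝓝 r] fun s => fderiv ℝ G (t, s) (1, 0) := by
      filter_upwards [lt_mem_nhds hr] with s hs
      exact (hasDerivAt_dt (differentiableAt_of_contDiffOn hF (by simp) hs)).deriv
    unfold dr
    rw [heq.deriv_eq]
    have := (hd.hasFDerivAt.comp_hasDerivAt r ((hasDerivAt_const r t).prodMk (hasDerivAt_id r)))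
    exact (this.clm_apply (hasDerivAt_const r ((1 : ℝ), (0 : ℝ)))).deriv.trans (by simp)
  rw [h1, h2, hsymm.eq]

theorem differentiableAt_chart {n : ℕ∞ω} {x : Fin 4 → ℝ}
    (hF : ContDiffOn ℝ n (fun p : ℝ × ℝ => F p.1 p.2) (exteriorTR M)) (hn : n ≠ 0)
    (hx : x ∈ exterior M) : DifferentiableAt ℝ (fun y : Fin 4 → ℝ => F (y 0) (y 1)) x := by
  have h : DifferentiableAt ℝ (fun p : ℝ × ℝ => F p.1 p.2) (x 0, x 1) :=
    differentiableAt_of_contDiffOn hF hn hx.1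
  have h2 : DifferentiableAt ℝ (fun y : Fin 4 → ℝ => (y 0, y 1)) x := by fun_prop
  exact h.comp x h2

end TimeRadius

/-! ### Lie derivatives of the Schwarzschild metric -/

section Lie

variable {M : ℝ} {x : Fin 4 → ℝ} {V W : CovectorField}

/-- The raised components `U` are supplied by the caller, so that each generator can be
differentiated in the form where it is simplest. -/
theorem lieMetric_schwarzschild (hM : 0 < M) (hx : x ∈ exterior M) {U : Fin 4 → (Fin 4 → ℝ) → ℝ}
    (hU : ∀ y ∈ exterior M, ∀ c, V y c = gDiag M (y 1) (y 2) c * U c y) (a b : Fin 4) :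
    lieMetric (schwarzschild M) V x a b
      = (if a = b then gDiagR M (x 1) (x 2) a * U 1 x + gDiagT (x 1) (x 2) a * U 2 x else 0)
        + gDiag M (x 1) (x 2) b * pd a (U b) x + gDiag M (x 1) (x 2) a * pd b (U a) x := by
  have hup : ∀ y ∈ exterior M, ∀ c, ((schwarzschild M y)⁻¹ *ᵥ V y) c = U c y := by
    intro y hy c
    rw [schwarzschild_inv hM hy, Matrix.mulVec_diagonal, hU y hy c, inv_mul_cancel_left₀]
    exact gDiag_ne_zero (exterior_r_ne hM hy) (exterior_f_ne hM hy) (exterior_sin_ne hy) c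
  have hpd : ∀ c d, pd d (fun y => ((schwarzschild M y)⁻¹ *ᵥ V y) c) x = pd d (U c) x :=
    fun c d => pd_congr_of_eqOn hx (fun y hy => hup y hy c) d
  simp only [lieMetric, Matrix.of_apply, hpd, hup x hx, pd_schwarzschild hM hx]
  rw [Finset.sum_add_distrib, Finset.sum_add_distrib]
  congr 1
  congr 1
  · split_ifs
    · simp [Fin.sum_univ_four]
      ring
    · simp
  · simp [schwarzschild_eq, Matrix.diagonal_apply]
  · simp [schwarzschild_eq, Matrix.diagonal_apply]

theorem lieMetric_congr (hM : 0 < M) (hx : x ∈ exterior M) (h : ∀ y ∈ exterior M, V y = W y) :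
    lieMetric (schwarzschild M) V x = lieMetric (schwarzschild M) W x := by
  have hne : ∀ y ∈ exterior M, ∀ c, gDiag M (y 1) (y 2) c ≠ 0 := fun y hy c =>
    gDiag_ne_zero (exterior_r_ne hM hy) (exterior_f_ne hM hy) (exterior_sin_ne hy) c
  ext a b
  rw [lieMetric_schwarzschild hM hx (U := fun c y => W y c / gDiag M (y 1) (y 2) c) fun y hy c => by
      rw [h y hy, mul_div_cancel₀ _ (hne y hy c)],
    lieMetric_schwarzschild hM hx (U := fun c y => W y c / gDiag M (y 1) (y 2) c) fun y hy c => by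
      rw [mul_div_cancel₀ _ (hne y hy c)]]

theorem differentiableAt_gDiag (hM : 0 < M) (hx : x ∈ exterior M) (c : Fin 4) :
    DifferentiableAt ℝ (fun y : Fin 4 → ℝ => gDiag M (y 1) (y 2) c) x := by
  have h1 := exterior_r_ne hM hx
  have h2 := exterior_f_ne hM hx
  have hf : DifferentiableAt ℝ (fun y : Fin 4 → ℝ => f M (y 1)) x :=
    DifferentiableAt.comp (g := f M) x (hasDerivAt_f h1).differentiableAt
      (differentiableAt_apply 1 x)
  fin_cases c
  · exact hf.neg
  · exact hf.inv h2
  · show DifferentiableAt ℝ (fun y : Fin 4 → ℝ => y 1 ^ 2) x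
    fun_prop
  · show DifferentiableAt ℝ (fun y : Fin 4 → ℝ => y 1 ^ 2 * sin (y 2) ^ 2) x
    fun_prop

theorem pd_add {F G : (Fin 4 → ℝ) → ℝ} (hF : DifferentiableAt ℝ F x) (hG : DifferentiableAt ℝ G x)
    (c : Fin 4) : pd c (fun y => F y + G y) x = pd c F x + pd c G x := by
  have hu : DifferentiableAt ℝ (fun s => Function.update x c s) (x c) :=
    (hasDerivAt_update x c (x c)).differentiableAt
  have hF' : DifferentiableAt ℝ (fun s => F (Function.update x c s)) (x c) :=
    DifferentiableAt.comp (x c) (by simpa using hF) hu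
  have hG' : DifferentiableAt ℝ (fun s => G (Function.update x c s)) (x c) :=
    DifferentiableAt.comp (x c) (by simpa using hG) hu
  exact deriv_fun_add hF' hG'

theorem differentiableAt_raise (hM : 0 < M) (hx : x ∈ exterior M)
    (hV : ∀ c, DifferentiableAt ℝ (fun y => V y c) x) (c : Fin 4) :
    DifferentiableAt ℝ (fun y => V y c / gDiag M (y 1) (y 2) c) x := by
  simp only [div_eq_mul_inv]
  refine (hV c).mul ((differentiableAt_gDiag hM hx c).inv ?_)
  exact gDiag_ne_zero (exterior_r_ne hM hx) (exterior_f_ne hM hx) (exterior_sin_ne hx) c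

theorem lieMetric_add (hM : 0 < M) (hx : x ∈ exterior M)
    (hV : ∀ c, DifferentiableAt ℝ (fun y => V y c) x)
    (hW : ∀ c, DifferentiableAt ℝ (fun y => W y c) x) :
    lieMetric (schwarzschild M) (fun y => V y + W y) x
      = lieMetric (schwarzschild M) V x + lieMetric (schwarzschild M) W x := by
  have hne : ∀ y ∈ exterior M, ∀ c, gDiag M (y 1) (y 2) c ≠ 0 := fun y hy c =>
    gDiag_ne_zero (exterior_r_ne hM hy) (exterior_f_ne hM hy) (exterior_sin_ne hy) c
  have hadd : ∀ c d, pd d (fun y => V y c / gDiag M (y 1) (y 2) c + W y c / gDiag M (y 1) (y 2) c) x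
      = pd d (fun y => V y c / gDiag M (y 1) (y 2) c) x
        + pd d (fun y => W y c / gDiag M (y 1) (y 2) c) x := fun c d =>
    pd_add (differentiableAt_raise hM hx hV c) (differentiableAt_raise hM hx hW c) d
  ext a b
  rw [Matrix.add_apply,
    lieMetric_schwarzschild hM hx (V := fun y => V y + W y)
      (U := fun c y => V y c / gDiag M (y 1) (y 2) c + W y c / gDiag M (y 1) (y 2) c)
      fun y hy c => by
        rw [← add_div, mul_div_cancel₀ _ (hne y hy c), Pi.add_apply],
    lieMetric_schwarzschild hM hx (V := V) (U := fun c y => V y c / gDiag M (y 1) (y 2) c)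
      fun y hy c => by rw [mul_div_cancel₀ _ (hne y hy c)],
    lieMetric_schwarzschild hM hx (V := W) (U := fun c y => W y c / gDiag M (y 1) (y 2) c)
      fun y hy c => by rw [mul_div_cancel₀ _ (hne y hy c)], hadd, hadd]
  split_ifs <;> ring

/-- Raised, the generator is `(C₁ / 2)(r ∂_r - t ∂_t)`. The dilation in `r` produces `r² C₁ γ`, and
the opposite one in `t` makes the remaining block a multiple of `dt² + f⁻² dr²`. -/
theorem lieMetric_conicityGenerator (hM : 0 < M) (C₁ : ℝ) (hx : x ∈ exterior M) :
    lieMetric (schwarzschild M) (conicityGenerator M C₁) x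
      = (-((1 - 3 * f M (x 1)) / 2 * C₁)) • massTensor M x + (x 1 ^ 2 * C₁) • gammaTensor x := by
  have h1 := exterior_r_ne hM hx
  have h2 := exterior_f_ne hM hx
  ext a b
  rw [lieMetric_schwarzschild hM hx
    (U := ![fun y => -(y 0 * (C₁ / 2)), fun y => y 1 * (C₁ / 2), fun _ => 0, fun _ => 0])
    fun y hy c => by
      have := exterior_f_ne hM hy
      fin_cases c <;> simp [conicityGenerator, gDiag] <;> field_simp]
  fin_cases a <;> fin_cases b <;>
    simp [pd, gDiag, gDiagR, gDiagT, massTensor, gammaTensor] <;> field_simp <;> ring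

theorem lieMetric_accelerationGenerator (hM : 0 < M) (lam : ℝ) (hx : x ∈ exterior M) :
    lieMetric (schwarzschild M) (accelerationGenerator M lam) x
      = (16 * π * lam / (6 * (1 - f M (x 1))) * cos (x 2)) •
        (Matrix.diagonal ![f M (x 1) * (1 - f M (x 1)),
          (3 * (1 - f M (x 1)) - 4) / f M (x 1), 0, 0]
          - (2 * x 1 ^ 2 * (1 + f M (x 1))) • gammaTensor x) := by
  have h1 := exterior_r_ne hM hx
  have h2 := exterior_f_ne hM hx
  -- Since `1 - f = 2M / r`, the prefactor `16πλ / (6 (1 - f))` equals `κ r`, and the raised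
  -- components become polynomials in `r`.
  set κ : ℝ := 16 * π * lam / (12 * M) with hκ
  have hr : ∀ c, pd c (fun y => -(κ * (y 1 ^ 2 - 2 * M * y 1) * cos (y 2))) x
      = ![0, -(κ * (2 * x 1 - 2 * M) * cos (x 2)), κ * (x 1 ^ 2 - 2 * M * x 1) * sin (x 2), 0] c := by
    refine pd_of_radial_polar (G := fun r θ => -(κ * (r ^ 2 - 2 * M * r) * cos θ)) hx
      (fun y _ => rfl) ?_ ?_
    · refine ((((hasDerivAt_pow 2 (x 1)).sub ((hasDerivAt_id (x 1)).const_mul (2 * M))).const_mul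
        κ).mul_const (cos (x 2))).neg.congr_deriv ?_
      simp
    · refine ((hasDerivAt_cos (x 2)).const_mul (κ * (x 1 ^ 2 - 2 * M * x 1))).neg.congr_deriv ?_
      simp
  have hθ : ∀ c, pd c (fun y => -(κ * y 1 * sin (y 2))) x
      = ![0, -(κ * sin (x 2)), -(κ * x 1 * cos (x 2)), 0] c := by
    refine pd_of_radial_polar (G := fun r θ => -(κ * r * sin θ)) hx (fun y _ => rfl) ?_ ?_
    · refine (((hasDerivAt_id (x 1)).const_mul κ).mul_const (sin (x 2))).neg.congr_deriv ?_
      simp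
    · exact ((hasDerivAt_sin (x 2)).const_mul (κ * x 1)).neg
  have h0 : ∀ c, pd c (fun _ => (0 : ℝ)) x = 0 := fun c => by simp [pd]
  have hpd : ∀ b c, pd c ((![fun _ => 0, fun y => -(κ * (y 1 ^ 2 - 2 * M * y 1) * cos (y 2)),
      fun y => -(κ * y 1 * sin (y 2)), fun _ => 0] : Fin 4 → (Fin 4 → ℝ) → ℝ) b) x
      = !![0, 0, 0, 0;
          0, -(κ * (2 * x 1 - 2 * M) * cos (x 2)), κ * (x 1 ^ 2 - 2 * M * x 1) * sin (x 2), 0;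
          0, -(κ * sin (x 2)), -(κ * x 1 * cos (x 2)), 0;
          0, 0, 0, 0] b c := by
    intro b c
    fin_cases b
    · exact (h0 c).trans (by fin_cases c <;> rfl)
    · exact hr c
    · exact hθ c
    · exact (h0 c).trans (by fin_cases c <;> rfl)
  ext a b
  rw [lieMetric_schwarzschild hM hx
    (U := ![fun _ => 0, fun y => -(κ * (y 1 ^ 2 - 2 * M * y 1) * cos (y 2)),
      fun y => -(κ * y 1 * sin (y 2)), fun _ => 0])
    fun y hy c => by
      have h1 := exterior_r_ne hM hy
      have h2 := exterior_f_ne hM hy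
      fin_cases c
      · simp [accelerationGenerator]
      · simp [accelerationGenerator, gDiag, hκ]
        rw [eq_inv_mul_iff_mul_eq₀ h2]
        simp only [f]
        field_simp
        ring
      · simp [accelerationGenerator, gDiag, hκ, f]
        field_simp
        ring
      · simp [accelerationGenerator], hpd, hpd]
  -- Eliminating `M` in favour of `f` makes the remaining goals identities in the independent
  -- symbols `r` and `f`.
  have hM' : M = x 1 * (1 - f M (x 1)) / 2 := by
    simp only [f]
    field_simp
    ring
  have h3 : 1 - f M (x 1) ≠ 0 := by
    intro h
    rw [h] at hM'
    linarith
  have hκ' : κ = 16 * π * lam / (6 * (x 1 * (1 - f M (x 1)))) := by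
    rw [hκ]
    congr 1
    nth_rewrite 1 [hM']
    ring
  rw [hκ']
  clear_value κ
  clear hκ hpd hr hθ h0 hκ'
  fin_cases a <;> fin_cases b <;>
    simp [gDiag, gDiagR, gDiagT, gammaTensor] <;> field_simp
  all_goals
    generalize f M (x 1) = F at *
    subst hM'
    ring

end Lie

/-! ### The monopole -/

section Monopole

variable {M M₁ α₁ C₁ : ℝ} {Υ : ℝ → ℝ → ℝ} {x : Fin 4 → ℝ}

theorem modePart_zero_linCMetric (hM : 0 < M) (hx : x ∈ exterior M) :
    modePart 0 (linCMetric M M₁ α₁ C₁) x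
      = (2 * M₁ / x 1) • massTensor M x + (x 1 ^ 2 * C₁) • gammaTensor x := by
  have h1 := exterior_r_ne hM hx
  have h2 := exterior_f_ne hM hx
  have hA : modeAngular M α₁ C₁ 0 (x 2) = 0 := by
    simp [modeAngular, harm2_of_le_one (zero_le_one)]
  rw [modePart_linCMetric hM 0 hx.1]
  ext a b
  fin_cases a <;> fin_cases b <;>
    simp [diagPert, gDiag, modeJet, massTensor, gammaTensor, hA] <;> field_simp

theorem exists_isMassGauge (hM : 0 < M) : ∃ Υ, IsMassGauge M M₁ Υ := by
  -- For `Υ` linear in `t` and independent of `r` the derivative terms vanish; as `3 (1 - f) = 6M /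
  -- r`, the equation becomes `6 M Υ = 8 M₁ t`.
  refine ⟨fun t _ => 4 * M₁ / (3 * M) * t, ?_, fun t r hr => ?_⟩
  · fun_prop
  · have hr0 : r ≠ 0 := by linarith
    have hd : dt (fun t _ => 4 * M₁ / (3 * M) * t) = fun _ _ => 4 * M₁ / (3 * M) := by
      ext t r
      simp [dt]
    rw [hd]
    simp [dt, dr, f]
    field_simp
    ring

theorem dt_add_linear (hΥ : ContDiffOn ℝ 3 (fun p : ℝ × ℝ => Υ p.1 p.2) (exteriorTR M)) {t r : ℝ}
    (hr : 2 * M < r) : dt (fun t r => Υ t r + 2 * C₁ * t) t r = dt Υ t r + 2 * C₁ := by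
  have h := (hasDerivAt_dt' (differentiableAt_of_contDiffOn (t := t) hΥ (by simp) hr)).add
    ((hasDerivAt_id t).const_mul (2 * C₁))
  exact h.deriv.trans (by simp)

theorem dr_add_linear (t r : ℝ) : dr (fun t r => Υ t r + 2 * C₁ * t) t r = dr Υ t r := by
  simp [dr]

theorem hasDerivAt_f_mul {u : ℝ → ℝ} {u' r : ℝ} (hr : r ≠ 0) (hu : HasDerivAt u u' r) :
    HasDerivAt (fun s => f M s * u s) ((1 - f M r) / r * u r + f M r * u') r :=
  (hasDerivAt_f hr).mul hu

/-- The time derivative of the equation of a gauge function. -/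
theorem IsMassGauge.dt_equation (hM : 0 < M) (h : IsMassGauge M M₁ Υ) {t r : ℝ} (hr : 2 * M < r) :
    -(1 / f M r) * dt (dt (dt Υ)) t r
      + ((1 - f M r) / r * dr (dt Υ) t r + f M r * dr (dr (dt Υ)) t r)
      + 1 / r ^ 2 * (3 * (1 - f M r)) * dt Υ t r - 4 / r ^ 3 * (2 * M₁) = 0 := by
  have hr0 : r ≠ 0 := by linarith
  have c0 := h.contDiffOn
  have ct := contDiffOn_dt (m := 2) c0 (by norm_num)
  have cr := contDiffOn_dr (m := 2) c0 (by norm_num)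
  have ctt := contDiffOn_dt (m := 1) ct (by norm_num)
  have crr := contDiffOn_dr (m := 1) cr (by norm_num)
  have e1 : ∀ s, -(1 / f M r) * dt (dt Υ) s r
      + ((1 - f M r) / r * dr Υ s r + f M r * dr (dr Υ) s r)
      + 1 / r ^ 2 * (3 * (1 - f M r)) * Υ s r - 4 / r ^ 3 * (2 * M₁ * s) = 0 := fun s => by
    have h1 := h.equation s r hr
    have h2 : dr (fun τ ρ => f M ρ * dr Υ τ ρ) s r
        = (1 - f M r) / r * dr Υ s r + f M r * dr (dr Υ) s r :=
      (hasDerivAt_f_mul hr0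
        (hasDerivAt_dr' (differentiableAt_of_contDiffOn cr (by simp) hr))).deriv
    rwa [h2] at h1
  have d0 := hasDerivAt_dt' (differentiableAt_of_contDiffOn (t := t) c0 (by simp) hr)
  have dtt := hasDerivAt_dt' (differentiableAt_of_contDiffOn (t := t) ctt (by simp) hr)
  have d1 := hasDerivAt_dt' (differentiableAt_of_contDiffOn (t := t) cr (by simp) hr)
  have d2 := hasDerivAt_dt' (differentiableAt_of_contDiffOn (t := t) crr (by simp) hr)
  have hd := (((dtt.const_mul (-(1 / f M r))).add ((d1.const_mul ((1 - f M r) / r)).add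
    (d2.const_mul (f M r)))).add (d0.const_mul (1 / r ^ 2 * (3 * (1 - f M r))))).sub
    (((hasDerivAt_id t).const_mul (2 * M₁)).const_mul (4 / r ^ 3))
  have hz : HasDerivAt (fun _ => (0 : ℝ)) _ t := hd.congr_of_eventuallyEq
    (Eventually.of_forall fun s => (e1 s).symm)
  have hz' := hz.unique (hasDerivAt_const t (0 : ℝ))
  -- Moving `∂_t` past `∂_r²` takes two exchanges, the first applied to `∂_r Υ`; this is where `C³`
  -- is needed.
  have hc : ∀ ρ, 2 * M < ρ → dt (dr Υ) t ρ = dr (dt Υ) t ρ := fun ρ hρ =>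
    dt_dr_comm (c0.of_le (by norm_num)) hρ
  have hc2 : dt (dr (dr Υ)) t r = dr (dr (dt Υ)) t r := by
    rw [dt_dr_comm cr hr]
    refine EventuallyEq.deriv_eq ?_
    filter_upwards [lt_mem_nhds hr] with ρ hρ using hc ρ hρ
  rw [hc r hr, hc2] at hz'
  linarith

theorem isMonopoleData_of_isMassGauge (hM : 0 < M) (h : IsMassGauge M M₁ Υ) :
    IsMonopoleData M M₁ (stringMonopoleSource M (tension M α₁ C₁ 0))
      (fun _ r => (1 - 3 * f M r) / (16 * π) * r * C₁) (fun _ _ => 0)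
      (fun t r => Υ t r + 2 * C₁ * t) (fun _ => 0) (fun _ => 0) := by
  have hpi := pi_ne_zero
  have hten : tension M α₁ C₁ 0 = -(C₁ / (8 * π)) := by
    simp [tension]
    field_simp
    ring
  have c0 := h.contDiffOn
  have ct := contDiffOn_dt (m := 2) c0 (by norm_num)
  have ctr := contDiffOn_dr (m := 1) ct (by norm_num)
  constructor
  · intro t r hr
    simp [stringMonopoleSource, dt, dr]
  · intro t r hr
    have hr0 : r ≠ 0 := by linarith
    have hf0 := (f_pos hM hr).ne'
    have hd : dr (fun _ s => -tension M α₁ C₁ 0 / (f M s * s ^ 2)) t r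
        = tension M α₁ C₁ 0 * ((1 - f M r) / r * r ^ 2 + f M r * (2 * r)) / (f M r * r ^ 2) ^ 2 := by
      have h := (hasDerivAt_const r (-tension M α₁ C₁ 0)).div
        ((hasDerivAt_f (M := M) hr0).mul (hasDerivAt_pow 2 r))
        (mul_ne_zero hf0 (pow_ne_zero 2 hr0))
      refine h.deriv.trans ?_
      simp
    simp only [stringMonopoleSource]
    rw [hd]
    simp [dt]
    field_simp
    ring
  · intro t r hr
    have hr0 : r ≠ 0 := by linarith
    have hf0 := (f_pos hM hr).ne'
    have h := (((((hasDerivAt_f (M := M) hr0).const_mul 3).const_sub 1).div_const (16 * π)).mul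
      (hasDerivAt_id r)).mul_const C₁
    refine h.congr_deriv ?_
    simp [stringMonopoleSource, hten]
    field_simp
    ring
  · intro t r hr
    have hr0 : r ≠ 0 := by linarith
    have hf0 := (f_pos hM hr).ne'
    refine (hasDerivAt_const t (0 : ℝ)).congr_deriv ?_
    simp [stringMonopoleSource]
    field_simp
    ring
  · intro r _ _
    simpa using hasDerivAt_const r (0 : ℝ)
  · exact c0.add (by fun_prop)
  · intro t r hr
    have hr0 : r ≠ 0 := by linarith
    have hf0 := (f_pos hM hr).ne'
    have e1 : dt (dt (dt fun t r => Υ t r + 2 * C₁ * t)) t r = dt (dt (dt Υ)) t r := by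
      have e : (fun s => dt (dt fun t r => Υ t r + 2 * C₁ * t) s r) = fun s => dt (dt Υ) s r := by
        ext s
        have e' : (fun s => dt (fun t r => Υ t r + 2 * C₁ * t) s r)
            = fun s => dt Υ s r + 2 * C₁ := by
          ext s
          exact dt_add_linear c0 hr
        exact (congrArg (fun u => deriv u s) e').trans (by simp [dt])
      exact congrArg (fun u => deriv u t) e
    have e2 : ∀ ρ, 2 * M < ρ → dr (dt fun t r => Υ t r + 2 * C₁ * t) t ρ = dr (dt Υ) t ρ := by
      intro ρ hρ
      have e : (fun s => dt (fun t r => Υ t r + 2 * C₁ * t) t s)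
          =ᶠ[𝓝 ρ] fun s => dt Υ t s + 2 * C₁ := by
        filter_upwards [lt_mem_nhds hρ] with s hs using dt_add_linear c0 hs
      exact e.deriv_eq.trans (by simp [dr])
    have e3 : dr (fun τ ρ => f M ρ * dr (dt fun t r => Υ t r + 2 * C₁ * t) τ ρ) t r
        = (1 - f M r) / r * dr (dt Υ) t r + f M r * dr (dr (dt Υ)) t r := by
      have e : (fun ρ => f M ρ * dr (dt fun t r => Υ t r + 2 * C₁ * t) t ρ)
          =ᶠ[𝓝 r] fun ρ => f M ρ * dr (dt Υ) t ρ := by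
        filter_upwards [lt_mem_nhds hr] with ρ hρ
        rw [e2 ρ hρ]
      exact e.deriv_eq.trans (hasDerivAt_f_mul hr0
        (hasDerivAt_dr' (differentiableAt_of_contDiffOn ctr (by simp) hr))).deriv
    have hE := h.dt_equation hM hr (t := t)
    rw [e1, e3, dt_add_linear c0 hr]
    simp only [stringMonopoleSource, hten]
    -- The shift of `F` by `2 C₁`, together with the conicity part of the antiderivative, gives `4
    -- C₁ / r²`: the `f`-dependence cancels, and this is exactly the string source.
    have h5 : 1 / r ^ 2 * (3 * (1 - f M r)) * (2 * C₁)
        + 4 / r ^ 3 * (-2 * (M₁ + 4 * π * ((1 - 3 * f M r) / (16 * π) * r * C₁)))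
        = -(4 / r ^ 3 * (2 * M₁)) + 16 * π * (-(1 / f M r) * (f M r * -(C₁ / (8 * π)) / r ^ 2)
          + f M r * (- -(C₁ / (8 * π)) / (f M r * r ^ 2))) := by
      field_simp
      ring
    linarith

theorem monopoleGenerator_eq (h : IsMassGauge M M₁ Υ) (hx : x ∈ exterior M) :
    monopoleGenerator M (fun t r => Υ t r + 2 * C₁ * t) (fun _ => 0) (fun _ => 0) x
      = massGenerator M Υ x + conicityGenerator M C₁ x := by
  ext a
  simp only [monopoleGenerator, massGenerator, conicityGenerator, dt_add_linear h.contDiffOn hx.1,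
    dr_add_linear]
  fin_cases a
  · simp
    ring
  · simp
    ring
  · simp
  · simp

theorem differentiableAt_f_chart (hM : 0 < M) (hx : x ∈ exterior M) :
    DifferentiableAt ℝ (fun y : Fin 4 → ℝ => f M (y 1)) x :=
  DifferentiableAt.comp (g := f M) x (hasDerivAt_f (exterior_r_ne hM hx)).differentiableAt
    (differentiableAt_apply 1 x)

theorem differentiableAt_massGenerator (hM : 0 < M) (h : IsMassGauge M M₁ Υ)
    (hx : x ∈ exterior M) (c : Fin 4) :
    DifferentiableAt ℝ (fun y => massGenerator M Υ y c) x := by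
  have c0 := h.contDiffOn
  have d0 := differentiableAt_chart c0 (by simp) hx
  have d1 := differentiableAt_chart (contDiffOn_dt (m := 2) c0 (by norm_num)) (by simp) hx
  have d2 := differentiableAt_chart (contDiffOn_dr (m := 2) c0 (by norm_num)) (by simp) hx
  have df := differentiableAt_f_chart hM hx
  have hr : DifferentiableAt ℝ (fun y : Fin 4 → ℝ => y 1) x := differentiableAt_apply 1 x
  fin_cases c
  · exact (df.const_mul (1 / 4)).mul (d0.add (hr.mul d2))
  · show DifferentiableAt ℝ (fun y => 1 / (4 * f M (y 1)) * y 1 * dt Υ (y 0) (y 1)) x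
    simp only [one_div]
    exact (((df.const_mul 4).inv (mul_ne_zero four_ne_zero (exterior_f_ne hM hx))).mul hr).mul d1
  · exact differentiableAt_const (0 : ℝ)
  · exact differentiableAt_const (0 : ℝ)

theorem differentiableAt_conicityGenerator (hM : 0 < M) (hx : x ∈ exterior M) (c : Fin 4) :
    DifferentiableAt ℝ (fun y => conicityGenerator M C₁ y c) x := by
  have df := differentiableAt_f_chart hM hx
  have ht : DifferentiableAt ℝ (fun y : Fin 4 → ℝ => y 0) x := differentiableAt_apply 0 x
  have hr : DifferentiableAt ℝ (fun y : Fin 4 → ℝ => y 1) x := differentiableAt_apply 1 x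
  fin_cases c
  · exact ((df.const_mul (1 / 2)).mul ht).mul_const C₁
  · show DifferentiableAt ℝ (fun y => y 1 / (2 * f M (y 1)) * C₁) x
    simp only [div_eq_mul_inv]
    exact (hr.mul ((df.const_mul 2).inv (mul_ne_zero two_ne_zero (exterior_f_ne hM hx)))).mul_const C₁
  · exact differentiableAt_const (0 : ℝ)
  · exact differentiableAt_const (0 : ℝ)

theorem modePart_zero_add_lieMetric (hM : 0 < M) (h : IsMassGauge M M₁ Υ) (hx : x ∈ exterior M) :
    modePart 0 (linCMetric M M₁ α₁ C₁) x + lieMetric (schwarzschild M) (massGenerator M Υ) x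
      = (2 * M₁ / x 1 + (1 - 3 * f M (x 1)) / 2 * C₁) • massTensor M x
        + lieMetric (schwarzschild M)
            (fun y => massGenerator M Υ y + conicityGenerator M C₁ y) x := by
  rw [lieMetric_add hM hx (differentiableAt_massGenerator hM h hx)
    (differentiableAt_conicityGenerator hM hx), lieMetric_conicityGenerator hM C₁ hx,
    modePart_zero_linCMetric hM hx]
  module

theorem modePart_zero_add_lieMetric_eq_monopoleSolution (hM : 0 < M) (h : IsMassGauge M M₁ Υ)
    (hx : x ∈ exterior M) :
    modePart 0 (linCMetric M M₁ α₁ C₁) x + lieMetric (schwarzschild M) (massGenerator M Υ) x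
      = monopoleSolution M M₁ (fun _ r => (1 - 3 * f M r) / (16 * π) * r * C₁)
          (fun _ _ => 0) (fun t r => Υ t r + 2 * C₁ * t) (fun _ => 0) (fun _ => 0) x := by
  have h1 := exterior_r_ne hM hx
  have hpi := pi_ne_zero
  rw [modePart_zero_add_lieMetric hM h hx, monopoleSolution,
    lieMetric_congr hM hx (fun y hy => (monopoleGenerator_eq h hy).symm)]
  have hc : 2 / x 1 * (M₁ + 4 * π * ((1 - 3 * f M (x 1)) / (16 * π) * x 1 * C₁))
      = 2 * M₁ / x 1 + (1 - 3 * f M (x 1)) / 2 * C₁ := by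
    field_simp
    ring
  simp only [hc, mul_zero, zero_smul, add_zero]

end Monopole

/-! ### The dipole -/

section Dipole

variable {M M₁ α₁ C₁ : ℝ} {x : Fin 4 → ℝ}

theorem modePart_one_linCMetric (hM : 0 < M) (hx : x ∈ exterior M) :
    modePart 1 (linCMetric M M₁ α₁ C₁) x = (-2 * α₁ * x 1 * cos (x 2)) • schwarzschild M x := by
  have hA : modeAngular M α₁ C₁ 1 (x 2) = 0 := by
    simp [modeAngular, harm2_of_le_one (le_refl 1)]
  rw [modePart_linCMetric hM 1 hx.1, schwarzschild_eq]
  ext a b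
  fin_cases a <;> fin_cases b <;> simp [diagPert, modeJet, hA] <;> ring

/-- With `Λ = 3 (1 - f)` the bracket collapses to `9 (1 - f)³`. This makes elementary static
solutions available. -/
theorem dipolePotential_eq (hM : 0 < M) {r : ℝ} (hr : 2 * M < r) :
    dipolePotential M r = (1 - f M r) / r ^ 2 := by
  have hr0 : r ≠ 0 := by linarith
  have h : 1 - f M r ≠ 0 := by
    simp only [f, sub_sub_cancel]
    positivity
  simp only [dipolePotential, dipoleLambda]
  field_simp
  ring

theorem hasDerivAt_stringSource_tt {r : ℝ} (lam : ℝ) (hr0 : r ≠ 0) :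
    HasDerivAt (fun s => f M s * lam / s ^ 2) (lam * (1 - 3 * f M r) / r ^ 3) r := by
  refine (((hasDerivAt_f hr0).mul_const lam).div (hasDerivAt_pow 2 r)
    (pow_ne_zero 2 hr0)).congr_deriv ?_
  simp
  field_simp
  ring

theorem hasDerivAt_stringSource_rr {r : ℝ} (lam : ℝ) (hr0 : r ≠ 0) (hf0 : f M r ≠ 0) :
    HasDerivAt (fun s => -lam / (f M s * s ^ 2)) (lam * (1 + f M r) / (f M r ^ 2 * r ^ 3)) r := by
  refine ((hasDerivAt_const r (-lam)).div ((hasDerivAt_f hr0).mul (hasDerivAt_pow 2 r))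
    (mul_ne_zero hf0 (pow_ne_zero 2 hr0))).congr_deriv ?_
  simp
  field_simp
  ring

theorem exists_isDipoleData (hM : 0 < M) (lam : ℝ) :
    ∃ Φ, IsDipoleData M (stringDipoleSource M lam) Φ := by
  -- The static homogeneous equation is solved by `Φ = r`. Applied to `r log r`, the operator gives
  -- `1 / r`, and the right-hand side is `(16πλ / 6) / r`.
  refine ⟨fun _ r => 16 * π * lam / 6 * (r * log r), ?_, ?_, ?_, ?_, ?_⟩
  · intro t r hr
    simp [stringDipoleSource, dt, dr]
  · intro t r hr
    have hr0 : r ≠ 0 := by linarith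
    have hf0 := (f_pos hM hr).ne'
    simp only [stringDipoleSource]
    rw [show dr (fun _ r => -lam / (f M r * r ^ 2)) t r = _ from
      (hasDerivAt_stringSource_rr lam hr0 hf0).deriv]
    simp [dt]
    field_simp
    ring
  · intro t r hr
    simp [stringDipoleSource, dt, dr]
  · intro p hp
    have hp0 : p.2 ≠ 0 := by
      have : 2 * M < p.2 := hp
      linarith
    exact ContDiffAt.contDiffWithinAt (contDiffAt_const.mul (contDiffAt_snd.mul
      (contDiffAt_snd.log hp0)))
  · intro t r hr
    have hr0 : r ≠ 0 := by linarith
    have hf0 := (f_pos hM hr).ne'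
    have h1f : 1 - f M r ≠ 0 := by
      simp only [f, sub_sub_cancel]
      positivity
    have hd : ∀ ρ, 2 * M < ρ → dr (fun _ r => 16 * π * lam / 6 * (r * log r)) t ρ
        = 16 * π * lam / 6 * (log ρ + 1) := by
      intro ρ hρ
      have hρ0 : ρ ≠ 0 := by linarith
      exact (((hasDerivAt_mul_log hρ0)).const_mul (16 * π * lam / 6)).deriv
    have hd2 : dr (fun τ ρ => f M ρ * dr (fun _ r => 16 * π * lam / 6 * (r * log r)) τ ρ) t r
        = (1 - f M r) / r * (16 * π * lam / 6 * (log r + 1))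
          + f M r * (16 * π * lam / 6 * (1 / r)) := by
      have e : (fun ρ => f M ρ * dr (fun _ r => 16 * π * lam / 6 * (r * log r)) t ρ)
          =ᶠ[𝓝 r] fun ρ => f M ρ * (16 * π * lam / 6 * (log ρ + 1)) := by
        filter_upwards [lt_mem_nhds hr] with ρ hρ
        rw [hd ρ hρ]
      refine e.deriv_eq.trans (hasDerivAt_f_mul hr0 ?_).deriv
      simpa using ((hasDerivAt_log hr0).add_const 1).const_mul (16 * π * lam / 6)
    rw [hd2, dipolePotential_eq hM hr]
    simp only [dipoleMasterSource, stringDipoleSource, dipoleLambda]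
    rw [show dr (fun _ r => -lam / (f M r * r ^ 2)) t r = _ from
      (hasDerivAt_stringSource_rr lam hr0 hf0).deriv,
      show dr (fun _ r => f M r * lam / r ^ 2) t r = _ from
      (hasDerivAt_stringSource_tt lam hr0).deriv]
    simp [dt]
    field_simp
    ring

theorem differentiableAt_dipoleGenerator {Φ : ℝ → ℝ → ℝ}
    (hΦ : ContDiffOn ℝ 2 (fun p : ℝ × ℝ => Φ p.1 p.2) (exteriorTR M)) (hx : x ∈ exterior M)
    (c : Fin 4) : DifferentiableAt ℝ (fun y => dipoleGenerator Φ y c) x := by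
  have d0 := differentiableAt_chart hΦ (by simp) hx
  have d1 := differentiableAt_chart (contDiffOn_dt (m := 1) hΦ (by norm_num)) (by simp) hx
  have d2 := differentiableAt_chart (contDiffOn_dr (m := 1) hΦ (by norm_num)) (by simp) hx
  have hr : DifferentiableAt ℝ (fun y : Fin 4 → ℝ => y 1) x := differentiableAt_apply 1 x
  have hc : DifferentiableAt ℝ (fun y : Fin 4 → ℝ => cos (y 2)) x := by fun_prop
  have hs : DifferentiableAt ℝ (fun y : Fin 4 → ℝ => sin (y 2)) x := by fun_prop
  fin_cases c
  · exact (hr.neg.mul d1).mul hc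
  · exact (d0.sub (hr.mul d2)).mul hc
  · exact (hr.neg.mul d0).mul hs
  · exact differentiableAt_const (0 : ℝ)

theorem one_sub_f_ne (hM : 0 < M) (hx : x ∈ exterior M) : 1 - f M (x 1) ≠ 0 := by
  have h1 := exterior_r_ne hM hx
  simp only [f, sub_sub_cancel]
  positivity

theorem differentiableAt_accelerationGenerator (hM : 0 < M) (lam : ℝ) (hx : x ∈ exterior M)
    (c : Fin 4) : DifferentiableAt ℝ (fun y => accelerationGenerator M lam y c) x := by
  have df := differentiableAt_f_chart hM hx
  have hr : DifferentiableAt ℝ (fun y : Fin 4 → ℝ => y 1) x := differentiableAt_apply 1 x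
  have hc : DifferentiableAt ℝ (fun y : Fin 4 → ℝ => cos (y 2)) x := by fun_prop
  have hs : DifferentiableAt ℝ (fun y : Fin 4 → ℝ => sin (y 2)) x := by fun_prop
  have hi : DifferentiableAt ℝ (fun y : Fin 4 → ℝ => (6 * (1 - f M (y 1)))⁻¹) x :=
    ((df.const_sub 1).const_mul 6).inv (mul_ne_zero (by norm_num) (one_sub_f_ne hM hx))
  fin_cases c
  · exact differentiableAt_const (0 : ℝ)
  · exact ((hr.mul hi).neg.mul_const _).mul hc
  · exact (((hr.pow 2).mul hi).neg.mul_const _).mul hs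
  · exact differentiableAt_const (0 : ℝ)

/-- `Φ` enters both sides through the same Lie derivative, which cancels. What remains is an
identity for the explicit source terms, whose deviation from a multiple of `g` is the Lie derivative
along `W`. -/
theorem dipoleSolution_stringDipoleSource (hM : 0 < M) (lam : ℝ) {Φ : ℝ → ℝ → ℝ}
    (hΦ : ContDiffOn ℝ 2 (fun p : ℝ × ℝ => Φ p.1 p.2) (exteriorTR M)) (hx : x ∈ exterior M) :
    dipoleSolution M (stringDipoleSource M lam) Φ x
      = lieMetric (schwarzschild M)
          (fun y => dipoleGenerator Φ y + accelerationGenerator M lam y) x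
        + (16 * π * lam / (3 * (1 - f M (x 1))) * cos (x 2)) • schwarzschild M x := by
  have h1 := exterior_r_ne hM hx
  have h2 := exterior_f_ne hM hx
  have h3 := one_sub_f_ne hM hx
  rw [lieMetric_add hM hx (differentiableAt_dipoleGenerator hΦ hx)
    (differentiableAt_accelerationGenerator hM lam hx), lieMetric_accelerationGenerator hM lam hx,
    add_assoc, dipoleSolution, sub_eq_add_neg, schwarzschild_eq]
  congr 1
  simp only [stringDipoleSource]
  rw [show dr (fun _ r => -lam / (f M r * r ^ 2)) (x 0) (x 1) = _ from
    (hasDerivAt_stringSource_rr lam h1 h2).deriv,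
    show dr (fun _ r => f M r * lam / r ^ 2) (x 0) (x 1) = _ from
    (hasDerivAt_stringSource_tt lam h1).deriv]
  have hdt : dt (fun _ r => f M r * lam / r ^ 2) (x 0) (x 1) = 0 := by simp [dt]
  rw [hdt]
  ext a b
  fin_cases a <;> fin_cases b <;> simp [gDiag, gammaTensor] <;> field_simp <;> ring

theorem tension_one (M α₁ C₁ : ℝ) : 16 * π * tension M α₁ C₁ 1 = -12 * α₁ * M := by
  have hpi := pi_ne_zero
  simp [tension]
  field_simp
  ring

theorem conformal_eq_modePart_one_iff (hM : 0 < M) (lam : ℝ) :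
    (∀ x ∈ exterior M,
      (16 * π * lam / (3 * (1 - f M (x 1))) * cos (x 2)) • schwarzschild M x
        = modePart 1 (linCMetric M M₁ α₁ C₁) x) ↔ lam = tension M α₁ C₁ 1 := by
  have hpi := pi_pos
  constructor
  · intro h
    -- One point determines `λ`: here `cos θ ≠ 0`, and `f = 1/3` is a plain number.
    have hx : (![0, 3 * M, π / 3, 0] : Fin 4 → ℝ) ∈ exterior M := by
      refine ⟨?_, ?_, ?_⟩ <;> simp <;> linarith
    have h0 := congrFun (congrFun (h _ hx) 0) 0
    rw [modePart_one_linCMetric hM hx, schwarzschild_eq] at h0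
    have hf : f M (3 * M) = 1 / 3 := by
      simp only [f]
      field_simp
      norm_num
    simp [gDiag, hf] at h0
    have h1 := tension_one M α₁ C₁
    have h2 : 16 * π * lam = 16 * π * tension M α₁ C₁ 1 := by
      rw [h1]
      field_simp at h0
      norm_num at h0
      linarith
    exact mul_left_cancel₀ (by positivity) h2
  · rintro rfl x hx
    have h1 := exterior_r_ne hM hx
    rw [modePart_one_linCMetric hM hx, tension_one]
    congr 1
    simp only [f, sub_sub_cancel]
    field_simp
    norm_num
    left
    ring

end Dipole

/-! ### The sum over the modes -/

/-- The pole, where `P_l = 1`, lies outside the chart, so continuity is used to move slightly off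
it. The resulting point makes `λ` unique. -/
theorem exists_harm_ne_zero (l : ℕ) : ∃ θ, 0 < θ ∧ θ < π ∧ harm l θ ≠ 0 := by
  have h1 : ∀ᶠ θ in 𝓝[>] (0 : ℝ), harm l θ ≠ 0 :=
    ((continuous_harm l).continuousAt.eventually_ne (by simp [harm_zero])).filter_mono
      nhdsWithin_le_nhds
  have h2 : ∀ᶠ θ in 𝓝[>] (0 : ℝ), θ ∈ Set.Ioo 0 π := Ioo_mem_nhdsGT pi_pos
  obtain ⟨θ, h3, h4⟩ := (h1.and h2).exists
  exact ⟨θ, h4.1, h4.2, h3⟩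

theorem stressMode_eq_iff {M M₁ α₁ C₁ : ℝ} (hM : 0 < M) (l : ℕ) (lam : ℝ) :
    (∀ x ∈ exterior M, stressMode M M₁ α₁ C₁ l x
      = (-(1 / x 1 ^ 2) * (lam * harm l (x 2))) • yTensor M x) ↔
    16 * π * lam = -(2 * l + 1) * ((2 * α₁ * M + C₁) + (-(2 * α₁ * M) + C₁) * (-1) ^ l) := by
  have hpi := pi_ne_zero
  have hten : 16 * π * tension M α₁ C₁ l
      = -(2 * l + 1) * ((2 * α₁ * M + C₁) + (-(2 * α₁ * M) + C₁) * (-1) ^ l) := by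
    unfold tension
    field_simp
  rw [← hten]
  constructor
  · intro h
    obtain ⟨θ, h0, h1, h2⟩ := exists_harm_ne_zero l
    have hx : (![0, 3 * M, θ, 0] : Fin 4 → ℝ) ∈ exterior M := by
      refine ⟨?_, ?_, ?_⟩ <;> simp <;> linarith
    have h3 := congrFun (congrFun (h _ hx) 0) 0
    rw [stressMode_eq hM l hx] at h3
    have hf : f M (3 * M) ≠ 0 := (f_pos hM (by linarith)).ne'
    simp [yTensor, hf, hM.ne', h2] at h3
    rw [h3]
  · intro h x hx
    rw [stressMode_eq hM l hx, mul_left_cancel₀ (by positivity) h]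

/-- The stress is known only off the axis; the endpoints of the `θ`-integral do not matter because
`sin θ` vanishes there. -/
theorem sphereIntegral_congr_Ioo {u v : ℝ → ℝ → ℝ} (h : ∀ θ φ, 0 < θ → θ < π → u θ φ = v θ φ) :
    sphereIntegral u = sphereIntegral v := by
  unfold sphereIntegral
  congr 1
  ext φ
  refine intervalIntegral.integral_congr fun θ hθ => ?_
  rw [Set.uIcc_of_le pi_pos.le] at hθ
  rcases hθ.1.eq_or_lt with h0 | h0
  · simp [← h0]
  rcases hθ.2.eq_or_lt with h1 | h1
  · simp [h1]
  · simp only [h θ φ h0 h1]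

theorem sphereIntegral_const_mul (c : ℝ) (u : ℝ → ℝ → ℝ) :
    sphereIntegral (fun θ φ => c * u θ φ) = c * sphereIntegral u := by
  simp only [sphereIntegral, mul_assoc, intervalIntegral.integral_const_mul]

theorem sphereIntegral_stressMode {M M₁ α₁ C₁ : ℝ} (hM : 0 < M) (l : ℕ) {t r : ℝ} (hr : 2 * M < r)
    (a b : Fin 4) (u : ℝ → ℝ → ℝ) :
    sphereIntegral (fun θ φ => stressMode M M₁ α₁ C₁ l ![t, r, θ, φ] a b * u θ φ)
      = -(1 / r ^ 2) * yTensor M ![t, r, π / 2, 0] a b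
        * (tension M α₁ C₁ l * sphereIntegral fun θ φ => harm l θ * u θ φ) := by
  rw [← mul_assoc, ← sphereIntegral_const_mul]
  refine sphereIntegral_congr_Ioo fun θ φ h0 h1 => ?_
  have hx : (![t, r, θ, φ] : Fin 4 → ℝ) ∈ exterior M := ⟨by simpa using hr, by simpa using h0,
    by simpa using h1⟩
  rw [stressMode_eq hM l hx]
  have hy : yTensor M ![t, r, θ, φ] = yTensor M ![t, r, π / 2, 0] := by simp [yTensor]
  rw [hy]
  simp
  ring

theorem tendsto_sum_stressMode {M M₁ α₁ C₁ : ℝ} (hM : 0 < M) {t r : ℝ} (hr : 2 * M < r)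
    (a b : Fin 4) {ψ : S2 → ℝ} (hψ : ContMDiff (𝓡 2) 𝓘(ℝ, ℝ) ∞ ψ) :
    Tendsto
      (fun N : ℕ => ∑ l ∈ Finset.range N, sphereIntegral fun θ φ =>
        stressMode M M₁ α₁ C₁ l ![t, r, θ, φ] a b * ψ (spherePoint θ φ))
      atTop
      (𝓝 (stringStress M (-(2 * α₁ * M + C₁) / 4) north t r a b ψ
        + stringStress M ((2 * α₁ * M - C₁) / 4) south t r a b ψ)) := by
  have h := (tendsto_sum_tension M α₁ C₁ hψ).const_mul
    (-(1 / r ^ 2) * yTensor M ![t, r, π / 2, 0] a b)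
  rw [mul_add] at h
  refine h.congr fun N => ?_
  rw [Finset.mul_sum]
  exact Finset.sum_congr rfl fun l _ => (sphereIntegral_stressMode hM l hr a b _).symm

end CMetricPert

end

/-! ### Assembly of the four claims. -/

open CMetricPert in
theorem mainTheorem3 (M M₁ α₁ C₁ : ℝ) (hM : 0 < M) :
    -- the l = 0 part, and its realization by the l = 0 solution
    ((∀ x ∈ exterior M, modePart 0 (linCMetric M M₁ α₁ C₁) x
        = (2 * M₁ / x 1) • massTensor M x + (x 1 ^ 2 * C₁) • gammaTensor x) ∧
      (∃ Υ, IsMassGauge M M₁ Υ) ∧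
      ∀ Υ, IsMassGauge M M₁ Υ →
        IsMonopoleData M M₁ (stringMonopoleSource M (tension M α₁ C₁ 0))
          (fun _ r => (1 - 3 * f M r) / (16 * π) * r * C₁) (fun _ _ => 0)
          (fun t r => Υ t r + 2 * C₁ * t) (fun _ => 0) (fun _ => 0) ∧
        ∀ x ∈ exterior M,
          monopoleGenerator M (fun t r => Υ t r + 2 * C₁ * t) (fun _ => 0) (fun _ => 0) x
            = massGenerator M Υ x + conicityGenerator M C₁ x ∧
          modePart 0 (linCMetric M M₁ α₁ C₁) x
              + lieMetric (schwarzschild M) (massGenerator M Υ) x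
            = (2 * M₁ / x 1 + (1 - 3 * f M (x 1)) / 2 * C₁) • massTensor M x
              + lieMetric (schwarzschild M)
                  (fun y => massGenerator M Υ y + conicityGenerator M C₁ y) x ∧
          modePart 0 (linCMetric M M₁ α₁ C₁) x
              + lieMetric (schwarzschild M) (massGenerator M Υ) x
            = monopoleSolution M M₁ (fun _ r => (1 - 3 * f M r) / (16 * π) * r * C₁)
                (fun _ _ => 0) (fun t r => Υ t r + 2 * C₁ * t) (fun _ => 0) (fun _ => 0) x) ∧
    -- the l = 1 part, and its realization by the l = 1 solution
    ((∀ x ∈ exterior M, modePart 1 (linCMetric M M₁ α₁ C₁) x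
        = (-2 * α₁ * x 1 * Real.cos (x 2)) • schwarzschild M x) ∧
      (∀ lam : ℝ, ∃ Φ, IsDipoleData M (stringDipoleSource M lam) Φ) ∧
      (∀ (lam : ℝ) (Φ : ℝ → ℝ → ℝ), IsDipoleData M (stringDipoleSource M lam) Φ →
        ∀ x ∈ exterior M,
          dipoleSolution M (stringDipoleSource M lam) Φ x
            = lieMetric (schwarzschild M)
                (fun y => dipoleGenerator Φ y + accelerationGenerator M lam y) x
              + (16 * Real.pi * lam / (3 * (1 - f M (x 1))) * Real.cos (x 2))
                • schwarzschild M x) ∧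
      (∀ lam : ℝ,
        (∀ x ∈ exterior M,
          (16 * Real.pi * lam / (3 * (1 - f M (x 1))) * Real.cos (x 2)) • schwarzschild M x
            = modePart 1 (linCMetric M M₁ α₁ C₁) x) ↔ lam = tension M α₁ C₁ 1) ∧
      (∀ Φ, IsDipoleData M (stringDipoleSource M (tension M α₁ C₁ 1)) Φ →
        ∀ x ∈ exterior M,
          dipoleSolution M (stringDipoleSource M (tension M α₁ C₁ 1)) Φ x
            = modePart 1 (linCMetric M M₁ α₁ C₁) x
              + lieMetric (schwarzschild M) (fun y => dipoleGenerator Φ y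
                  + accelerationGenerator M (tension M α₁ C₁ 1) y) x)) ∧
    -- the tension formula, for every l
    (∀ (l : ℕ) (lam : ℝ),
      (∀ x ∈ exterior M, stressMode M M₁ α₁ C₁ l x
        = (-(1 / x 1 ^ 2) * (lam * harm l (x 2))) • yTensor M x) ↔
      16 * Real.pi * lam
        = -(2 * l + 1) * ((2 * α₁ * M + C₁) + (-(2 * α₁ * M) + C₁) * (-1) ^ l)) ∧
    -- the sum over the modes
    (∀ t r : ℝ, 2 * M < r → ∀ (a b : Fin 4) (ψ : S2 → ℝ), ContMDiff (𝓡 2) 𝓘(ℝ, ℝ) ∞ ψ →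
      Tendsto
        (fun N : ℕ => ∑ l ∈ Finset.range N, sphereIntegral fun θ φ =>
          stressMode M M₁ α₁ C₁ l ![t, r, θ, φ] a b * ψ (spherePoint θ φ))
        atTop
        (𝓝 (stringStress M (-(2 * α₁ * M + C₁) / 4) north t r a b ψ
          + stringStress M ((2 * α₁ * M - C₁) / 4) south t r a b ψ))) := by
  refine ⟨⟨fun x hx => modePart_zero_linCMetric hM hx, exists_isMassGauge hM, fun Υ hΥ =>
      ⟨isMonopoleData_of_isMassGauge hM hΥ, fun x hx => ⟨monopoleGenerator_eq hΥ hx,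
        modePart_zero_add_lieMetric hM hΥ hx,
        modePart_zero_add_lieMetric_eq_monopoleSolution hM hΥ hx⟩⟩⟩,
    ⟨fun x hx => modePart_one_linCMetric hM hx, exists_isDipoleData hM,
      fun lam Φ hΦ x hx => dipoleSolution_stringDipoleSource hM lam hΦ.contDiffOn hx,
      conformal_eq_modePart_one_iff hM, fun Φ hΦ x hx => ?_⟩,
    stressMode_eq_iff hM, fun t r hr a b ψ hψ => tendsto_sum_stressMode hM hr a b hψ⟩
  rw [dipoleSolution_stringDipoleSource hM _ hΦ.contDiffOn hx,
    (conformal_eq_modePart_one_iff hM _).mpr rfl x hx, add_comm]
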